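/- **Setting.** A closed (locally orientable) $3$-orbifold $X$ is a closed PL $3$-manifold $|X|$ with a singular set $S(X)$: a finite union of circles and trivalent graphs, each component of $S(X)$ minus the vertices carrying an order $p\ge 2$, such that the orders at each vertex are, up to permutation, $(2,2,n)$ with $n\ge 2$, or $(2,3,n)$ with $n\in\{3,4,5\}$ (call these triples admissible), and such that $(|X|,S(X))$ is locally PL isomorphic to a discal orbifold. The discal $3$-orbifolds are the $3$-disc with empty singular set, with a trivial arc of order $p$, or with a trivial Y-graph (the cone over three boundary points) with admissible orders $(p,q,r)$. A *simple polyhedron* $P\subset |X|$ is a compact subpolyhedron such that the link of each point embeds in the circle with three radii; the *vertices* of $P$ are the points whose link is a circle with three radii. $P$ is *special* if every link is a circle with zero, two or three radii and, denoting by $S(P)$ the set of points whose link is a circle with two or three radii, $S(P)$ has no circle component and $P\setminus S(P)$ consists of open $2$-discs. A *spine* of $X$ is a simple polyhedron $P\subset|X|$ that meets $S(X)$ transversely, only at points of $P$ whose link is a circle and at non-vertex points of $S(X)$, and such that each component of $X\setminus P$ is isomorphic to an open discal $3$-orbifold. Let $c(P,S(X))$ be the number of vertices of $P$ plus $\sum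 (p_x-1)$ over $x\in P\cap S(X)$, where $p_x$ is the order of $S(X)$ at $x$. The *complexity* $c(X)$ is the minimum of $c(P,S(X))$ over all spines $P$ of $X$. A spine $P$ is *minimal* if $c(P,S(X))=c(X)$ and every proper subpolyhedron of $P$ that is also a spine of $X$ is homeomorphic to $P$. For $p\ge 2$ let $\mathbb S^3_{\rm c}(p)$, and for $(p,q,r)$ admissible let $\mathbb S^3_{\rm v}(p,q,r)$, be the orbifold obtained by mirroring in its boundary the discal orbifold whose singular set is an arc of order $p$, respectively a Y-graph of orders $p,q,r$. Let $\mathbb P^3$ and $L_{3,1}$ be the quotients of $S^3\subset\mathbb C^2$ by scalar multiplication by the square, respectively cube, roots of unity. In each of them let $F$ be a fibre of the Seifert fibration induced by the Hopf fibration (all fibres are nonsingular and isotopic), and let $(\mathbb P^3,F_p)$ and $(L_{3,1},F_p)$ be the orbifolds with singular set $F$ of order $p\geq 2$. For $p=1$ the symbols $\mathbb S^3_{\rm c}(1)$, $(\mathbb P^3,F_1)$, $(L_{3,1},F_1)$ denote the manifolds $S^3$, $\mathbb P^3$, $L_{3,1}$ with empty singular set. **Proposition.** (1) For every integer $p\ge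 1$, $$c(\mathbb S^3_{\rm c}(p))=c(\mathbb P^3,F_p)=c(L_{3,1},F_p)=p-1,$$ and no minimal spine of any of these orbifolds is special. (2) For every admissible triple $(p,q,r)$, $$c(\mathbb S^3_{\rm v}(p,q,r))=(p-1)+(q-1)+(r-1),$$ and no minimal spine of this orbifold is special. -/

import Mathlib

open Set Filter Topology

noncomputable section

namespace Orbifold3

/-! ### Piecewise linear maps and the piecewise linear groupoid -/

section PL

variable {E F G : Type*} [NormedAddCommGroup E] [NormedSpace ℝ E]
  [NormedAddCommGroup F] [NormedSpace ℝ F] [NormedAddCommGroup G] [NormedSpace ℝ G]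

/-- At each point of `s`, the map `f` takes the value of one of finitely many affine maps. -/
def FinitelyAffineOn (f : E → F) (s : Set E) : Prop :=
  ∃ T : Set (E →ᵃ[ℝ] F), T.Finite ∧ ∀ x ∈ s, ∃ A ∈ T, f x = A x

/-- Piecewise linear maps: continuous maps which, near every point, take their values among those
of finitely many affine maps. -/
def PLOn (f : E → F) (s : Set E) : Prop :=
  ContinuousOn f s ∧ ∀ x ∈ s, ∃ U ∈ 𝓝[s] x, FinitelyAffineOn f U

/-- A compact polyhedron: a finite union of convex hulls of finite sets. -/
def IsPolyhedron (A : Set E) : Prop :=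
  ∃ K : Set (Finset E), K.Finite ∧ A = ⋃ s ∈ K, convexHull ℝ (s : Set E)

/-- The germs `(A, a)` and `(B, b)` are PL homeomorphic: some neighbourhood of `a` in `A` is
carried by a PL homeomorphism, with `a ↦ b`, to some neighbourhood of `b` in `B`. -/
def PLGermEquiv (A : Set E) (a : E) (B : Set F) (b : F) : Prop :=
  ∃ h : PartialEquiv E F, h.source ⊆ A ∧ h.source ∈ 𝓝[A] a ∧ h.target ⊆ B ∧ h.target ∈ 𝓝[B] b ∧
    h a = b ∧ PLOn h h.source ∧ PLOn h.symm h.target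

theorem FinitelyAffineOn.mono {f : E → F} {s t : Set E} (h : FinitelyAffineOn f t) (hst : s ⊆ t) :
    FinitelyAffineOn f s := by
  obtain ⟨T, hT, hf⟩ := h
  exact ⟨T, hT, fun x hx => hf x (hst hx)⟩

theorem FinitelyAffineOn.congr {f g : E → F} {s : Set E} (h : FinitelyAffineOn f s)
    (hfg : ∀ x ∈ s, g x = f x) : FinitelyAffineOn g s := by
  obtain ⟨T, hT, hf⟩ := h
  exact ⟨T, hT, fun x hx => by rw [hfg x hx]; exact hf x hx⟩

theorem FinitelyAffineOn.affine (A : E →ᵃ[ℝ] F) (s : Set E) : FinitelyAffineOn (fun x => A x) s :=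
  ⟨{A}, finite_singleton A, fun _ _ => ⟨A, rfl, rfl⟩⟩

theorem FinitelyAffineOn.linear (A : E →ₗ[ℝ] F) (s : Set E) : FinitelyAffineOn (fun x => A x) s :=
  FinitelyAffineOn.affine A.toAffineMap s

theorem FinitelyAffineOn.const (c : F) (s : Set E) : FinitelyAffineOn (fun _ : E => c) s :=
  FinitelyAffineOn.affine (AffineMap.const ℝ E c) s

theorem FinitelyAffineOn.comp {f : E → F} {g : F → G} {s : Set E} {t : Set F}
    (hg : FinitelyAffineOn g t) (hf : FinitelyAffineOn f s) :
    FinitelyAffineOn (g ∘ f) (s ∩ f ⁻¹' t) := by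
  obtain ⟨T, hT, hf⟩ := hf
  obtain ⟨T', hT', hg⟩ := hg
  refine ⟨image2 (fun B A => B.comp A) T' T, hT'.image2 _ hT, fun x hx => ?_⟩
  obtain ⟨A, hA, hAx⟩ := hf x hx.1
  obtain ⟨B, hB, hBx⟩ := hg (f x) hx.2
  exact ⟨B.comp A, mem_image2_of_mem hB hA, by simp [hBx, ← hAx]⟩

theorem FinitelyAffineOn.linear_comp {f : E → F} {s : Set E} (B : F →ₗ[ℝ] G)
    (hf : FinitelyAffineOn f s) : FinitelyAffineOn (fun x => B (f x)) s := by
  exact ((FinitelyAffineOn.linear B univ).comp hf).mono fun x hx => ⟨hx, mem_univ _⟩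

theorem FinitelyAffineOn.prodMk {f : E → F} {g : E → G} {s : Set E}
    (hf : FinitelyAffineOn f s) (hg : FinitelyAffineOn g s) :
    FinitelyAffineOn (fun x => (f x, g x)) s := by
  obtain ⟨T, hT, hf⟩ := hf
  obtain ⟨T', hT', hg⟩ := hg
  refine ⟨image2 (fun A B => A.prod B) T T', hT.image2 _ hT', fun x hx => ?_⟩
  obtain ⟨A, hA, hAx⟩ := hf x hx
  obtain ⟨B, hB, hBx⟩ := hg x hx
  exact ⟨A.prod B, mem_image2_of_mem hA hB, by simp [hAx, hBx]⟩

theorem FinitelyAffineOn.add {f g : E → F} {s : Set E}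
    (hf : FinitelyAffineOn f s) (hg : FinitelyAffineOn g s) :
    FinitelyAffineOn (fun x => f x + g x) s :=
  (hf.prodMk hg).linear_comp (LinearMap.fst ℝ F F + LinearMap.snd ℝ F F)

theorem FinitelyAffineOn.sub {f g : E → F} {s : Set E}
    (hf : FinitelyAffineOn f s) (hg : FinitelyAffineOn g s) :
    FinitelyAffineOn (fun x => f x - g x) s :=
  (hf.prodMk hg).linear_comp (LinearMap.fst ℝ F F - LinearMap.snd ℝ F F)

theorem FinitelyAffineOn.max {f g : E → ℝ} {s : Set E}
    (hf : FinitelyAffineOn f s) (hg : FinitelyAffineOn g s) :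
    FinitelyAffineOn (fun x => max (f x) (g x)) s := by
  obtain ⟨T, hT, hf⟩ := hf
  obtain ⟨T', hT', hg⟩ := hg
  refine ⟨T ∪ T', hT.union hT', fun x hx => ?_⟩
  obtain ⟨A, hA, hAx⟩ := hf x hx
  obtain ⟨B, hB, hBx⟩ := hg x hx
  rcases max_choice (f x) (g x) with h | h
  · exact ⟨A, Or.inl hA, h.trans hAx⟩
  · exact ⟨B, Or.inr hB, h.trans hBx⟩

theorem FinitelyAffineOn.abs {f : E → ℝ} {s : Set E} (hf : FinitelyAffineOn f s) :
    FinitelyAffineOn (fun x => |f x|) s :=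
  hf.max ((FinitelyAffineOn.const 0 s).sub hf) |>.congr fun x _ => by simp [abs_eq_max_neg]

theorem FinitelyAffineOn.plOn {f : E → F} {s : Set E} (hf : FinitelyAffineOn f s)
    (hc : ContinuousOn f s) : PLOn f s :=
  ⟨hc, fun _ _ => ⟨s, self_mem_nhdsWithin, hf⟩⟩

end PL

/-- The model space `ℝ³`. -/
abbrev V3 : Type := Fin 3 → ℝ

/-- The pregroupoid of PL maps between open subsets of `ℝ³`. -/
def plPregroupoid : Pregroupoid V3 where
  property f s := PLOn f s
  comp := by
    intro f g u v hf hg _ _ _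
    refine ⟨hg.1.comp (hf.1.mono inter_subset_left) fun x hx => hx.2, fun x hx => ?_⟩
    obtain ⟨U, hU, hfU⟩ := hf.2 x hx.1
    obtain ⟨W, hW, hgW⟩ := hg.2 (f x) hx.2
    refine ⟨U ∩ f ⁻¹' W, inter_mem (nhdsWithin_mono x inter_subset_left hU) ?_, hgW.comp hfU⟩
    have hc : Tendsto f (𝓝[u ∩ f ⁻¹' v] x) (𝓝[v] (f x)) :=
      tendsto_nhdsWithin_iff.2 ⟨(hf.1 x hx.1).mono_left (nhdsWithin_mono x inter_subset_left),
        eventually_mem_nhdsWithin.mono fun y hy => hy.2⟩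
    exact hc hW
  id_mem := (FinitelyAffineOn.linear LinearMap.id univ).plOn continuousOn_id
  locality := by
    intro f u _ h
    refine ⟨fun x hx => ?_, fun x hx => ?_⟩ <;> obtain ⟨v, hv, hxv, hf⟩ := h x hx
    · exact (continuousWithinAt_inter (hv.mem_nhds hxv)).1 (hf.1 x ⟨hx, hxv⟩)
    · obtain ⟨U, hU, hfU⟩ := hf.2 x ⟨hx, hxv⟩
      rw [nhdsWithin_inter_of_mem' (mem_nhdsWithin_of_mem_nhds (hv.mem_nhds hxv))] at hU
      exact ⟨U, hU, hfU⟩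
  congr := by
    intro f g u _ h hf
    refine ⟨hf.1.congr h, fun x hx => ?_⟩
    obtain ⟨U, hU, hfU⟩ := hf.2 x hx
    exact ⟨U ∩ u, inter_mem hU self_mem_nhdsWithin,
      (hfU.mono inter_subset_left).congr fun y hy => h y hy.2⟩

/-- The groupoid of PL homeomorphisms between open subsets of `ℝ³`. -/
def plGroupoid : StructureGroupoid V3 := plPregroupoid.groupoid

/-! ### Discal `3`-orbifolds -/

/-- The orders allowed at a vertex: `(2,2,n)` with `n ≥ 2`, or `(2,3,n)` with `n ∈ {3,4,5}`,
up to permutation. -/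
def Admissible (p q r : ℕ) : Prop :=
  (∃ n, 2 ≤ n ∧ ({p, q, r} : Multiset ℕ) = {2, 2, n}) ∨
    ∃ n, 3 ≤ n ∧ n ≤ 5 ∧ ({p, q, r} : Multiset ℕ) = {2, 3, n}

/-! The singular set of an orbifold, together with its orders, is recorded as a labelling of the
points: the label is `1` at the nonsingular points, it is the order `p ≥ 2` at the singular points
that are not vertices, and it is `0` at the vertices. -/

/-- The empty singular set in `ℝ³`. -/
def ordinaryLabel : V3 → ℕ := fun _ => 1

open Classical in
/-- The singular set in `ℝ³` given by a line (the last axis), of order `p`. -/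
def cyclicLabel (p : ℕ) : V3 → ℕ := fun y => if y 0 = 0 ∧ y 1 = 0 then p else 1

open Classical in
/-- The singular set in `ℝ³` given by the cone from the origin over three points (the union of the
three positive half-axes), of orders `p`, `q`, `r`. -/
def vertexLabel (p q r : ℕ) : V3 → ℕ := fun y =>
  if y = 0 then 0
  else if 0 < y 0 ∧ y 1 = 0 ∧ y 2 = 0 then p
  else if 0 < y 1 ∧ y 0 = 0 ∧ y 2 = 0 then q
  else if 0 < y 2 ∧ y 0 = 0 ∧ y 1 = 0 then r
  else 1

/-- The singular sets (with orders) of the ordinary, cyclic and vertex discal `3`-orbifolds. The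
underlying `3`-disc is the octahedron `∑ |yᵢ| ≤ 1` in `ℝ³`. -/
inductive IsDiscalLabel : (V3 → ℕ) → Prop
  | ordinary : IsDiscalLabel ordinaryLabel
  | cyclic (p : ℕ) (hp : 2 ≤ p) : IsDiscalLabel (cyclicLabel p)
  | vertex (p q r : ℕ) (h : Admissible p q r) : IsDiscalLabel (vertexLabel p q r)

/-- The open `3`-disc underlying the open discal `3`-orbifolds. -/
def openDisc : Set V3 := {y | ∑ i, |y i| < 1}

/-! ### Closed `3`-orbifolds -/

/-- A closed locally orientable `3`-orbifold `X`: a closed PL `3`-manifold `|X|` with a singular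
set with orders, recorded as a labelling and locally PL isomorphic to that of one of the discal
`3`-orbifolds, with the given point at the centre. -/
structure ClosedOrbifold where
  /-- the support -/
  carrier : Type
  [topology : TopologicalSpace carrier]
  [compact : CompactSpace carrier]
  [hausdorff : T2Space carrier]
  [charted : ChartedSpace V3 carrier]
  [pl : HasGroupoid carrier plGroupoid]
  /-- `1` at nonsingular points, the order at singular points that are not vertices, `0` at
  vertices -/
  label : carrier → ℕ
  locally_discal : ∀ x, ∃ φ ∈ plGroupoid.maximalAtlas carrier, x ∈ φ.source ∧ φ x = 0 ∧
    ∃ l, IsDiscalLabel l ∧ ∀ᶠ y in 𝓝 x, label y = l (φ y)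

attribute [instance] ClosedOrbifold.topology ClosedOrbifold.compact ClosedOrbifold.hausdorff
  ClosedOrbifold.charted ClosedOrbifold.pl

namespace ClosedOrbifold

variable (X : ClosedOrbifold)

/-- The PL charts of the support. -/
abbrev charts : Set (OpenPartialHomeomorph X.carrier V3) := plGroupoid.maximalAtlas X.carrier

/-- The singular set. -/
def singularSet : Set X.carrier := {x | X.label x ≠ 1}

/-- Compact subpolyhedra of the support. -/
def IsSubpolyhedron (P : Set X.carrier) : Prop :=
  IsCompact P ∧ ∀ x ∈ P, ∃ φ ∈ X.charts, x ∈ φ.source ∧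
    ∃ B : Set V3, IsPolyhedron B ∧ ∀ᶠ y in 𝓝 x, (y ∈ P ↔ φ y ∈ B)

end ClosedOrbifold

/-! ### Simple and special polyhedra -/

/-- The cone with apex `0` over a subset of `ℝ³` (used for subsets of the plane `v 2 = 1`). -/
def cone (L : Set V3) : Set V3 := insert 0 {v | ∃ t : ℝ, 0 ≤ t ∧ ∃ u ∈ L, v = t • u}

/-- The PL circle `|v₀| + |v₁| = 1` together with the radii pointing to the points of `R`, in the
plane `v₂ = 1`. -/
def circleWithRadii (R : Set (ℝ × ℝ)) : Set V3 :=
  {v | v 2 = 1 ∧ (|v 0| + |v 1| = 1 ∨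
    ∃ u ∈ R, ∃ t ∈ Icc (0 : ℝ) 1, v 0 = t * u.1 ∧ v 1 = t * u.2)}

/-- A circle. -/
def circleLink : Set V3 := circleWithRadii ∅

/-- A circle with two radii. -/
def thetaLink : Set V3 := circleWithRadii {(1, 0), (-1, 0)}

/-- A circle with three radii. -/
def vertexLink : Set V3 := circleWithRadii {(1, 0), (-1, 0), (0, 1)}

namespace ClosedOrbifold

variable (X : ClosedOrbifold)

/-- The link of `x` in the polyhedron `P` is (PL homeomorphic to) `L`: near `x`, the polyhedron
`P` is PL homeomorphic to the cone over `L`, with `x` at the apex. -/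
def HasLink (P : Set X.carrier) (x : X.carrier) (L : Set V3) : Prop :=
  ∃ φ ∈ X.charts, x ∈ φ.source ∧ PLGermEquiv (φ '' (P ∩ φ.source)) (φ x) (cone L) 0

/-- Simple polyhedra in `|X|`: the link of each point embeds in a circle with three radii. -/
def IsSimple (P : Set X.carrier) : Prop :=
  X.IsSubpolyhedron P ∧ ∀ x ∈ P, ∃ L ⊆ vertexLink, IsPolyhedron L ∧ X.HasLink P x L

/-- The vertices of a polyhedron: the link is a circle with three radii. -/
def vertices (P : Set X.carrier) : Set X.carrier := {x | x ∈ P ∧ X.HasLink P x vertexLink}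

/-- The singular points of a polyhedron: the link is a circle with two or three radii. -/
def singularPoints (P : Set X.carrier) : Set X.carrier :=
  {x | x ∈ P ∧ (X.HasLink P x thetaLink ∨ X.HasLink P x vertexLink)}

/-- Almost-special polyhedra: each link is a circle with zero, two or three radii. -/
def IsAlmostSpecial (P : Set X.carrier) : Prop :=
  X.IsSimple P ∧
    ∀ x ∈ P, X.HasLink P x circleLink ∨ X.HasLink P x thetaLink ∨ X.HasLink P x vertexLink

/-- Special polyhedra: almost-special, no component of the set of singular points is a circle, and
the components of the complement of the set of singular points are open discs. -/
def IsSpecial (P : Set X.carrier) : Prop :=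
  X.IsAlmostSpecial P ∧
  (∀ x ∈ X.singularPoints P,
    ¬ Nonempty (connectedComponentIn (X.singularPoints P) x ≃ₜ Circle)) ∧
  ∀ x ∈ P \ X.singularPoints P,
    Nonempty (connectedComponentIn (P \ X.singularPoints P) x ≃ₜ EuclideanSpace ℝ (Fin 2))

/-! ### Spines and complexity -/

/-- The polyhedron `P` meets the singular set of `X` at `x` transversely, at a surface point of
`P` and a singular point that is not a vertex: up to a PL homeomorphism this is the intersection
of a plane and a line in `ℝ³`. -/
def IsTransverseAt (P : Set X.carrier) (x : X.carrier) : Prop :=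
  ∃ φ ∈ X.charts, x ∈ φ.source ∧ φ x = 0 ∧ ∃ p : ℕ, 2 ≤ p ∧
    ∀ᶠ y in 𝓝 x, (y ∈ P ↔ φ y 2 = 0) ∧ X.label y = cyclicLabel p (φ y)

/-- Spines of `X`: simple polyhedra `P` in `|X|`, transverse to the singular set, such that each
component of `X \ P` is isomorphic to an open discal `3`-orbifold. -/
def IsSpine (P : Set X.carrier) : Prop :=
  X.IsSimple P ∧
  (∀ x ∈ P ∩ X.singularSet, X.IsTransverseAt P x) ∧
  ∀ x ∈ Pᶜ, ∃ φ ∈ X.charts, φ.source = connectedComponentIn Pᶜ x ∧ φ.target = openDisc ∧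
    ∃ l, IsDiscalLabel l ∧ ∀ y ∈ φ.source, X.label y = l (φ y)

/-- The number `c(P, S(X))`: the number of vertices of `P` plus the sum of `p - 1` over the
points of `P ∩ S(X)`, where `p` is the order of `S(X)` at the point. -/
def spineComplexity (P : Set X.carrier) : ℕ∞ :=
  (X.vertices P).encard + ∑' x : ↥(P ∩ X.singularSet), ((X.label x - 1 : ℕ) : ℕ∞)

/-- The complexity `c(X)`: the minimum of `c(P, S(X))` over all spines `P` of `X` (it would be `⊤`
if there were no spines). -/
def complexity : ℕ∞ := ⨅ (P : Set X.carrier) (_ : X.IsSpine P), X.spineComplexity P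

/-- Minimal spines: `c(P, S(X)) = c(X)`, and every proper subpolyhedron of `P` that is also a
spine of `X` is homeomorphic to `P`. -/
def IsMinimalSpine (P : Set X.carrier) : Prop :=
  X.IsSpine P ∧ X.spineComplexity P = X.complexity ∧
    ∀ Q, Q ⊂ P → X.IsSpine Q → Nonempty (Q ≃ₜ P)

end ClosedOrbifold

/-! ### Polyhedra in vector spaces and their quotients as PL manifolds -/

section Atlas

variable {E : Type*} [NormedAddCommGroup E] [NormedSpace ℝ E] {S : Set E}
  {M : Type*} [TopologicalSpace M]

/-- The PL charts of a quotient `M` of a polyhedron `S` in a vector space: those charts `φ` such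
that `φ ∘ π` is piecewise affine and the inverse of `φ` lifts to a piecewise affine map to `S`. -/
def polyhedralAtlas (π : S → M) : Set (OpenPartialHomeomorph M V3) :=
  {φ | (∃ T : Set (E →ᵃ[ℝ] V3), T.Finite ∧ ∀ s : S, π s ∈ φ.source → ∃ A ∈ T, φ (π s) = A s) ∧
    ∃ T : Set (V3 →ᵃ[ℝ] E), T.Finite ∧
      ∀ y ∈ φ.target, ∃ A ∈ T, ∃ s : S, (s : E) = A y ∧ π s = φ.symm y}

theorem polyhedralAtlas_compatible {π : S → M} {φ ψ : OpenPartialHomeomorph M V3}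
    (hφ : φ ∈ polyhedralAtlas π) (hψ : ψ ∈ polyhedralAtlas π) :
    PLOn (φ.symm.trans ψ) (φ.symm.trans ψ).source := by
  obtain ⟨-, T, hT, hφ⟩ := hφ
  obtain ⟨⟨T', hT', hψ⟩, -⟩ := hψ
  refine FinitelyAffineOn.plOn ⟨image2 (fun B A => B.comp A) T' T, hT'.image2 _ hT, ?_⟩
    (φ.symm.trans ψ).continuousOn
  intro y hy
  simp only [OpenPartialHomeomorph.trans_source, OpenPartialHomeomorph.symm_source, mem_inter_iff,
    mem_preimage] at hy
  obtain ⟨A, hA, s, hs, hπ⟩ := hφ y hy.1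
  obtain ⟨B, hB, hBs⟩ := hψ s (by rw [hπ]; exact hy.2)
  exact ⟨B.comp A, mem_image2_of_mem hB hA, by simp [← hπ, hBs, hs]⟩

/-- The PL manifold structure given by the polyhedral atlas. -/
@[reducible] def polyhedralChartedSpace (π : S → M)
    (h : ∀ x : M, ∃ φ ∈ polyhedralAtlas π, x ∈ φ.source) : ChartedSpace V3 M where
  atlas := polyhedralAtlas π
  chartAt x := (h x).choose
  mem_chart_source x := (h x).choose_spec.2
  chart_mem_atlas x := (h x).choose_spec.1

theorem polyhedralChartedSpace_hasGroupoid (π : S → M)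
    (h : ∀ x : M, ∃ φ ∈ polyhedralAtlas π, x ∈ φ.source) :
    @HasGroupoid V3 _ M _ (polyhedralChartedSpace π h) plGroupoid :=
  @hasGroupoid_of_pregroupoid V3 M _ _ (polyhedralChartedSpace π h) plPregroupoid
    fun he he' => polyhedralAtlas_compatible he he'

end Atlas

/-- A homeomorphism from a relatively open part of `S` to an open subset of `ℝ³`, with explicit
inverse. -/
theorem exists_openPartialHomeomorph {E : Type*} [TopologicalSpace E] {S : Set E} (f : E → V3) (g : V3 → E) (U : Set E) (W : Set V3)
    (hU : IsOpen U) (hW : IsOpen W) (hf : Continuous f) (hg : Continuous g)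
    (hfg : ∀ s ∈ S, s ∈ U → f s ∈ W ∧ g (f s) = s)
    (hgf : ∀ y ∈ W, g y ∈ S ∧ g y ∈ U ∧ f (g y) = y) (hS : S.Nonempty) :
    ∃ e : OpenPartialHomeomorph S V3, e.source = {s : S | (s : E) ∈ U} ∧ e.target = W ∧
      (∀ s, e s = f s) ∧ ∀ y ∈ W, (e.symm y : E) = g y := by
  classical
  obtain ⟨s₀, hs₀⟩ := hS
  let inv : V3 → S := fun y => if h : y ∈ W then ⟨g y, (hgf y h).1⟩ else ⟨s₀, hs₀⟩
  have hinv : ∀ y ∈ W, (inv y : E) = g y := fun y hy => by simp [inv, hy]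
  refine ⟨{ toFun := fun s => f s
            invFun := inv
            source := {s : S | (s : E) ∈ U}
            target := W
            map_source' := fun s hs => (hfg s s.2 hs).1
            map_target' := fun y hy => by
              change (inv y : E) ∈ U
              rw [hinv y hy]
              exact (hgf y hy).2.1
            left_inv' := fun s hs => by
              apply Subtype.ext
              rw [hinv _ (hfg s s.2 hs).1]
              exact (hfg s s.2 hs).2
            right_inv' := fun y hy => by
              rw [hinv y hy]
              exact (hgf y hy).2.2
            open_source := hU.preimage continuous_subtype_val
            open_target := hW
            continuousOn_toFun := (hf.comp continuous_subtype_val).continuousOn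
            continuousOn_invFun := by
              rw [Topology.IsInducing.subtypeVal.continuousOn_iff]
              exact hg.continuousOn.congr fun y hy => hinv y hy }, rfl, rfl, fun _ => rfl, hinv⟩

/-! ### Local structure of the labellings -/

/-- Near `y`, up to an affine change of coordinates with `y ↦ 0`, the labelling `m` is that of a
discal `3`-orbifold. -/
def DiscalAt (m : V3 → ℕ) (y : V3) : Prop :=
  ∃ T : V3 ≃ᵃ[ℝ] V3, T y = 0 ∧ ∃ l, IsDiscalLabel l ∧ ∀ᶠ z in 𝓝 y, m z = l (T z)

/-- An affine automorphism of `ℝ³`, as a homeomorphism. -/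
def affineHomeomorph (T : V3 ≃ᵃ[ℝ] V3) : OpenPartialHomeomorph V3 V3 :=
  T.toContinuousAffineEquiv.toHomeomorph.toOpenPartialHomeomorph

theorem affineHomeomorph_mem (T : V3 ≃ᵃ[ℝ] V3) : affineHomeomorph T ∈ plGroupoid := by
  have key : ∀ (T : V3 ≃ᵃ[ℝ] V3) (s : Set V3), PLOn T s := fun T s =>
    (FinitelyAffineOn.affine T.toAffineMap s).plOn
      T.toAffineMap.continuous_of_finiteDimensional.continuousOn
  exact mem_groupoid_of_pregroupoid.2 ⟨key T _, key T.symm _⟩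

theorem trans_mem_maximalAtlas {H M : Type*} [TopologicalSpace H] [TopologicalSpace M]
    [ChartedSpace H M] (G : StructureGroupoid H) {φ : OpenPartialHomeomorph M H}
    (hφ : φ ∈ G.maximalAtlas M) {f : OpenPartialHomeomorph H H} (hf : f ∈ G) :
    φ.trans f ∈ G.maximalAtlas M := by
  rw [mem_maximalAtlas_iff] at hφ ⊢
  intro e he
  obtain ⟨h1, h2⟩ := hφ e he
  constructor
  · rw [OpenPartialHomeomorph.trans_symm_eq_symm_trans_symm, OpenPartialHomeomorph.trans_assoc]
    exact G.trans (G.symm hf) h1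
  · rw [← OpenPartialHomeomorph.trans_assoc]
    exact G.trans h2 hf

theorem exists_discal_chart {M : Type*} [TopologicalSpace M] [ChartedSpace V3 M] {label : M → ℕ}
    {φ : OpenPartialHomeomorph M V3} (hφ : φ ∈ plGroupoid.maximalAtlas M) {x : M}
    (hx : x ∈ φ.source) {m : V3 → ℕ} (hm : DiscalAt m (φ x))
    (hl : ∀ y ∈ φ.source, label y = m (φ y)) :
    ∃ φ ∈ plGroupoid.maximalAtlas M, x ∈ φ.source ∧ φ x = 0 ∧
      ∃ l, IsDiscalLabel l ∧ ∀ᶠ y in 𝓝 x, label y = l (φ y) := by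
  obtain ⟨T, hT, l, hdl, h⟩ := hm
  refine ⟨_, trans_mem_maximalAtlas plGroupoid hφ (affineHomeomorph_mem T), by simpa [affineHomeomorph] using hx, hT, l, hdl, ?_⟩
  filter_upwards [(φ.continuousAt hx).eventually h, φ.open_source.mem_nhds hx] with y hy hy'
  rw [hl y hy', hy]
  rfl

/-- The translation taking `y` to `0`. -/
theorem exists_translation (y : V3) : ∃ T : V3 ≃ᵃ[ℝ] V3, ∀ z, T z = z - y :=
  ⟨AffineEquiv.constVAdd ℝ V3 (-y), fun z => by simp [sub_eq_neg_add]⟩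

theorem discalAt_of_eventually_one {m : V3 → ℕ} {y : V3} (h : ∀ᶠ z in 𝓝 y, m z = 1) :
    DiscalAt m y := by
  obtain ⟨T, hT⟩ := exists_translation y
  exact ⟨T, by simp [hT], _, .ordinary, h⟩

theorem cyclicLabel_one : cyclicLabel 1 = ordinaryLabel := by
  funext y
  simp [cyclicLabel, ordinaryLabel]

theorem isDiscalLabel_cyclicLabel {p : ℕ} (hp : 1 ≤ p) : IsDiscalLabel (cyclicLabel p) := by
  rcases hp.eq_or_lt with rfl | hp
  · rw [cyclicLabel_one]
    exact .ordinary
  · exact .cyclic p hp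

theorem discalAt_ordinary (y : V3) : DiscalAt ordinaryLabel y :=
  discalAt_of_eventually_one (Eventually.of_forall fun _ => rfl)

theorem discalAt_cyclic {p : ℕ} (hp : 1 ≤ p) (y : V3) : DiscalAt (cyclicLabel p) y := by
  by_cases hy : y 0 = 0 ∧ y 1 = 0
  · obtain ⟨T, hT⟩ := exists_translation y
    refine ⟨T, by simp [hT], _, isDiscalLabel_cyclicLabel hp, Eventually.of_forall fun z => ?_⟩
    simp [cyclicLabel, hT, hy]
  · apply discalAt_of_eventually_one
    have hopen : IsOpen {z : V3 | ¬ (z 0 = 0 ∧ z 1 = 0)} := by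
      rw [← compl_ofPred, isOpen_compl_iff]
      exact (isClosed_eq (continuous_apply 0) continuous_const).inter
        (isClosed_eq (continuous_apply 1) continuous_const)
    filter_upwards [hopen.mem_nhds hy] with z hz
    exact if_neg hz

theorem Admissible.one_le {p q r : ℕ} (h : Admissible p q r) : 1 ≤ p ∧ 1 ≤ q ∧ 1 ≤ r := by
  have key : ∀ x ∈ ({p, q, r} : Multiset ℕ), 1 ≤ x := by
    rcases h with ⟨n, hn, h⟩ | ⟨n, hn, -, h⟩ <;> rw [h] <;> intro x hx <;>
      simp only [Multiset.insert_eq_cons, Multiset.mem_cons, Multiset.mem_singleton] at hx <;>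
      omega
  exact ⟨key p (by simp), key q (by simp), key r (by simp)⟩

/-- Near a point of one of the half-axes (other than the origin) a vertex labelling is cyclic. -/
theorem discalAt_of_eventually_axis {m : V3 → ℕ} {y : V3} {p : ℕ} (hp : 1 ≤ p)
    (σ : Equiv.Perm (Fin 3)) (hy : y (σ 0) = 0 ∧ y (σ 1) = 0)
    (h : ∀ᶠ z in 𝓝 y, m z = cyclicLabel p (fun i => z (σ i))) : DiscalAt m y := by
  obtain ⟨T, hT⟩ := exists_translation y
  refine ⟨T.trans (LinearEquiv.funCongrLeft ℝ ℝ σ).toAffineEquiv, ?_, _,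
    isDiscalLabel_cyclicLabel hp, ?_⟩
  · ext i
    simp [hT, LinearEquiv.funCongrLeft_apply, LinearMap.funLeft_apply]
  · filter_upwards [h] with z hz
    rw [hz]
    simp [cyclicLabel, hT, LinearEquiv.funCongrLeft_apply, LinearMap.funLeft_apply, hy]

theorem discalAt_vertex {p q r : ℕ} (h : Admissible p q r) (y : V3) :
    DiscalAt (vertexLabel p q r) y := by
  obtain ⟨hp, hq, hr⟩ := h.one_le
  have pos : ∀ i, 0 < y i → ∀ᶠ z in 𝓝 y, 0 < z i := fun i hi =>
    (continuous_apply i).continuousAt.eventually (lt_mem_nhds hi)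
  by_cases h0 : y = 0
  · exact ⟨AffineEquiv.refl ℝ V3, by simp [h0], _, .vertex p q r h,
      Eventually.of_forall fun _ => rfl⟩
  by_cases h1 : 0 < y 0 ∧ y 1 = 0 ∧ y 2 = 0
  · refine discalAt_of_eventually_axis hp (Equiv.swap 0 2) (by simp [h1, Equiv.swap_apply_of_ne_of_ne]) ?_
    filter_upwards [pos 0 h1.1] with z hz
    have : z ≠ 0 := by rintro rfl; simp at hz
    simp [vertexLabel, cyclicLabel, this, hz, hz.ne', Equiv.swap_apply_of_ne_of_ne, and_comm]
  by_cases h2 : 0 < y 1 ∧ y 0 = 0 ∧ y 2 = 0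
  · refine discalAt_of_eventually_axis hq (Equiv.swap 1 2) (by simp [h2, Equiv.swap_apply_of_ne_of_ne]) ?_
    filter_upwards [pos 1 h2.1] with z hz
    have : z ≠ 0 := by rintro rfl; simp at hz
    simp [vertexLabel, cyclicLabel, this, hz, hz.ne', Equiv.swap_apply_of_ne_of_ne]
  by_cases h3 : 0 < y 2 ∧ y 0 = 0 ∧ y 1 = 0
  · refine discalAt_of_eventually_axis hr (Equiv.refl _) (by simp [h3]) ?_
    filter_upwards [pos 2 h3.1] with z hz
    have : z ≠ 0 := by rintro rfl; simp at hz
    simp only [vertexLabel, cyclicLabel, this, hz, hz.ne']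
    simp
    congr
  · apply discalAt_of_eventually_one
    have hclosed : ∀ i j k : Fin 3, IsClosed {z : V3 | 0 ≤ z i ∧ z j = 0 ∧ z k = 0} := fun i j k =>
      (isClosed_le continuous_const (continuous_apply i)).inter
        ((isClosed_eq (continuous_apply j) continuous_const).inter
          (isClosed_eq (continuous_apply k) continuous_const))
    have hne : ∀ i j k : Fin 3, (∀ l, l = i ∨ l = j ∨ l = k) →
        ¬ (0 < y i ∧ y j = 0 ∧ y k = 0) → ¬ (0 ≤ y i ∧ y j = 0 ∧ y k = 0) := by
      rintro i j k hl hn ⟨h, hj, hk⟩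
      rcases h.eq_or_lt with h | h
      · apply h0
        ext l
        rcases hl l with rfl | rfl | rfl
        · exact h.symm
        · exact hj
        · exact hk
      · exact hn ⟨h, hj, hk⟩
    filter_upwards [(hclosed 0 1 2).isOpen_compl.mem_nhds (hne 0 1 2 (by decide) h1),
      (hclosed 1 0 2).isOpen_compl.mem_nhds (hne 1 0 2 (by decide) h2),
      (hclosed 2 0 1).isOpen_compl.mem_nhds (hne 2 0 1 (by decide) h3)] with z hz1 hz2 hz3
    have hz0 : z ≠ 0 := by rintro rfl; exact hz1 (by simp)
    have e1 : ¬ (0 < z 0 ∧ z 1 = 0 ∧ z 2 = 0) := fun h => hz1 ⟨h.1.le, h.2⟩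
    have e2 : ¬ (0 < z 1 ∧ z 0 = 0 ∧ z 2 = 0) := fun h => hz2 ⟨h.1.le, h.2⟩
    have e3 : ¬ (0 < z 2 ∧ z 0 = 0 ∧ z 1 = 0) := fun h => hz3 ⟨h.1.le, h.2⟩
    simp only [vertexLabel, if_neg hz0, if_neg e1, if_neg e2, if_neg e3]

theorem IsDiscalLabel.discalAt {l : V3 → ℕ} (h : IsDiscalLabel l) (y : V3) : DiscalAt l y := by
  cases h with
  | ordinary => exact discalAt_ordinary y
  | cyclic p hp => exact discalAt_cyclic (by omega) y
  | vertex p q r h => exact discalAt_vertex h y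

/-! ### The spherical `3`-orbifolds -/

/-- The PL `3`-sphere: the boundary `∑ |xᵢ| = 1` of the cross-polytope in `ℝ⁴`. -/
def octSphere : Set (Fin 4 → ℝ) := {x | ∑ i, |x i| = 1}

theorem octSphere_nonempty : octSphere.Nonempty :=
  ⟨Pi.single 0 1, by simp [octSphere, Fin.sum_univ_four]⟩

theorem isCompact_octSphere : IsCompact octSphere := by
  apply IsCompact.of_isClosed_subset (isCompact_closedBall (0 : Fin 4 → ℝ) 1)
  · exact isClosed_eq (by fun_prop) continuous_const
  · intro x hx
    rw [mem_closedBall_zero_iff, pi_norm_le_iff_of_nonneg zero_le_one]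
    intro i
    rw [Real.norm_eq_abs, ← show ∑ i, |x i| = 1 from hx]
    exact Finset.single_le_sum (f := fun i => |x i|) (fun i _ => abs_nonneg _) (Finset.mem_univ i)

instance : CompactSpace octSphere := isCompact_iff_compactSpace.1 isCompact_octSphere

theorem FinitelyAffineOn.pi {E ι : Type*} [NormedAddCommGroup E] [NormedSpace ℝ E] [Fintype ι]
    {f : E → ι → ℝ} {s : Set E} (h : ∀ i, FinitelyAffineOn (fun x => f x i) s) :
    FinitelyAffineOn f s := by
  choose T hT hf using h
  refine ⟨AffineMap.pi '' {A | ∀ i, A i ∈ T i}, (Set.Finite.pi' hT).image _, fun x hx => ?_⟩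
  choose A hA hAx using fun i => hf i x hx
  exact ⟨_, mem_image_of_mem _ hA, by ext i; simp [hAx]⟩

theorem FinitelyAffineOn.sum_abs (s : Set V3) :
    FinitelyAffineOn (fun y : V3 => ∑ i, |y i|) s := by
  have h : ∀ i, FinitelyAffineOn (fun y : V3 => |y i|) s := fun i =>
    (FinitelyAffineOn.linear (LinearMap.proj i) s).abs
  exact (((h 0).add (h 1)).add (h 2)).congr fun y _ => Fin.sum_univ_three _

/-- The projection of an open hemisphere along a coordinate direction is a PL chart. -/
theorem exists_octSphere_chart (i : Fin 4) (ε : ℝ) (hε : ε = 1 ∨ ε = -1) :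
    ∃ e ∈ polyhedralAtlas (id : octSphere → octSphere), e.source = {s | 0 < ε * s.1 i} ∧
      e.target = openDisc ∧ ∀ s, e s = fun j => s.1 (i.succAbove j) := by
  have hεε : ε * ε = 1 := by rcases hε with rfl | rfl <;> norm_num
  have hεa : |ε| = 1 := by rcases hε with rfl | rfl <;> norm_num
  let g : V3 → Fin 4 → ℝ := fun y =>
    Fin.insertNth (α := fun _ => ℝ) i (ε * (1 - ∑ j, |y j|)) y
  have hgc : Continuous g := by
    apply Continuous.finInsertNth <;> fun_prop
  have hgi : ∀ y, g y i = ε * (1 - ∑ j, |y j|) := fun y => Fin.insertNth_apply_same ..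
  have hgj : ∀ y j, g y (i.succAbove j) = y j := fun y j => Fin.insertNth_apply_succAbove ..
  have hgf : FinitelyAffineOn g openDisc := by
    apply FinitelyAffineOn.pi
    intro k
    induction k using Fin.succAboveCases i with
    | x => 
      refine (((FinitelyAffineOn.const 1 _).sub (FinitelyAffineOn.sum_abs _)).linear_comp
        (ε • LinearMap.id)).congr fun y _ => ?_
      simp [hgi]
    | p j => exact (FinitelyAffineOn.linear (LinearMap.proj j) _).congr fun y _ => hgj y j
  let f : (Fin 4 → ℝ) →ₗ[ℝ] V3 := LinearMap.funLeft ℝ ℝ i.succAbove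
  have hf : ∀ x j, f x j = x (i.succAbove j) := fun _ _ => rfl
  obtain ⟨e, hes, het, hef, heg⟩ := exists_openPartialHomeomorph (S := octSphere) f g
    {x | 0 < ε * x i} openDisc (isOpen_lt continuous_const (by fun_prop))
    (isOpen_lt (by fun_prop) continuous_const) f.continuous_of_finiteDimensional hgc
    (by
      intro s hs hsU
      have h : |s i| + ∑ j, |s (i.succAbove j)| = 1 := by
        rw [← Fin.sum_univ_succAbove (fun k => |s k|) i]; exact hs
      have hsi : |s i| = ε * s i := by
        rw [← abs_of_pos (show 0 < ε * s i from hsU), abs_mul, hεa, one_mul]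
      have hsU' : 0 < ε * s i := hsU
      refine ⟨?_, ?_⟩
      · simp only [openDisc, mem_ofPred_eq, hf]
        linarith
      · ext k
        induction k using Fin.succAboveCases i with
        | x =>
          rw [hgi]
          simp only [hf]
          rw [show 1 - ∑ j, |s (i.succAbove j)| = ε * s i by linarith, ← mul_assoc, hεε, one_mul]
        | p j => rw [hgj, hf])
    (by
      intro y hy
      have hy' : 0 < 1 - ∑ j, |y j| := sub_pos.2 hy
      refine ⟨?_, ?_, ?_⟩
      · change ∑ k, |g y k| = 1
        rw [Fin.sum_univ_succAbove _ i, hgi, abs_mul, hεa, abs_of_pos hy']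
        simp [hgj]
      · change 0 < ε * g y i
        rw [hgi, ← mul_assoc, hεε, one_mul]
        exact hy'
      · ext j
        rw [hf, hgj])
    octSphere_nonempty
  refine ⟨e, ⟨?_, ?_⟩, hes, het, fun s => by rw [hef]; rfl⟩
  · exact ⟨{f.toAffineMap}, finite_singleton _, fun s _ => ⟨_, rfl, hef s⟩⟩
  · obtain ⟨T, hT, h⟩ := hgf
    refine ⟨T, hT, fun y hy => ?_⟩
    rw [het] at hy
    obtain ⟨A, hA, hAy⟩ := h y hy
    exact ⟨A, hA, e.symm y, by rw [heg y hy, hAy], rfl⟩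

theorem exists_octSphere_hemisphere (x : octSphere) :
    ∃ (i : Fin 4) (ε : ℝ), (ε = 1 ∨ ε = -1) ∧ 0 < ε * x.1 i := by
  by_contra! h
  have h0 : ∀ i, x.1 i = 0 := fun i => by
    have h1 := h i 1 (Or.inl rfl)
    have h2 := h i (-1) (Or.inr rfl)
    linarith
  have hx : ∑ i, |x.1 i| = 1 := x.2
  simp [h0] at hx

instance : ChartedSpace V3 octSphere :=
  polyhedralChartedSpace (id : octSphere → octSphere) fun x => by
    obtain ⟨i, ε, hε, hx⟩ := exists_octSphere_hemisphere x
    obtain ⟨e, he, hes, -, -⟩ := exists_octSphere_chart i ε hε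
    exact ⟨e, he, by rw [hes]; exact hx⟩

instance : HasGroupoid octSphere plGroupoid := polyhedralChartedSpace_hasGroupoid _ _

/-- The orbifold obtained by mirroring in its boundary the discal `3`-orbifold with singular set
`l`. The two copies of the `3`-disc `∑ |yᵢ| ≤ 1` are the hemispheres `x₃ ≥ 0` and `x₃ ≤ 0` of the
sphere `∑ |xᵢ| = 1` in `ℝ⁴`, both identified with the disc by forgetting the last coordinate. -/
def mirror (l : V3 → ℕ) (hl : IsDiscalLabel l) : ClosedOrbifold where
  carrier := octSphere
  label x := l fun i => x.1 i.castSucc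
  locally_discal := by
    intro x
    obtain ⟨i, ε, hε, hx⟩ := exists_octSphere_hemisphere x
    obtain ⟨e, he, hes, -, hef⟩ := exists_octSphere_chart i ε hε
    have hem : e ∈ plGroupoid.maximalAtlas octSphere := plGroupoid.subset_maximalAtlas he
    have hxe : x ∈ e.source := by rw [hes]; exact hx
    suffices ∃ m : V3 → ℕ, DiscalAt m (e x) ∧
        ∀ y ∈ e.source, (l fun i => y.1 i.castSucc) = m (e y) by
      obtain ⟨m, hm, h⟩ := this
      exact exists_discal_chart hem hxe hm h
    have hne : ∀ y ∈ e.source, y.1 i ≠ 0 := fun y hy h => by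
      rw [hes, mem_ofPred_eq, h, mul_zero] at hy
      exact lt_irrefl _ hy
    simp only [hes, mem_ofPred_eq] at hne
    simp only [hes, mem_ofPred_eq, hef]
    by_cases hi : i = Fin.last 3
    · subst hi
      exact ⟨l, hl.discalAt _, fun y _ => by simp only [Fin.succAbove_last]⟩
    cases hl with
    | ordinary => exact ⟨ordinaryLabel, discalAt_ordinary _, fun _ _ => rfl⟩
    | cyclic p hp =>
      by_cases h2 : i = 2
      · subst h2
        exact ⟨cyclicLabel p, discalAt_cyclic (by omega) _, fun y _ => rfl⟩
      · refine ⟨ordinaryLabel, discalAt_ordinary _, fun y hy => if_neg ?_⟩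
        rintro ⟨h0, h1⟩
        have := hne y hy
        fin_cases i
        · exact this h0
        · exact this h1
        · exact h2 rfl
        · exact hi rfl
    | vertex p q r h =>
      obtain ⟨hp, hq, hr⟩ := h.one_le
      have h00 : Fin.castSucc (0 : Fin 3) = 0 := rfl
      have h11 : Fin.castSucc (1 : Fin 3) = 1 := rfl
      have h22 : Fin.castSucc (2 : Fin 3) = 2 := rfl
      have hv : ∀ y : octSphere, y.1 i ≠ 0 → (fun j : Fin 3 => y.1 j.castSucc) ≠ 0 := by
        intro y hy h0
        obtain ⟨j, rfl⟩ := Fin.exists_castSucc_eq.2 hi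
        exact hy (congrFun h0 j)
      rcases hε with rfl | rfl
      · fin_cases i
        · refine ⟨cyclicLabel p, discalAt_cyclic hp _, fun y hy => ?_⟩
          have h3 : 0 < y.1 0 := by simpa using hy
          simp [vertexLabel, cyclicLabel, hv y (hne y hy), h00, h11, h22, h3, h3.ne',
            Fin.succAbove]
        · refine ⟨cyclicLabel q, discalAt_cyclic hq _, fun y hy => ?_⟩
          have h3 : 0 < y.1 1 := by simpa using hy
          simp [vertexLabel, cyclicLabel, hv y (hne y hy), h00, h11, h22, h3, h3.ne',
            Fin.succAbove]
        · refine ⟨cyclicLabel r, discalAt_cyclic hr _, fun y hy => ?_⟩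
          have h3 : 0 < y.1 2 := by simpa using hy
          simp [vertexLabel, cyclicLabel, hv y (hne y hy), h00, h11, h22, h3, h3.ne',
            Fin.succAbove]
        · exact absurd rfl hi
      · refine ⟨ordinaryLabel, discalAt_ordinary _, fun y hy => ?_⟩
        have hy' : y.1 i < 0 := by linarith
        have e1 : ¬ (0 < y.1 0 ∧ y.1 1 = 0 ∧ y.1 2 = 0) := by
          rintro ⟨h0, h1, h2⟩
          fin_cases i
          exacts [lt_asymm h0 hy', hy'.ne h1, hy'.ne h2, hi rfl]
        have e2 : ¬ (0 < y.1 1 ∧ y.1 0 = 0 ∧ y.1 2 = 0) := by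
          rintro ⟨h1, h0, h2⟩
          fin_cases i
          exacts [hy'.ne h0, lt_asymm h1 hy', hy'.ne h2, hi rfl]
        have e3 : ¬ (0 < y.1 2 ∧ y.1 0 = 0 ∧ y.1 1 = 0) := by
          rintro ⟨h2, h0, h1⟩
          fin_cases i
          exacts [hy'.ne h0, hy'.ne h1, lt_asymm h2 hy', hi rfl]
        simp only [vertexLabel, h00, h11, h22, if_neg (hv y (hne y hy)), if_neg e1, if_neg e2,
          if_neg e3, ordinaryLabel]

/-- The cyclic spherical `3`-orbifold of order `p`; for `p = 1` it is the ordinary one. -/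
def sphereCyclic (p : ℕ) (hp : 1 ≤ p) : ClosedOrbifold :=
  mirror (cyclicLabel p) (isDiscalLabel_cyclicLabel hp)

/-- The vertex spherical `3`-orbifold of orders `p`, `q`, `r`. -/
def sphereVertex (p q r : ℕ) (h : Admissible p q r) : ClosedOrbifold :=
  mirror (vertexLabel p q r) (.vertex p q r h)

/-! ### Quotients of the `3`-sphere in `ℂ²` by scalar multiplication by roots of unity -/

/-- The coordinate `a` of `z = a + b e^{iπ/3}`, for real `a`, `b`. -/
def hexA (z : ℂ) : ℝ := z.re - z.im / √3

/-- The coordinate `b` of `z = a + b e^{iπ/3}`, for real `a`, `b`. -/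
def hexB (z : ℂ) : ℝ := 2 * z.im / √3

/-- The complex number `a + b e^{iπ/3}`. -/
def ofHex (a b : ℝ) : ℂ := ⟨a + b / 2, b * √3 / 2⟩

/-- The PL norm on `ℂ` whose unit circle is the regular hexagon with vertices the sixth roots of
unity. -/
def hexNorm (z : ℂ) : ℝ := max (max |hexA z| |hexB z|) |hexA z + hexB z|

/-- The PL `3`-sphere in `ℂ²` which is the unit sphere of the PL norm `N(z) + N(w)`, where `N` is
the hexagonal norm. It is invariant under scalar multiplication by the sixth roots of unity. -/
def hexSphere : Set (ℂ × ℂ) := {s | hexNorm s.1 + hexNorm s.2 = 1}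

theorem hexA_ofHex (a b : ℝ) : hexA (ofHex a b) = a := by
  have : √3 ≠ 0 := by positivity
  simp only [hexA, ofHex]
  field_simp
  ring

theorem hexB_ofHex (a b : ℝ) : hexB (ofHex a b) = b := by
  have : √3 ≠ 0 := by positivity
  simp only [hexB, ofHex]
  field_simp

theorem ofHex_hexA_hexB (z : ℂ) : ofHex (hexA z) (hexB z) = z := by
  have : √3 ≠ 0 := by positivity
  apply Complex.ext <;> simp only [hexA, hexB, ofHex] <;> field_simp
  ring

theorem eq_of_hex {z w : ℂ} (ha : hexA z = hexA w) (hb : hexB z = hexB w) : z = w := by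
  rw [← ofHex_hexA_hexB z, ha, hb, ofHex_hexA_hexB]

theorem hexA_rotate (z : ℂ) : hexA (ofHex 0 1 * z) = -hexB z := by
  have h : √3 ≠ 0 := by positivity
  have h2 : √3 ^ 2 = 3 := Real.sq_sqrt (by norm_num)
  simp only [hexA, hexB, ofHex, Complex.mul_re, Complex.mul_im]
  field_simp
  linear_combination (-z.im) * h2

theorem hexB_rotate (z : ℂ) : hexB (ofHex 0 1 * z) = hexA z + hexB z := by
  have h : √3 ≠ 0 := by positivity
  simp only [hexA, hexB, ofHex, Complex.mul_im]
  field_simp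
  ring

theorem hexNorm_rotate (z : ℂ) : hexNorm (ofHex 0 1 * z) = hexNorm z := by
  have h : -hexB z + (hexA z + hexB z) = hexA z := by ring
  rw [hexNorm, hexNorm, hexA_rotate, hexB_rotate, abs_neg, h, max_comm, ← max_assoc]

theorem ofHex_zero_one : ofHex 0 1 = Complex.exp (2 * Real.pi * Complex.I / (6 : ℕ)) := by
  have h : 2 * Real.pi * Complex.I / (6 : ℕ) = ((Real.pi / 3 : ℝ) : ℂ) * Complex.I := by
    push_cast
    ring
  rw [h]
  apply Complex.ext
  · rw [Complex.exp_ofReal_mul_I_re, Real.cos_pi_div_three]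
    simp [ofHex]
  · rw [Complex.exp_ofReal_mul_I_im, Real.sin_pi_div_three]
    simp [ofHex]

theorem isPrimitiveRoot_ofHex : IsPrimitiveRoot (ofHex 0 1) 6 := by
  rw [ofHex_zero_one]
  exact Complex.isPrimitiveRoot_exp 6 (by norm_num)

theorem hexNorm_mul {u : ℂ} (hu : u ^ 6 = 1) (z : ℂ) : hexNorm (u * z) = hexNorm z := by
  obtain ⟨k, -, rfl⟩ := isPrimitiveRoot_ofHex.eq_pow_of_pow_eq_one hu
  induction k with
  | zero => simp
  | succ k ih => rw [pow_succ', mul_assoc, hexNorm_rotate, ih (by rw [← pow_mul, mul_comm, pow_mul,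
      isPrimitiveRoot_ofHex.pow_eq_one, one_pow])]

theorem hexNorm_nonneg (z : ℂ) : 0 ≤ hexNorm z :=
  (abs_nonneg _).trans (le_max_right _ _)

theorem hexNorm_zero : hexNorm 0 = 0 := by simp [hexNorm, hexA, hexB]

theorem continuous_hexA : Continuous hexA := by unfold hexA; fun_prop

theorem continuous_hexB : Continuous hexB := by unfold hexB; fun_prop

theorem continuous_hexNorm : Continuous hexNorm :=
  ((continuous_hexA.abs).max continuous_hexB.abs).max (continuous_hexA.add continuous_hexB).abs

/-- The coordinate `hexA` as a linear form. -/
def hexALinear : ℂ →ₗ[ℝ] ℝ := Complex.reLm - (√3)⁻¹ • Complex.imLm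

/-- The coordinate `hexB` as a linear form. -/
def hexBLinear : ℂ →ₗ[ℝ] ℝ := (2 * (√3)⁻¹) • Complex.imLm

theorem hexALinear_apply (z : ℂ) : hexALinear z = hexA z := by
  simp [hexALinear, hexA]
  ring

theorem hexBLinear_apply (z : ℂ) : hexBLinear z = hexB z := by
  simp [hexBLinear, hexB]
  ring

theorem hexSphere_nonempty : hexSphere.Nonempty := by
  refine ⟨(1, 0), ?_⟩
  simp [hexSphere, hexNorm, hexA, hexB]

theorem norm_le_hexNorm (z : ℂ) : ‖z‖ ≤ 3 * hexNorm z := by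
  have ha : |hexA z| ≤ hexNorm z := (le_max_left _ _).trans (le_max_left _ _)
  have hb : |hexB z| ≤ hexNorm z := (le_max_right _ _).trans (le_max_left _ _)
  have h3 : √3 ≤ 2 := by
    rw [Real.sqrt_le_left (by norm_num)]
    norm_num
  have h3' := Real.sqrt_nonneg 3
  have hre : z.re = hexA z + hexB z / 2 := congrArg Complex.re (ofHex_hexA_hexB z).symm
  have him : z.im = hexB z * √3 / 2 := congrArg Complex.im (ofHex_hexA_hexB z).symm
  have h1 : |z.re| ≤ hexNorm z + hexNorm z / 2 := by
    rw [hre]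
    refine (abs_add_le _ _).trans (add_le_add ha ?_)
    rw [abs_div, abs_two]
    linarith
  have h2 : |z.im| ≤ hexNorm z := by
    rw [him, abs_div, abs_two, abs_mul, abs_of_nonneg h3']
    nlinarith [abs_nonneg (hexB z)]
  have := Complex.norm_le_abs_re_add_abs_im z
  have := hexNorm_nonneg z
  linarith

theorem isCompact_hexSphere : IsCompact hexSphere := by
  apply IsCompact.of_isClosed_subset (isCompact_closedBall (0 : ℂ × ℂ) 3)
  · exact isClosed_eq ((continuous_hexNorm.comp continuous_fst).add
      (continuous_hexNorm.comp continuous_snd)) continuous_const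
  · intro s hs
    have hs' : hexNorm s.1 + hexNorm s.2 = 1 := hs
    have h1 := norm_le_hexNorm s.1
    have h2 := norm_le_hexNorm s.2
    have h3 := hexNorm_nonneg s.1
    have h4 := hexNorm_nonneg s.2
    rw [mem_closedBall_zero_iff, Prod.norm_def]
    exact max_le (by linarith) (by linarith)

instance : CompactSpace hexSphere := isCompact_iff_compactSpace.1 isCompact_hexSphere

/-- The sector of `ℂ` of angle `2π/3` around the positive real axis. -/
def sector : Set ℂ := {z | 0 < hexA z ∧ 0 < hexA z + hexB z}

theorem isOpen_sector : IsOpen sector :=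
  (isOpen_lt continuous_const continuous_hexA).inter
    (isOpen_lt continuous_const (continuous_hexA.add continuous_hexB))

theorem hexNorm_of_mem_sector {z : ℂ} (hz : z ∈ sector) :
    hexNorm z = hexA z + max (hexB z) 0 := by
  obtain ⟨h1, h2⟩ := hz
  rw [hexNorm, abs_of_pos h1, abs_of_pos h2]
  rcases le_total 0 (hexB z) with hb | hb
  · rw [abs_of_nonneg hb, max_eq_left hb, max_eq_right]
    exact max_le (by linarith) (by linarith)
  · rw [abs_of_nonpos hb, max_eq_right hb, add_zero, max_eq_left_of_lt (by linarith : -hexB z < _),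
      max_eq_left (by linarith)]

theorem exists_rotate_mem_sector {z : ℂ} (hz : z ≠ 0) : ∃ u : ℂ, u ^ 6 = 1 ∧ u * z ∈ sector := by
  by_contra! h
  have hA : ∀ k : ℕ, hexA (ofHex 0 1 ^ (k + 1) * z) = -hexB (ofHex 0 1 ^ k * z) := fun k => by
    rw [pow_succ', mul_assoc, hexA_rotate]
  have hB : ∀ k : ℕ, hexB (ofHex 0 1 ^ (k + 1) * z) =
      hexA (ofHex 0 1 ^ k * z) + hexB (ofHex 0 1 ^ k * z) := fun k => by
    rw [pow_succ', mul_assoc, hexB_rotate]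
  have key : ∀ k : ℕ, ¬ (0 < hexA (ofHex 0 1 ^ k * z) ∧
      0 < hexA (ofHex 0 1 ^ k * z) + hexB (ofHex 0 1 ^ k * z)) := fun k =>
    h _ (by rw [← pow_mul, mul_comm, pow_mul, isPrimitiveRoot_ofHex.pow_eq_one, one_pow])
  have k0 := key 0
  have k1 := key (0 + 1)
  have k2 := key (0 + 1 + 1)
  have k3 := key (0 + 1 + 1 + 1)
  have k4 := key (0 + 1 + 1 + 1 + 1)
  have k5 := key (0 + 1 + 1 + 1 + 1 + 1)
  simp only [hA, hB, pow_zero, one_mul] at k0 k1 k2 k3 k4 k5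
  apply hz
  have h0 : hexA z = 0 ∧ hexB z = 0 := by
    constructor <;> grind
  exact eq_of_hex (by rw [h0.1]; simp [hexA]) (by rw [h0.2]; simp [hexB])

/-- The coordinates `(Re w, Im w, b)` of `(z, w)`, where `z = a + b e^{iπ/3}`. -/
def hexCoord : ℂ × ℂ →ₗ[ℝ] V3 :=
  LinearMap.pi ![Complex.reLm ∘ₗ LinearMap.snd ℝ ℂ ℂ, Complex.imLm ∘ₗ LinearMap.snd ℝ ℂ ℂ,
    hexBLinear ∘ₗ LinearMap.fst ℝ ℂ ℂ]

theorem hexCoord_zero (s : ℂ × ℂ) : hexCoord s 0 = s.2.re := rfl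

theorem hexCoord_one (s : ℂ × ℂ) : hexCoord s 1 = s.2.im := rfl

theorem hexCoord_two (s : ℂ × ℂ) : hexCoord s 2 = hexB s.1 := hexBLinear_apply _

/-- The part of the sphere where the first coordinate lies in the sector is a PL chart. -/
theorem exists_hexSphere_chart (R : (ℂ × ℂ) ≃ₗ[ℝ] (ℂ × ℂ))
    (hR : ∀ s, R s ∈ hexSphere ↔ s ∈ hexSphere) :
    ∃ e ∈ polyhedralAtlas (id : hexSphere → hexSphere), e.source = {s | (R s.1).1 ∈ sector} ∧
      ∀ s, e s = hexCoord (R s.1) := by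
  let w : V3 →ₗ[ℝ] ℂ :=
    Complex.equivRealProdCLM.symm.toLinearMap ∘ₗ (LinearMap.proj 0).prod (LinearMap.proj 1)
  have hw_re : ∀ y, (w y).re = y 0 := fun y => rfl
  have hw_im : ∀ y, (w y).im = y 1 := fun y => rfl
  have hwf : ∀ s, w (hexCoord s) = s.2 := fun s => Complex.ext rfl rfl
  let a : V3 → ℝ := fun y => 1 - hexNorm (w y) - max (y 2) 0
  let g : V3 → ℂ × ℂ := fun y => (ofHex (a y) (y 2), w y)
  have hwc : Continuous w := w.continuous_of_finiteDimensional
  have hac : Continuous a := by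
    have := continuous_hexNorm.comp hwc
    simp only [a]
    fun_prop
  have hgc : Continuous g := by
    refine Continuous.prodMk ?_ hwc
    have h : (fun y : V3 => ofHex (a y) (y 2)) =
        fun y => ((a y + y 2 / 2 : ℝ) : ℂ) + ((y 2 * √3 / 2 : ℝ) : ℂ) * Complex.I := by
      funext y
      apply Complex.ext <;> simp [ofHex]
    rw [h]
    fun_prop
  let W : Set V3 := {y | |y 2| + hexNorm (w y) < 1}
  have hW : IsOpen W := by
    have := continuous_hexNorm.comp hwc
    exact isOpen_lt (by fun_prop) continuous_const
  have hgf : FinitelyAffineOn g W := by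
    have lin : ∀ L : V3 →ₗ[ℝ] ℝ, FinitelyAffineOn (fun y => L y) W := fun L =>
      FinitelyAffineOn.linear L W
    have hA : FinitelyAffineOn (fun y => hexA (w y)) W :=
      (lin (hexALinear ∘ₗ w)).congr fun y _ => (hexALinear_apply _).symm
    have hB : FinitelyAffineOn (fun y => hexB (w y)) W :=
      (lin (hexBLinear ∘ₗ w)).congr fun y _ => (hexBLinear_apply _).symm
    have hN : FinitelyAffineOn (fun y => hexNorm (w y)) W := (hA.abs.max hB.abs).max (hA.add hB).abs
    have h2 : FinitelyAffineOn (fun y : V3 => y 2) W := lin (LinearMap.proj 2)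
    have ha : FinitelyAffineOn a W :=
      ((FinitelyAffineOn.const 1 W).sub hN).sub (h2.max (FinitelyAffineOn.const 0 W))
    let o : ℝ × ℝ →ₗ[ℝ] ℂ := Complex.equivRealProdCLM.symm.toLinearMap ∘ₗ
      (LinearMap.fst ℝ ℝ ℝ + (1 / 2 : ℝ) • LinearMap.snd ℝ ℝ ℝ).prod
        ((√3 / 2) • LinearMap.snd ℝ ℝ ℝ)
    refine FinitelyAffineOn.prodMk (((ha.prodMk h2).linear_comp o).congr fun y _ => ?_)
      (FinitelyAffineOn.linear w W)
    apply Complex.ext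
    · change a y + y 2 / 2 = a y + (1 / 2 : ℝ) * y 2
      ring
    · change y 2 * √3 / 2 = (√3 / 2) * y 2
      ring
  have hRc : Continuous R := R.toLinearMap.continuous_of_finiteDimensional
  have hRc' : Continuous R.symm := R.symm.toLinearMap.continuous_of_finiteDimensional
  have hcc : Continuous hexCoord := hexCoord.continuous_of_finiteDimensional
  obtain ⟨e, hes, het, hef, heg⟩ := exists_openPartialHomeomorph (S := hexSphere)
    (fun s => hexCoord (R s)) (fun y => R.symm (g y)) {s | (R s).1 ∈ sector} W
    (isOpen_sector.preimage (continuous_fst.comp hRc)) hW (hcc.comp hRc) (hRc'.comp hgc)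
    (by
      intro s hs hsU
      have hs' : hexNorm (R s).1 + hexNorm (R s).2 = 1 := (hR s).2 hs
      have hsec : (R s).1 ∈ sector := hsU
      have hN := hexNorm_of_mem_sector hsec
      refine ⟨?_, ?_⟩
      · change |hexCoord (R s) 2| + hexNorm (w (hexCoord (R s))) < 1
        rw [hwf, hexCoord_two]
        have : |hexB (R s).1| < hexNorm (R s).1 := by
          rw [hN]
          obtain ⟨h1, h2⟩ := hsec
          rcases le_total 0 (hexB (R s).1) with hb | hb
          · rw [abs_of_nonneg hb, max_eq_left hb]; linarith
          · rw [abs_of_nonpos hb, max_eq_right hb]; linarith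
        linarith
      · rw [LinearEquiv.symm_apply_eq]
        refine Prod.ext ?_ (hwf _)
        change ofHex (1 - hexNorm (w (hexCoord (R s))) - max (hexCoord (R s) 2) 0)
          (hexCoord (R s) 2) = (R s).1
        rw [hwf, hexCoord_two, show 1 - hexNorm (R s).2 - max (hexB (R s).1) 0 = hexA (R s).1 by
          linarith, ofHex_hexA_hexB])
    (by
      intro y hy
      have hy' : |y 2| + hexNorm (w y) < 1 := hy
      have hay : a y = 1 - hexNorm (w y) - max (y 2) 0 := rfl
      have h1 := le_abs_self (y 2)
      have h2 := neg_abs_le (y 2)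
      have hsec : ofHex (a y) (y 2) ∈ sector := by
        refine ⟨?_, ?_⟩
        · rw [hexA_ofHex, hay]
          have : max (y 2) 0 ≤ |y 2| := max_le h1 (abs_nonneg _)
          linarith
        · rw [hexA_ofHex, hexB_ofHex, hay]
          rcases le_total 0 (y 2) with hb | hb
          · rw [max_eq_left hb]; linarith [abs_nonneg (y 2)]
          · rw [max_eq_right hb]; linarith
      refine ⟨?_, ?_, ?_⟩
      · rw [← hR, LinearEquiv.apply_symm_apply]
        change hexNorm (ofHex (a y) (y 2)) + hexNorm (w y) = 1
        rw [hexNorm_of_mem_sector hsec, hexA_ofHex, hexB_ofHex, hay]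
        ring
      · change (R (R.symm (g y))).1 ∈ sector
        rw [LinearEquiv.apply_symm_apply]
        exact hsec
      · simp only [LinearEquiv.apply_symm_apply]
        ext i
        fin_cases i
        · rfl
        · rfl
        · exact (hexCoord_two _).trans (hexB_ofHex _ _))
    hexSphere_nonempty
  refine ⟨e, ⟨?_, ?_⟩, hes, hef⟩
  · exact ⟨{(hexCoord ∘ₗ R.toLinearMap).toAffineMap}, finite_singleton _,
      fun s _ => ⟨_, rfl, hef s⟩⟩
  · obtain ⟨T, hT, h⟩ := hgf.linear_comp R.symm.toLinearMap
    refine ⟨T, hT, fun y hy => ?_⟩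
    rw [het] at hy
    obtain ⟨A, hA, hAy⟩ := h y hy
    exact ⟨A, hA, e.symm y, by rw [heg y hy, ← hAy]; rfl, rfl⟩

/-- The group of `n`-th roots of unity acts on the sphere in `ℂ²` by scalar multiplication:
`ζ • (z, w) = (ζ z, ζ w)`. -/
instance hexAction (n : ℕ) [hn : Fact (n ∣ 6)] : MulAction (rootsOfUnity n ℂ) hexSphere where
  smul ζ s := ⟨(((ζ : ℂˣ) : ℂ) * s.1.1, ((ζ : ℂˣ) : ℂ) * s.1.2), by
    have h : ((ζ : ℂˣ) : ℂ) ^ 6 = 1 := by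
      obtain ⟨k, hk⟩ := hn.out
      rw [hk, pow_mul, ← Units.val_pow_eq_pow_val, (mem_rootsOfUnity n _).1 ζ.2, Units.val_one,
        one_pow]
    change hexNorm _ + hexNorm _ = 1
    rw [hexNorm_mul h, hexNorm_mul h]
    exact s.2⟩
  one_smul s := Subtype.ext (Prod.ext (one_mul _) (one_mul _))
  mul_smul ζ ξ s := Subtype.ext (Prod.ext (mul_assoc _ _ _) (mul_assoc _ _ _))

section Lens

variable (n : ℕ) [hn : Fact (n ∣ 6)]

theorem hexAction_apply (ζ : rootsOfUnity n ℂ) (s : hexSphere) :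
    (ζ • s).1 = (((ζ : ℂˣ) : ℂ) * s.1.1, ((ζ : ℂˣ) : ℂ) * s.1.2) := rfl

instance : ContinuousConstSMul (rootsOfUnity n ℂ) hexSphere where
  continuous_const_smul ζ := by
    apply Continuous.subtype_mk
    fun_prop

instance : NeZero n := ⟨by
  rintro rfl
  have := hn.out
  omega⟩

/-- The action is free. -/
instance : IsCancelSMul (rootsOfUnity n ℂ) hexSphere where
  right_cancel' ζ ξ s h := by
    have h1 := congrArg (fun t : hexSphere => t.1.1) h
    have h2 := congrArg (fun t : hexSphere => t.1.2) h
    simp only [hexAction_apply] at h1 h2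
    apply Subtype.ext
    apply Units.ext
    by_cases hz : s.1.1 = 0
    · by_cases hw : s.1.2 = 0
      · have hs : hexNorm s.1.1 + hexNorm s.1.2 = 1 := s.2
        rw [hz, hw, hexNorm_zero] at hs
        norm_num at hs
      · exact mul_right_cancel₀ hw h2
    · exact mul_right_cancel₀ hz h1

/-- The quotient of the sphere in `ℂ²` by the scalar action of the `n`-th roots of unity: the
projective space for `n = 2` and the lens space `L(3,1)` for `n = 3`. -/
def LensSpace : Type := MulAction.orbitRel.Quotient (rootsOfUnity n ℂ) hexSphere

instance : TopologicalSpace (LensSpace n) :=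
  inferInstanceAs (TopologicalSpace (Quotient (MulAction.orbitRel (rootsOfUnity n ℂ) hexSphere)))

instance : CompactSpace (LensSpace n) :=
  inferInstanceAs (CompactSpace (Quotient (MulAction.orbitRel (rootsOfUnity n ℂ) hexSphere)))

instance : T2Space (LensSpace n) :=
  inferInstanceAs (T2Space (Quotient (MulAction.orbitRel (rootsOfUnity n ℂ) hexSphere)))

/-- The quotient map from the sphere. -/
def lensMk : hexSphere → LensSpace n :=
  Quotient.mk (MulAction.orbitRel (rootsOfUnity n ℂ) hexSphere)

theorem lensMk_surjective : Function.Surjective (lensMk n) := Quotient.mk_surjective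

theorem lensMk_eq_iff {s t : hexSphere} :
    lensMk n s = lensMk n t ↔ ∃ ζ : rootsOfUnity n ℂ, ζ • t = s :=
  Quotient.eq

theorem isLocalHomeomorph_lensMk : IsLocalHomeomorph (lensMk n) :=
  (isQuotientCoveringMap_quotientMk_of_properlyDiscontinuousSMul
    (G := rootsOfUnity n ℂ) (E := hexSphere)).isCoveringMap.isLocalHomeomorph

/-- Charts of the sphere induce charts of the quotient. -/
theorem exists_lens_chart {e : OpenPartialHomeomorph hexSphere V3}
    (he : e ∈ polyhedralAtlas (id : hexSphere → hexSphere)) (s : hexSphere) (hs : s ∈ e.source) :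
    ∃ φ ∈ polyhedralAtlas (lensMk n), lensMk n s ∈ φ.source ∧
      ∀ x ∈ φ.source, ∃ t ∈ e.source, lensMk n t = x ∧ φ x = e t := by
  obtain ⟨L, hsL, hL⟩ := isLocalHomeomorph_lensMk n s
  have hLs : L.symm (lensMk n s) = s := by rw [hL]; exact L.left_inv hsL
  have hLt : ∀ x ∈ L.target, lensMk n (L.symm x) = x := fun x hx => by
    rw [hL]; exact L.right_inv hx
  obtain ⟨⟨T, hT, hTe⟩, ⟨T', hT', hTe'⟩⟩ := he
  refine ⟨L.symm.trans e, ⟨?_, ?_⟩, ?_, ?_⟩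
  · let r : rootsOfUnity n ℂ → (ℂ × ℂ →ₗ[ℝ] ℂ × ℂ) := fun ζ =>
      LinearMap.lsmul ℂ (ℂ × ℂ) ((ζ : ℂˣ) : ℂ) |>.restrictScalars ℝ
    refine ⟨image2 (fun A ζ => A.comp (r ζ).toAffineMap) T univ, hT.image2 _ finite_univ, ?_⟩
    intro t ht
    simp only [OpenPartialHomeomorph.trans_source, OpenPartialHomeomorph.symm_source,
      mem_inter_iff, mem_preimage] at ht
    obtain ⟨ζ, hζ⟩ := (lensMk_eq_iff n).1 (hLt _ ht.1)
    obtain ⟨A, hA, hAt⟩ := hTe _ ht.2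
    refine ⟨_, mem_image2_of_mem hA (mem_univ ζ), ?_⟩
    change e (L.symm (lensMk n t)) = A (((ζ : ℂˣ) : ℂ) • t.1)
    refine hAt.trans (congrArg A ?_)
    exact congrArg Subtype.val hζ.symm
  · refine ⟨T', hT', fun y hy => ?_⟩
    simp only [OpenPartialHomeomorph.trans_target, OpenPartialHomeomorph.symm_target,
      mem_inter_iff, mem_preimage] at hy
    obtain ⟨A, hA, t, ht, hte⟩ := hTe' y hy.1
    refine ⟨A, hA, t, ht, ?_⟩
    change lensMk n t = L (e.symm y)
    rw [hL]
    exact congrArg L hte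
  · simp only [OpenPartialHomeomorph.trans_source, OpenPartialHomeomorph.symm_source,
      mem_inter_iff, mem_preimage]
    exact ⟨by rw [hL]; exact L.map_source hsL, by rw [hLs]; exact hs⟩
  · intro x hx
    simp only [OpenPartialHomeomorph.trans_source, OpenPartialHomeomorph.symm_source,
      mem_inter_iff, mem_preimage] at hx
    exact ⟨L.symm x, hx.2, hLt x hx.1, rfl⟩

/-- The linear automorphism of `ℂ²` given by multiplication by a nonzero complex number. -/
def scale (u : ℂˣ) : (ℂ × ℂ) ≃ₗ[ℝ] (ℂ × ℂ) :=
  (LinearEquiv.smulOfUnit u : (ℂ × ℂ) ≃ₗ[ℂ] (ℂ × ℂ)).restrictScalars ℝ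

theorem exists_chart_of_fst_ne_zero (s : hexSphere) (hs : s.1.1 ≠ 0) :
    ∃ e ∈ polyhedralAtlas (id : hexSphere → hexSphere), s ∈ e.source ∧
      ∀ t ∈ e.source, (e t 0 = 0 ∧ e t 1 = 0 ↔ t.1.2 = 0) := by
  obtain ⟨u, hu, hus⟩ := exists_rotate_mem_sector hs
  have hu0 : u ≠ 0 := by
    rintro rfl
    norm_num at hu
  obtain ⟨e, he, hes, hef⟩ := exists_hexSphere_chart (scale (Units.mk0 u hu0)) (fun t => by
    change hexNorm (u * t.1) + hexNorm (u * t.2) = 1 ↔ hexNorm t.1 + hexNorm t.2 = 1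
    rw [hexNorm_mul hu, hexNorm_mul hu])
  refine ⟨e, he, by rw [hes]; exact hus, fun t _ => ?_⟩
  rw [hef, hexCoord_zero, hexCoord_one]
  change (u * t.1.2).re = 0 ∧ (u * t.1.2).im = 0 ↔ _
  rw [← mul_eq_zero_iff_left hu0 (b := t.1.2), Complex.ext_iff]
  rfl

theorem exists_chart_of_snd_ne_zero (s : hexSphere) (hs : s.1.2 ≠ 0) :
    ∃ e ∈ polyhedralAtlas (id : hexSphere → hexSphere), s ∈ e.source ∧
      ∀ t ∈ e.source, t.1.2 ≠ 0 := by
  obtain ⟨u, hu, hus⟩ := exists_rotate_mem_sector hs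
  have hu0 : u ≠ 0 := by
    rintro rfl
    norm_num at hu
  obtain ⟨e, he, hes, hef⟩ := exists_hexSphere_chart
    ((LinearEquiv.prodComm ℝ ℂ ℂ).trans (scale (Units.mk0 u hu0))) (fun t => by
      change hexNorm (u * t.2) + hexNorm (u * t.1) = 1 ↔ hexNorm t.1 + hexNorm t.2 = 1
      rw [hexNorm_mul hu, hexNorm_mul hu, add_comm])
  refine ⟨e, he, by rw [hes]; exact hus, fun t ht h0 => ?_⟩
  rw [hes] at ht
  have ht' : u * t.1.2 ∈ sector := ht
  rw [h0, mul_zero] at ht'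
  have := ht'.1
  simp [hexA] at this

theorem exists_mem_source (x : LensSpace n) : ∃ φ ∈ polyhedralAtlas (lensMk n), x ∈ φ.source := by
  obtain ⟨s, rfl⟩ := lensMk_surjective n x
  by_cases hs : s.1.2 = 0
  · have hz : s.1.1 ≠ 0 := fun hz => by
      have h : hexNorm s.1.1 + hexNorm s.1.2 = 1 := s.2
      rw [hz, hs, hexNorm_zero] at h
      norm_num at h
    obtain ⟨e, he, hse, -⟩ := exists_chart_of_fst_ne_zero s hz
    obtain ⟨φ, hφ, hsφ, -⟩ := exists_lens_chart n he s hse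
    exact ⟨φ, hφ, hsφ⟩
  · obtain ⟨e, he, hse, -⟩ := exists_chart_of_snd_ne_zero s hs
    obtain ⟨φ, hφ, hsφ, -⟩ := exists_lens_chart n he s hse
    exact ⟨φ, hφ, hsφ⟩

instance : ChartedSpace V3 (LensSpace n) :=
  polyhedralChartedSpace (lensMk n) (exists_mem_source n)

instance : HasGroupoid (LensSpace n) plGroupoid := polyhedralChartedSpace_hasGroupoid _ _

/-- The image in the quotient of the circle `w = 0` in the sphere. It is one of the fibres of the
Seifert fibration induced by the Hopf fibration `(z, w) ↦ [z : w]`; all of these are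
nonsingular and isotopic to each other. -/
def lensFibre : Set (LensSpace n) := lensMk n '' {s | s.1.2 = 0}

theorem lensMk_mem_lensFibre {s : hexSphere} : lensMk n s ∈ lensFibre n ↔ s.1.2 = 0 := by
  refine ⟨?_, fun h => ⟨s, h, rfl⟩⟩
  rintro ⟨t, ht, h⟩
  obtain ⟨ζ, rfl⟩ := (lensMk_eq_iff n).1 h
  have ht' : ((ζ : ℂˣ) : ℂ) * s.1.2 = 0 := ht
  exact (mul_eq_zero.1 ht').resolve_left (Units.ne_zero _)

open Classical in
/-- The orbifold with support the quotient of the `3`-sphere by the `n`-th roots of unity, and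
with singular set the nonsingular fibre `w = 0`, of order `p`. For `p = 1` it is the manifold,
with empty singular set. -/
def lensOrbifold (p : ℕ) (hp : 1 ≤ p) : ClosedOrbifold where
  carrier := LensSpace n
  label x := if x ∈ lensFibre n then p else 1
  locally_discal := by
    intro x
    obtain ⟨s, rfl⟩ := lensMk_surjective n x
    by_cases hs : s.1.2 = 0
    · have hz : s.1.1 ≠ 0 := fun hz => by
        have h : hexNorm s.1.1 + hexNorm s.1.2 = 1 := s.2
        rw [hz, hs, hexNorm_zero] at h
        norm_num at h
      obtain ⟨e, he, hse, hel⟩ := exists_chart_of_fst_ne_zero s hz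
      obtain ⟨φ, hφ, hsφ, h⟩ := exists_lens_chart n he s hse
      refine exists_discal_chart (plGroupoid.subset_maximalAtlas hφ) hsφ (discalAt_cyclic hp _)
        fun y hy => ?_
      obtain ⟨t, hte, rfl, hty⟩ := h y hy
      simp only [lensMk_mem_lensFibre, cyclicLabel, hty, hel t hte]
    · obtain ⟨e, he, hse, hel⟩ := exists_chart_of_snd_ne_zero s hs
      obtain ⟨φ, hφ, hsφ, h⟩ := exists_lens_chart n he s hse
      refine exists_discal_chart (plGroupoid.subset_maximalAtlas hφ) hsφ (discalAt_ordinary _)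
        fun y hy => ?_
      obtain ⟨t, hte, rfl, -⟩ := h y hy
      exact if_neg fun h0 => hel t hte ((lensMk_mem_lensFibre n).1 h0)

end Lens

instance : Fact (2 ∣ 6) := ⟨by norm_num⟩

instance : Fact (3 ∣ 6) := ⟨by norm_num⟩

/-- The orbifold `(ℙ³, F_p)`. -/
def projectiveFibre (p : ℕ) (hp : 1 ≤ p) : ClosedOrbifold := lensOrbifold 2 p hp

/-- The orbifold `(L_{3,1}, F_p)`. -/
def lensThreeFibre (p : ℕ) (hp : 1 ≤ p) : ClosedOrbifold := lensOrbifold 3 p hp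

end Orbifold3

end

open Orbifold3

/-!
The values of the complexity come from lower bounds which hold for every spine, and from explicit
spines without vertices which attain them.

*Lower bounds.* A component of the complement of a spine is an open discal orbifold. Its singular
set is either empty or not compact, and it contains at most one vertex of the singular set of the
orbifold. If the singular set of the orbifold is a circle, the circle therefore cannot be disjoint
from the spine (`IsSpine.inter_singularSet_nonempty`), and it contributes at least `p - 1`. If it
consists of three edges joining two vertices, then each of the edges meets the spine
(`IsSpine.inter_nonempty`, `IsSpine.exists_mem_edge`), and the contribution is at least
`(p - 1) + (q - 1) + (r - 1)`. Since the contribution of the singular set alone attains the minimum,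
a spine whose complexity is the minimum has no vertices (`complexity_eq_of_spine`).

*Special polyhedra have vertices* (`IsSpecial.vertices_nonempty`). In an almost-special polyhedron
without vertices the singular points form a compact one-dimensional manifold, whose components
are circles (`nonempty_homeomorph_circle`). If the polyhedron is special there are thus no singular
points, so its components are at the same time compact and open discs, which is absurd unless it is
empty; and spines are not empty. Here one has to know that the local structure of a polyhedron at a
point is well-defined: the book of three half-planes is not PL equivalent to a plane
(`no_injective_plOn_bookModel`), nor the neighbourhood of a vertex to the book
(`not_germ_vertexModel_bookModel`). The former is shown without any algebraic topology: at a generic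
point of the axis an injective PL map would be affine on each of the three pages, and it would send
two of them to the same side of the image of the axis.

*Spines.* For the cyclic spherical orbifold a disc meeting the singular circle once
(`isSpine_octDisc`), for the vertex spherical orbifold the equatorial sphere (`isSpine_equator`).
For the two quotients of the sphere in `ℂ²`, the image of the part of the sphere where the first
coordinate lies in a cone `K` over two, respectively three, points of the circle (`SpineCone.isSpine`,
`spineCone_two`, `spineCone_three`): a projective plane, and a disc whose boundary is wrapped
three times around a circle. The complement of each of these is a union of PL discs, by explicit
piecewise affine charts, and near each of their points they are modelled on a plane, a half-plane or
the book, so that they are simple and have no vertices (`isSimple_of_modeledAt`,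
`vertices_eq_empty_of_modeledAt`).
-/

noncomputable section

namespace Orbifold3

/-! ### PL maps and germs -/

section PL

variable {E F G : Type*} [NormedAddCommGroup E] [NormedSpace ℝ E]
  [NormedAddCommGroup F] [NormedSpace ℝ F] [NormedAddCommGroup G] [NormedSpace ℝ G]

theorem PLOn.mono {f : E → F} {s t : Set E} (h : PLOn f t) (hst : s ⊆ t) : PLOn f s := by
  refine ⟨h.1.mono hst, fun x hx => ?_⟩
  obtain ⟨U, hU, hf⟩ := h.2 x (hst hx)
  exact ⟨U, nhdsWithin_mono x hst hU, hf⟩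

theorem PLOn.comp {f : E → F} {g : F → G} {s : Set E} {t : Set F} (hg : PLOn g t)
    (hf : PLOn f s) (hst : MapsTo f s t) : PLOn (g ∘ f) s := by
  refine ⟨hg.1.comp hf.1 hst, fun x hx => ?_⟩
  obtain ⟨U, hU, hfU⟩ := hf.2 x hx
  obtain ⟨W, hW, hgW⟩ := hg.2 (f x) (hst hx)
  exact ⟨U ∩ f ⁻¹' W, inter_mem hU ((hf.1 x hx).tendsto_nhdsWithin hst hW), hgW.comp hfU⟩

theorem PLOn.congr {f g : E → F} {s : Set E} (h : PLOn f s) (hfg : ∀ x ∈ s, g x = f x) :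
    PLOn g s := by
  refine ⟨h.1.congr hfg, fun x hx => ?_⟩
  obtain ⟨U, hU, hf⟩ := h.2 x hx
  exact ⟨U ∩ s, inter_mem hU self_mem_nhdsWithin,
    (hf.mono inter_subset_left).congr fun y hy => hfg y hy.2⟩

theorem PLGermEquiv.symm {A : Set E} {a : E} {B : Set F} {b : F} (h : PLGermEquiv A a B b)
    (ha : a ∈ A) : PLGermEquiv B b A a := by
  obtain ⟨h, h1, h2, h3, h4, h5, h6, h7⟩ := h
  refine ⟨h.symm, h3, h4, h1, h2, ?_, h7, h6⟩
  rw [← h5]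
  exact h.left_inv (mem_of_mem_nhdsWithin ha h2)

theorem PLGermEquiv.mem {A : Set E} {a : E} {B : Set F} {b : F} (h : PLGermEquiv A a B b)
    (ha : a ∈ A) : b ∈ B := by
  obtain ⟨h, h1, h2, h3, h4, h5, h6, h7⟩ := h
  rw [← h5]
  exact h3 (h.map_source (mem_of_mem_nhdsWithin ha h2))

theorem PLGermEquiv.trans {A : Set E} {a : E} {B : Set F} {b : F} {C : Set G} {c : G}
    (h : PLGermEquiv A a B b) (k : PLGermEquiv B b C c) (ha : a ∈ A) : PLGermEquiv A a C c := by
  have hb := h.mem ha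
  obtain ⟨h, h1, h2, h3, h4, h5, h6, h7⟩ := h
  obtain ⟨k, k1, k2, k3, k4, k5, k6, k7⟩ := k
  have has : a ∈ h.source := mem_of_mem_nhdsWithin ha h2
  have hbs : b ∈ k.source := mem_of_mem_nhdsWithin hb k2
  have hc : Tendsto h (𝓝[A] a) (𝓝[B] b) := by
    rw [← h5]
    refine Tendsto.mono_left ((h6.1 a has).tendsto_nhdsWithin fun x hx => h3 (h.map_source hx)) ?_
    rw [nhdsWithin_le_iff]
    exact h2
  have hk : Tendsto k.symm (𝓝[C] c) (𝓝[B] b) := by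
    have h8 : k.symm c = b := by rw [← k5, k.left_inv hbs]
    have hct : c ∈ k.target := k5 ▸ k.map_source hbs
    rw [← h8]
    refine Tendsto.mono_left
      ((k7.1 c hct).tendsto_nhdsWithin fun x hx => k1 (k.map_target hx)) ?_
    rw [nhdsWithin_le_iff]
    exact k4
  refine ⟨h.trans k, fun x hx => h1 hx.1, inter_mem h2 (hc k2), ?_, ?_, ?_, ?_, ?_⟩
  · intro x hx
    rw [PartialEquiv.trans_target] at hx
    exact k3 hx.1
  · rw [PartialEquiv.trans_target]
    exact inter_mem k4 (hk h4)
  · simp [h5, k5]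
  · exact k6.comp (h6.mono inter_subset_left) fun x hx => hx.2
  · rw [PartialEquiv.trans_target]
    exact h7.comp (k7.mono inter_subset_left) fun x hx => hx.2

theorem finitelyAffineOn_coord {ι : Type*} [Fintype ι] (i : ι) (s : Set (ι → ℝ)) :
    FinitelyAffineOn (fun y : ι → ℝ => y i) s :=
  FinitelyAffineOn.linear (LinearMap.proj i) s

theorem FinitelyAffineOn.const_mul {f : E → ℝ} {s : Set E} (hf : FinitelyAffineOn f s) (c : ℝ) :
    FinitelyAffineOn (fun x => c * f x) s :=
  hf.linear_comp (c • LinearMap.id)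

theorem FinitelyAffineOn.min {f g : E → ℝ} {s : Set E}
    (hf : FinitelyAffineOn f s) (hg : FinitelyAffineOn g s) :
    FinitelyAffineOn (fun x => min (f x) (g x)) s := by
  refine ((hf.const_mul (-1)).max (hg.const_mul (-1))).const_mul (-1) |>.congr fun x _ => ?_
  rw [neg_one_mul, neg_one_mul, neg_one_mul, max_neg_neg, neg_neg]

theorem finitelyAffineOn_vec3 {f g h : E → ℝ} {s : Set E} (hf : FinitelyAffineOn f s)
    (hg : FinitelyAffineOn g s) (hh : FinitelyAffineOn h s) :
    FinitelyAffineOn (fun x => (![f x, g x, h x] : V3)) s := by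
  apply FinitelyAffineOn.pi
  intro i
  fin_cases i
  exacts [hf, hg, hh]

end PL

/-- A piecewise affine homeomorphism of `ℝ³` with finitely many pieces. -/
structure PLAut extends V3 ≃ₜ V3 where
  finitelyAffine : FinitelyAffineOn toFun univ
  finitelyAffine_symm : FinitelyAffineOn invFun univ

namespace PLAut

instance : CoeFun PLAut fun _ => V3 → V3 := ⟨fun Θ => ⇑Θ.toHomeomorph⟩

/-- The inverse of a piecewise affine homeomorphism. -/
def symm (Θ : PLAut) : PLAut := ⟨Θ.toHomeomorph.symm, Θ.finitelyAffine_symm, Θ.finitelyAffine⟩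

/-- The composition of piecewise affine homeomorphisms. -/
def trans (Θ Ξ : PLAut) : PLAut where
  toHomeomorph := Θ.toHomeomorph.trans Ξ.toHomeomorph
  finitelyAffine := (Ξ.finitelyAffine.comp Θ.finitelyAffine).mono fun _ _ => ⟨trivial, trivial⟩
  finitelyAffine_symm :=
    (Θ.finitelyAffine_symm.comp Ξ.finitelyAffine_symm).mono fun _ _ => ⟨trivial, trivial⟩

theorem trans_apply (Θ Ξ : PLAut) (v : V3) : Θ.trans Ξ v = Ξ (Θ v) := rfl

theorem symm_apply_apply (Θ : PLAut) (v : V3) : Θ.symm (Θ v) = v := Θ.left_inv v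

theorem apply_symm_apply (Θ : PLAut) (v : V3) : Θ (Θ.symm v) = v := Θ.right_inv v

theorem continuous (Θ : PLAut) : Continuous Θ := Θ.toHomeomorph.continuous

/-- A pair of mutually inverse continuous piecewise affine maps. -/
def ofInverse (f g : V3 → V3) (hf : Continuous f) (hg : Continuous g)
    (hf' : FinitelyAffineOn f univ) (hg' : FinitelyAffineOn g univ) (hgf : ∀ v, g (f v) = v)
    (hfg : ∀ v, f (g v) = v) : PLAut where
  toFun := f
  invFun := g
  left_inv := hgf
  right_inv := hfg
  continuous_toFun := hf
  continuous_invFun := hg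
  finitelyAffine := hf'
  finitelyAffine_symm := hg'

/-- An affine automorphism of `ℝ³`. -/
def ofAffine (T : V3 ≃ᵃ[ℝ] V3) : PLAut where
  toHomeomorph := T.toContinuousAffineEquiv.toHomeomorph
  finitelyAffine := FinitelyAffineOn.affine T.toAffineMap univ
  finitelyAffine_symm := FinitelyAffineOn.affine T.symm.toAffineMap univ

/-- The translation taking `a` to `0`. -/
def translate (a : V3) : PLAut := ofAffine (AffineEquiv.constVAdd ℝ V3 (-a))

theorem translate_apply (a v : V3) : translate a v = v - a := by
  change -a +ᵥ v = v - a
  simp [sub_eq_neg_add]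

/-- A permutation of the coordinates. -/
def perm (σ : Equiv.Perm (Fin 3)) : PLAut :=
  ofAffine (LinearEquiv.funCongrLeft ℝ ℝ σ).toAffineEquiv

theorem perm_apply (σ : Equiv.Perm (Fin 3)) (v : V3) (i : Fin 3) : perm σ v i = v (σ i) := rfl

theorem mem_plGroupoid (Θ : PLAut) : Θ.toHomeomorph.toOpenPartialHomeomorph ∈ plGroupoid :=
  mem_groupoid_of_pregroupoid.2
    ⟨Θ.finitelyAffine.plOn Θ.continuous.continuousOn,
      Θ.finitelyAffine_symm.plOn Θ.symm.continuous.continuousOn⟩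

end PLAut

theorem PLGermEquiv.of_plAut (Θ : PLAut) {A B : Set V3} {a : V3}
    (h : ∀ᶠ v in 𝓝 a, (v ∈ A ↔ Θ v ∈ B)) : PLGermEquiv A a B (Θ a) := by
  refine ⟨Θ.toEquiv.toPartialEquiv.restr (A ∩ Θ ⁻¹' B), ?_, ?_, ?_, ?_, rfl, ?_, ?_⟩
  · rw [PartialEquiv.restr_source]
    exact fun x hx => hx.2.1
  · rw [PartialEquiv.restr_source]
    refine inter_mem univ_mem (inter_mem self_mem_nhdsWithin ?_)
    filter_upwards [nhdsWithin_le_nhds h, self_mem_nhdsWithin] with x hx hxA using hx.1 hxA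
  · rw [PartialEquiv.restr_target]
    rintro x ⟨-, -, hx⟩
    exact (Θ.apply_symm_apply x) ▸ hx
  · rw [PartialEquiv.restr_target]
    refine inter_mem univ_mem ?_
    have hc : Tendsto Θ.symm (𝓝 (Θ a)) (𝓝 a) := by
      have := Θ.symm.continuous.tendsto (Θ a)
      rwa [Θ.symm_apply_apply] at this
    filter_upwards [nhdsWithin_le_nhds (hc.eventually h), self_mem_nhdsWithin] with x hx hxB
    have hxB' : Θ (Θ.symm x) ∈ B := by rwa [Θ.apply_symm_apply]
    exact ⟨hx.2 hxB', hxB'⟩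
  · exact (Θ.finitelyAffine.plOn Θ.continuous.continuousOn).mono (subset_univ _)
  · exact (Θ.finitelyAffine_symm.plOn Θ.symm.continuous.continuousOn).mono (subset_univ _)

theorem PLGermEquiv.of_plAut' (Θ : PLAut) {A B : Set V3} {a b : V3}
    (h : ∀ᶠ v in 𝓝 a, (v ∈ A ↔ Θ v ∈ B)) (hb : Θ a = b) : PLGermEquiv A a B b :=
  hb ▸ PLGermEquiv.of_plAut Θ h

theorem PLGermEquiv.of_eventually {A B : Set V3} {a : V3}
    (h : ∀ᶠ v in 𝓝 a, (v ∈ A ↔ v ∈ B)) : PLGermEquiv A a B a :=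
  PLGermEquiv.of_plAut' (PLAut.ofAffine (AffineEquiv.refl ℝ V3)) h rfl

/-! ### Links and PL charts -/

namespace ClosedOrbifold

variable {X : ClosedOrbifold} {P : Set X.carrier} {x : X.carrier}

theorem trans_plAut_mem_charts {φ : OpenPartialHomeomorph X.carrier V3} (hφ : φ ∈ X.charts)
    (Θ : PLAut) : φ.trans Θ.toHomeomorph.toOpenPartialHomeomorph ∈ X.charts :=
  trans_mem_maximalAtlas plGroupoid hφ Θ.mem_plGroupoid

theorem eventually_mem_image_iff {φ : OpenPartialHomeomorph X.carrier V3} (hx : x ∈ φ.source)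
    {B : Set V3} (h : ∀ᶠ y in 𝓝 x, (y ∈ P ↔ φ y ∈ B)) :
    ∀ᶠ v in 𝓝 (φ x), (v ∈ φ '' (P ∩ φ.source) ↔ v ∈ B) := by
  have hc : Tendsto φ.symm (𝓝 (φ x)) (𝓝 x) := by
    have := φ.symm.continuousAt (φ.map_source hx)
    rwa [ContinuousAt, φ.left_inv hx] at this
  filter_upwards [hc.eventually h, φ.open_target.mem_nhds (φ.map_source hx)] with v hv hvt
  rw [φ.right_inv hvt] at hv
  rw [← hv]
  constructor
  · rintro ⟨y, hy, rfl⟩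
    rw [φ.left_inv hy.2]
    exact hy.1
  · exact fun h => ⟨_, ⟨h, φ.map_target hvt⟩, φ.right_inv hvt⟩

theorem hasLink_of_germ {φ : OpenPartialHomeomorph X.carrier V3} (hφ : φ ∈ X.charts)
    (hx : x ∈ φ.source) (hxP : x ∈ P) {B L : Set V3} (h : ∀ᶠ y in 𝓝 x, (y ∈ P ↔ φ y ∈ B))
    (hg : PLGermEquiv B (φ x) (cone L) 0) : X.HasLink P x L :=
  ⟨φ, hφ, hx, (PLGermEquiv.of_eventually (eventually_mem_image_iff hx h)).trans hg
    ⟨x, ⟨hxP, hx⟩, rfl⟩⟩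

theorem plOn_chart_change {φ ψ : OpenPartialHomeomorph X.carrier V3} (hφ : φ ∈ X.charts)
    (hψ : ψ ∈ X.charts) : PLOn (φ.symm.trans ψ) (φ.symm.trans ψ).source :=
  (mem_groupoid_of_pregroupoid.1 (plGroupoid.compatible_of_mem_maximalAtlas hφ hψ)).1

/-- The germ of a polyhedron at a point does not depend on the PL chart in which it is viewed. -/
theorem germ_chart_change {φ ψ : OpenPartialHomeomorph X.carrier V3} (hφ : φ ∈ X.charts)
    (hψ : ψ ∈ X.charts) (hx : x ∈ φ.source) (hx' : x ∈ ψ.source) :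
    PLGermEquiv (φ '' (P ∩ φ.source)) (φ x) (ψ '' (P ∩ ψ.source)) (ψ x) := by
  let h := ((φ.symm.trans ψ).toPartialEquiv.restr (φ.symm ⁻¹' P))
  have hs : h.source = φ.target ∩ φ.symm ⁻¹' (P ∩ ψ.source) := by
    ext v
    simp [h, PartialEquiv.restr_source, and_comm, and_left_comm]
  have ht : h.target = ψ.target ∩ ψ.symm ⁻¹' (P ∩ φ.source) := by
    ext v
    simp only [h, PartialEquiv.restr_target, OpenPartialHomeomorph.trans_toPartialEquiv,
      OpenPartialHomeomorph.symm_toPartialEquiv, PartialEquiv.trans_target,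
      PartialEquiv.symm_target, mem_inter_iff, mem_preimage]
    change (v ∈ ψ.target ∧ ψ.symm v ∈ φ.source) ∧ φ.symm (φ (ψ.symm v)) ∈ P ↔ _
    constructor
    · rintro ⟨⟨h1, h2⟩, h3⟩
      rw [φ.left_inv h2] at h3
      exact ⟨h1, h3, h2⟩
    · rintro ⟨h1, h3, h2⟩
      rw [φ.left_inv h2]
      exact ⟨⟨h1, h2⟩, h3⟩
  have key : ∀ {φ ψ : OpenPartialHomeomorph X.carrier V3}, x ∈ φ.source → x ∈ ψ.source →
      φ.target ∩ φ.symm ⁻¹' (P ∩ ψ.source) ∈ 𝓝[φ '' (P ∩ φ.source)] (φ x) := by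
    intro φ ψ hx hx'
    have hc : Tendsto φ.symm (𝓝 (φ x)) (𝓝 x) := by
      have := φ.symm.continuousAt (φ.map_source hx)
      rwa [ContinuousAt, φ.left_inv hx] at this
    filter_upwards [self_mem_nhdsWithin, nhdsWithin_le_nhds (hc (ψ.open_source.mem_nhds hx'))]
    rintro _ ⟨y, hy, rfl⟩ h2
    refine ⟨φ.map_source hy.2, ?_⟩
    rw [mem_preimage, φ.left_inv hy.2] at h2 ⊢
    exact ⟨hy.1, h2⟩
  have sub : ∀ {φ ψ : OpenPartialHomeomorph X.carrier V3},
      φ.target ∩ φ.symm ⁻¹' (P ∩ ψ.source) ⊆ φ '' (P ∩ φ.source) := fun {φ ψ} v hv =>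
    ⟨_, ⟨hv.2.1, φ.map_target hv.1⟩, φ.right_inv hv.1⟩
  refine ⟨h, ?_, ?_, ?_, ?_, ?_, ?_, ?_⟩
  · rw [hs]; exact sub
  · rw [hs]; exact key hx hx'
  · rw [ht]; exact sub
  · rw [ht]; exact key hx' hx
  · change ψ (φ.symm (φ x)) = ψ x
    rw [φ.left_inv hx]
  · exact (plOn_chart_change hφ hψ).mono fun v hv => by
      rw [hs] at hv
      simpa using ⟨hv.1, hv.2.2⟩
  · refine ((plOn_chart_change hψ hφ).mono fun v hv => ?_).congr fun _ _ => rfl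
    rw [ht] at hv
    simpa using ⟨hv.1, hv.2.2⟩

theorem HasLink.germ {L : Set V3} (h : X.HasLink P x L) (hxP : x ∈ P)
    {φ : OpenPartialHomeomorph X.carrier V3} (hφ : φ ∈ X.charts) (hx : x ∈ φ.source) :
    PLGermEquiv (φ '' (P ∩ φ.source)) (φ x) (cone L) 0 := by
  obtain ⟨ψ, hψ, hxψ, hg⟩ := h
  exact (germ_chart_change hφ hψ hx hxψ).trans hg ⟨x, ⟨hxP, hx⟩, rfl⟩

end ClosedOrbifold

/-! ### Local models of simple polyhedra -/

/-- The model of a polyhedron near a point with link a circle. -/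
def planeModel : Set V3 := {v | v 2 = 0}

/-- The model of a polyhedron near a boundary point. -/
def halfModel : Set V3 := {v | v 2 = 0 ∧ 0 ≤ v 1}

/-- The model of a polyhedron near a point whose link is a circle with two radii: three half-planes
along the first axis. -/
def bookModel : Set V3 := {v | v 2 = 0 ∨ v 1 = 0 ∧ 0 ≤ v 2}

/-- The model of a polyhedron near a vertex. -/
def vertexModel : Set V3 := {v | v 2 = 0 ∨ v 1 = 0 ∧ 0 ≤ v 2 ∨ v 0 = 0 ∧ 0 ≤ v 1 ∧ 0 ≤ v 2}

/-- Half of the PL circle: the link of a boundary point. -/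
def arcLink : Set V3 := {v | v 2 = 1 ∧ |v 0| + |v 1| = 1 ∧ 0 ≤ v 1}

/-- The piecewise affine homeomorphism flattening the cone over the PL circle. -/
def flatten : PLAut :=
  PLAut.ofInverse (fun v => ![v 0, v 1, v 2 - (|v 0| + |v 1|)])
    (fun v => ![v 0, v 1, v 2 + (|v 0| + |v 1|)])
    (by fun_prop) (by fun_prop)
    (finitelyAffineOn_vec3 (finitelyAffineOn_coord 0 _) (finitelyAffineOn_coord 1 _)
      ((finitelyAffineOn_coord 2 _).sub
        ((finitelyAffineOn_coord 0 _).abs.add (finitelyAffineOn_coord 1 _).abs)))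
    (finitelyAffineOn_vec3 (finitelyAffineOn_coord 0 _) (finitelyAffineOn_coord 1 _)
      ((finitelyAffineOn_coord 2 _).add
        ((finitelyAffineOn_coord 0 _).abs.add (finitelyAffineOn_coord 1 _).abs)))
    (fun v => by ext i; fin_cases i <;> simp) (fun v => by ext i; fin_cases i <;> simp)

theorem flatten_zero (v : V3) : flatten v 0 = v 0 := rfl
theorem flatten_one (v : V3) : flatten v 1 = v 1 := rfl
theorem flatten_two (v : V3) : flatten v 2 = v 2 - (|v 0| + |v 1|) := rfl

theorem flatten_map_zero : flatten 0 = 0 := by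
  ext i
  fin_cases i
  exacts [rfl, rfl, by simp [flatten_two]]

theorem mem_cone_circleWithRadii {R : Set (ℝ × ℝ)} {v : V3} :
    v ∈ cone (circleWithRadii R) ↔ v 2 = |v 0| + |v 1| ∨
      ∃ u ∈ R, ∃ s ∈ Icc 0 (v 2), v 0 = s * u.1 ∧ v 1 = s * u.2 := by
  constructor
  · rintro (rfl | ⟨t, ht, u, ⟨hu, hu' | ⟨r, hr, s, hs, h0, h1⟩⟩, rfl⟩)
    · simp
    · left
      simp only [Pi.smul_apply, smul_eq_mul, abs_mul, abs_of_nonneg ht, hu, mul_one]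
      rw [← mul_add, hu', mul_one]
    · right
      refine ⟨r, hr, t * s, ?_, ?_, ?_⟩
      · simp only [Pi.smul_apply, smul_eq_mul, hu, mul_one]
        exact ⟨mul_nonneg ht hs.1, mul_le_of_le_one_right ht hs.2⟩
      · simp only [Pi.smul_apply, smul_eq_mul, h0, mul_assoc]
      · simp only [Pi.smul_apply, smul_eq_mul, h1, mul_assoc]
  · intro h
    have h2 : 0 ≤ v 2 := by
      rcases h with h | ⟨u, -, s, hs, -⟩
      · rw [h]; positivity
      · exact hs.1.trans hs.2
    rcases h2.eq_or_lt with h2 | h2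
    · left
      rcases h with h | ⟨u, -, s, hs, h0, h1⟩
      · have a0 := abs_nonneg (v 0)
        have a1 := abs_nonneg (v 1)
        ext i
        fin_cases i
        · exact abs_eq_zero.1 (show |v 0| = 0 by linarith)
        · exact abs_eq_zero.1 (show |v 1| = 0 by linarith)
        · exact h2.symm
      · have : s = 0 := le_antisymm (hs.2.trans h2.symm.le) hs.1
        subst this
        ext i
        fin_cases i
        · simpa using h0
        · simpa using h1
        · exact h2.symm
    · right
      refine ⟨v 2, h2.le, (v 2)⁻¹ • v, ⟨?_, ?_⟩, ?_⟩
      · simp [h2.ne']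
      · rcases h with h | ⟨u, hu, s, hs, h0, h1⟩
        · left
          simp only [Pi.smul_apply, smul_eq_mul, abs_mul, abs_of_pos (inv_pos.2 h2)]
          rw [← mul_add, ← h, inv_mul_cancel₀ h2.ne']
        · right
          refine ⟨u, hu, (v 2)⁻¹ * s, ⟨by have := hs.1; positivity, ?_⟩, ?_, ?_⟩
          · rw [inv_mul_le_iff₀ h2, mul_one]
            exact hs.2
          · simp [h0, mul_assoc]
          · simp [h1, mul_assoc]
      · rw [smul_smul, mul_inv_cancel₀ h2.ne', one_smul]

theorem mem_cone_circleLink {v : V3} : v ∈ cone circleLink ↔ flatten v ∈ planeModel := by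
  rw [circleLink, mem_cone_circleWithRadii]
  simp only [mem_empty_iff_false, false_and, exists_false, or_false]
  exact sub_eq_zero.symm

theorem exists_radius_left_or_right {v : V3} :
    (v 2 = |v 0| + |v 1| ∨ (∃ s ∈ Icc 0 (v 2), v 0 = s * 1 ∧ v 1 = s * 0) ∨
      ∃ s ∈ Icc 0 (v 2), v 0 = s * (-1) ∧ v 1 = s * 0) ↔
    (v 2 = |v 0| + |v 1| ∨ v 1 = 0 ∧ |v 0| + |v 1| ≤ v 2) := by
  refine or_congr_right ?_
  constructor
  · rintro (⟨s, hs, h0, h1⟩ | ⟨s, hs, h0, h1⟩)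
    · refine ⟨by linarith, ?_⟩
      rw [h0, h1, mul_one, mul_zero, abs_zero, abs_of_nonneg hs.1, add_zero]
      exact hs.2
    · refine ⟨by linarith, ?_⟩
      rw [h0, h1, mul_neg_one, mul_zero, abs_zero, abs_neg, abs_of_nonneg hs.1, add_zero]
      exact hs.2
  · rintro ⟨h1, h⟩
    rw [h1, abs_zero, add_zero] at h
    rcases le_total 0 (v 0) with h0 | h0
    · rw [abs_of_nonneg h0] at h
      exact Or.inl ⟨v 0, ⟨h0, h⟩, by ring, by linarith⟩
    · rw [abs_of_nonpos h0] at h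
      exact Or.inr ⟨-v 0, ⟨by linarith, h⟩, by ring, by linarith⟩

theorem mem_cone_thetaLink {v : V3} : v ∈ cone thetaLink ↔ flatten v ∈ bookModel := by
  rw [thetaLink, mem_cone_circleWithRadii]
  simp only [mem_insert_iff, mem_singleton_iff, exists_eq_or_imp, exists_eq_left]
  rw [exists_radius_left_or_right]
  simp only [bookModel, mem_ofPred_eq, flatten_one, flatten_two, sub_eq_zero, sub_nonneg]

theorem mem_cone_vertexLink {v : V3} : v ∈ cone vertexLink ↔ flatten v ∈ vertexModel := by
  rw [vertexLink, mem_cone_circleWithRadii]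
  simp only [mem_insert_iff, mem_singleton_iff, exists_eq_or_imp, exists_eq_left]
  rw [← or_assoc (b := ∃ s ∈ Icc 0 (v 2), v 0 = s * (-1) ∧ v 1 = s * 0), ← or_assoc,
    exists_radius_left_or_right]
  simp only [vertexModel, mem_ofPred_eq, flatten_zero, flatten_one, flatten_two, sub_eq_zero,
    sub_nonneg, or_assoc]
  refine or_congr_right (or_congr_right ?_)
  constructor
  · rintro ⟨s, hs, h0, h1⟩
    rw [mul_zero] at h0
    rw [mul_one] at h1
    rw [h0, h1, abs_zero, abs_of_nonneg hs.1, zero_add]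
    exact ⟨rfl, hs⟩
  · rintro ⟨h0, h1, h⟩
    rw [h0, abs_zero, abs_of_nonneg h1, zero_add] at h
    exact ⟨v 1, ⟨h1, h⟩, by linarith, by ring⟩

theorem mem_cone_arcLink {v : V3} : v ∈ cone arcLink ↔ flatten v ∈ halfModel := by
  have h : v ∈ cone arcLink ↔ v ∈ cone circleLink ∧ 0 ≤ v 1 := by
    constructor
    · rintro (rfl | ⟨t, ht, u, ⟨hu, hu', h0⟩, rfl⟩)
      · exact ⟨Or.inl rfl, le_rfl⟩
      · exact ⟨Or.inr ⟨t, ht, u, ⟨hu, Or.inl hu'⟩, rfl⟩, mul_nonneg ht h0⟩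
    · rintro ⟨rfl | ⟨t, ht, u, ⟨hu, hu'⟩, rfl⟩, h0⟩
      · exact Or.inl rfl
      · rcases ht.eq_or_lt with rfl | ht'
        · exact Or.inl (zero_smul _ _)
        · refine Or.inr ⟨t, ht, u, ⟨hu, ?_, nonneg_of_mul_nonneg_right h0 ht'⟩, rfl⟩
          simpa using hu'
  rw [h, mem_cone_circleLink]
  rfl

theorem germ_of_flatten {M L : Set V3} (h : ∀ v, v ∈ cone L ↔ flatten v ∈ M) :
    PLGermEquiv M 0 (cone L) 0 :=
  (PLGermEquiv.of_plAut' flatten (Eventually.of_forall h) flatten_map_zero).symm (Or.inl rfl)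

theorem germ_of_flatten' {M L : Set V3} (h : ∀ v, v ∈ cone L ↔ flatten v ∈ M) :
    PLGermEquiv (cone L) 0 M 0 :=
  PLGermEquiv.of_plAut' flatten (Eventually.of_forall h) flatten_map_zero

/-! ### Polyhedra -/

theorem IsPolyhedron.union {A B : Set V3} (hA : IsPolyhedron A) (hB : IsPolyhedron B) :
    IsPolyhedron (A ∪ B) := by
  obtain ⟨K, hK, rfl⟩ := hA
  obtain ⟨K', hK', rfl⟩ := hB
  exact ⟨K ∪ K', hK.union hK', (biUnion_union _ _ _).symm⟩

theorem isPolyhedron_convexHull {s : Set V3} (hs : s.Finite) : IsPolyhedron (convexHull ℝ s) :=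
  ⟨{hs.toFinset}, finite_singleton _, by simp⟩

theorem isPolyhedron_segment (a b : V3) : IsPolyhedron (segment ℝ a b) := by
  rw [← convexHull_pair]
  exact isPolyhedron_convexHull (by simp)

open Pointwise in
theorem isPolyhedron_parallelogram (a u v : V3) :
    IsPolyhedron {x | ∃ s ∈ Icc (0 : ℝ) 1, ∃ t ∈ Icc (0 : ℝ) 1, x = a + s • u + t • v} := by
  have h : {x | ∃ s ∈ Icc (0 : ℝ) 1, ∃ t ∈ Icc (0 : ℝ) 1, x = a + s • u + t • v} =
      convexHull ℝ ({a} + {0, u} + {0, v}) := by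
    rw [convexHull_add, convexHull_add, convexHull_pair, convexHull_pair, convexHull_singleton]
    ext x
    simp only [Set.mem_add, segment_eq_image, smul_zero, zero_add, mem_image, mem_singleton_iff,
      mem_ofPred_eq]
    constructor
    · rintro ⟨s, hs, t, ht, rfl⟩
      exact ⟨a + s • u, ⟨a, rfl, s • u, ⟨s, hs, rfl⟩, rfl⟩, t • v, ⟨t, ht, rfl⟩, rfl⟩
    · rintro ⟨_, ⟨_, rfl, _, ⟨s, hs, rfl⟩, rfl⟩, _, ⟨t, ht, rfl⟩, rfl⟩
      exact ⟨s, hs, t, ht, rfl⟩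
  rw [h]
  exact isPolyhedron_convexHull (by
    refine Finite.add (Finite.add (finite_singleton _) ?_) ?_ <;> simp)

theorem isPolyhedron_edge {ε δ : ℝ} (hε : ε * ε = 1) (hδ : δ * δ = 1) :
    IsPolyhedron {v : V3 | v 2 = 1 ∧ 0 ≤ ε * v 0 ∧ 0 ≤ δ * v 1 ∧ ε * v 0 + δ * v 1 = 1} := by
  convert isPolyhedron_segment ![ε, 0, 1] ![0, δ, 1] using 1
  ext v
  constructor
  · rintro ⟨h2, h0, h1, h⟩
    refine ⟨ε * v 0, δ * v 1, h0, h1, h, ?_⟩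
    ext i
    fin_cases i
    · simp; linear_combination v 0 * hε
    · simp; linear_combination v 1 * hδ
    · simp; linarith
  · rintro ⟨a, b, ha, hb, hab, rfl⟩
    have e0 : ε * (a * ε) = a := by linear_combination a * hε
    have e1 : δ * (b * δ) = b := by linear_combination b * hδ
    refine ⟨by simp [hab], by simpa [e0] using ha, by simpa [e1] using hb, by simp [e0, e1, hab]⟩

theorem isPolyhedron_diameter : IsPolyhedron {v : V3 | v 2 = 1 ∧ v 1 = 0 ∧ |v 0| ≤ 1} := by
  convert isPolyhedron_segment ![1, 0, 1] ![-1, 0, 1] using 1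
  ext v
  constructor
  · rintro ⟨h2, h1, h0⟩
    rw [abs_le] at h0
    refine ⟨(1 + v 0) / 2, (1 - v 0) / 2, by linarith, by linarith, by ring, ?_⟩
    ext i
    fin_cases i
    · simp; ring
    · simp [h1]
    · simp; linarith
  · rintro ⟨a, b, ha, hb, hab, rfl⟩
    refine ⟨by simp [hab], by simp, ?_⟩
    simp only [Pi.add_apply, Pi.smul_apply, smul_eq_mul, Matrix.cons_val_zero]
    rw [abs_le]
    constructor <;> linarith

theorem isPolyhedron_arcLink : IsPolyhedron arcLink := by
  convert (isPolyhedron_edge (ε := 1) (δ := 1) (by norm_num) (by norm_num)).union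
    (isPolyhedron_edge (ε := -1) (δ := 1) (by norm_num) (by norm_num)) using 1
  ext v
  simp only [arcLink, mem_ofPred_eq, mem_union]
  constructor
  · rintro ⟨h2, h, h1⟩
    rw [abs_of_nonneg h1] at h
    rcases abs_cases (v 0) with ⟨h0, h0'⟩ | ⟨h0, h0'⟩
    · left; refine ⟨h2, ?_, ?_, ?_⟩ <;> linarith
    · right; refine ⟨h2, ?_, ?_, ?_⟩ <;> linarith
  · rintro (⟨h2, h0, h1, h⟩ | ⟨h2, h0, h1, h⟩)
    · refine ⟨h2, ?_, by linarith⟩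
      rw [abs_of_nonneg (by linarith), abs_of_nonneg (by linarith)]; linarith
    · refine ⟨h2, ?_, by linarith⟩
      rw [abs_of_nonpos (by linarith), abs_of_nonneg (by linarith)]; linarith

theorem isPolyhedron_circleLink : IsPolyhedron circleLink := by
  convert isPolyhedron_arcLink.union
    ((isPolyhedron_edge (ε := 1) (δ := -1) (by norm_num) (by norm_num)).union
    (isPolyhedron_edge (ε := -1) (δ := -1) (by norm_num) (by norm_num))) using 1
  ext v
  simp only [circleLink, circleWithRadii, arcLink, mem_ofPred_eq, mem_union, mem_empty_iff_false,
    false_and, exists_false, or_false]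
  constructor
  · rintro ⟨h2, h⟩
    rcases abs_cases (v 1) with ⟨h1, h1'⟩ | ⟨h1, h1'⟩
    · exact Or.inl ⟨h2, h, h1'⟩
    · right
      rcases abs_cases (v 0) with ⟨h0, h0'⟩ | ⟨h0, h0'⟩
      · left; refine ⟨h2, ?_, ?_, ?_⟩ <;> linarith
      · right; refine ⟨h2, ?_, ?_, ?_⟩ <;> linarith
  · rintro (⟨h2, h, -⟩ | ⟨h2, h0, h1, h⟩ | ⟨h2, h0, h1, h⟩)
    · exact ⟨h2, h⟩
    · refine ⟨h2, ?_⟩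
      rw [abs_of_nonneg (by linarith), abs_of_nonpos (by linarith)]; linarith
    · refine ⟨h2, ?_⟩
      rw [abs_of_nonpos (by linarith), abs_of_nonpos (by linarith)]; linarith

theorem isPolyhedron_thetaLink : IsPolyhedron thetaLink := by
  convert isPolyhedron_circleLink.union isPolyhedron_diameter using 1
  ext v
  simp only [circleLink, thetaLink, circleWithRadii, mem_ofPred_eq, mem_union, mem_empty_iff_false,
    false_and, exists_false, or_false, mem_insert_iff, mem_singleton_iff, exists_eq_or_imp,
    exists_eq_left]
  rw [← and_or_left]
  refine and_congr_right fun h2 => or_congr_right ?_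
  constructor
  · rintro (⟨s, hs, h0, h1⟩ | ⟨s, hs, h0, h1⟩)
    · refine ⟨by linarith, ?_⟩
      rw [h0, mul_one, abs_of_nonneg hs.1]
      exact hs.2
    · refine ⟨by linarith, ?_⟩
      rw [h0, mul_neg_one, abs_neg, abs_of_nonneg hs.1]
      exact hs.2
  · rintro ⟨h1, h⟩
    rcases le_total 0 (v 0) with h0 | h0
    · rw [abs_of_nonneg h0] at h
      exact Or.inl ⟨v 0, ⟨h0, h⟩, by ring, by linarith⟩
    · rw [abs_of_nonpos h0] at h
      exact Or.inr ⟨-v 0, ⟨by linarith, h⟩, by ring, by linarith⟩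

theorem circleLink_subset_vertexLink : circleLink ⊆ vertexLink := fun _ hv =>
  ⟨hv.1, hv.2.imp_right fun ⟨_, hu, _⟩ => hu.elim⟩

theorem arcLink_subset_vertexLink : arcLink ⊆ vertexLink := fun _ hv => ⟨hv.1, Or.inl hv.2.1⟩

theorem thetaLink_subset_vertexLink : thetaLink ⊆ vertexLink := fun _ hv =>
  ⟨hv.1, hv.2.imp_right fun ⟨u, hu, h⟩ => ⟨u, hu.elim Or.inl fun h => Or.inr (Or.inl h), h⟩⟩

theorem exists_isPolyhedron_halfModel :
    ∃ B, IsPolyhedron B ∧ ∀ᶠ v : V3 in 𝓝 0, (v ∈ halfModel ↔ v ∈ B) := by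
  refine ⟨_, isPolyhedron_parallelogram ![-1, 0, 0] ![2, 0, 0] ![0, 1, 0], ?_⟩
  filter_upwards [Metric.ball_mem_nhds (0 : V3) one_pos] with v hv
  have hv' : ∀ i, |v i| < 1 := fun i =>
    (norm_le_pi_norm v i).trans_lt (mem_ball_zero_iff.1 hv)
  have h0 := abs_lt.1 (hv' 0)
  have h1 := abs_lt.1 (hv' 1)
  constructor
  · rintro ⟨h2, h⟩
    refine ⟨(v 0 + 1) / 2, ⟨by linarith, by linarith⟩, v 1, ⟨h, h1.2.le⟩, ?_⟩
    ext i
    fin_cases i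
    · simp
    · simp
    · simpa using h2
  · rintro ⟨s, hs, t, ht, rfl⟩
    exact ⟨by simp, by simpa using ht.1⟩

theorem exists_isPolyhedron_of_mem_iff (Θ : PLAut) (hΘ : ∃ A : V3 ≃ᵃ[ℝ] V3, ∀ v, Θ v = A v)
    (h0 : Θ 0 = 0) {M N : Set V3} (hN : ∀ v, v ∈ N ↔ Θ v ∈ M)
    (hM : ∃ B, IsPolyhedron B ∧ ∀ᶠ v : V3 in 𝓝 0, (v ∈ M ↔ v ∈ B)) :
    ∃ B, IsPolyhedron B ∧ ∀ᶠ v : V3 in 𝓝 0, (v ∈ N ↔ v ∈ B) := by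
  obtain ⟨B, ⟨K, hK, rfl⟩, h⟩ := hM
  obtain ⟨A, hA⟩ := hΘ
  classical
  refine ⟨A.symm '' ⋃ s ∈ K, convexHull ℝ (s : Set V3), ⟨(fun s => s.image A.symm) '' K,
    hK.image _, ?_⟩, ?_⟩
  · rw [image_iUnion₂]
    simp only [biUnion_image, Finset.coe_image]
    refine iUnion₂_congr fun s _ => ?_
    exact A.symm.toAffineMap.image_convexHull _
  · have hc : Tendsto Θ (𝓝 0) (𝓝 0) := by
      have := Θ.continuous.tendsto 0
      rwa [h0] at this
    filter_upwards [hc.eventually h] with v hv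
    rw [hN, hv, hA]
    constructor
    · exact fun h => ⟨_, h, A.symm_apply_apply v⟩
    · rintro ⟨w, hw, rfl⟩
      rwa [A.apply_symm_apply]

theorem exists_isPolyhedron_union {M N : Set V3}
    (hM : ∃ B, IsPolyhedron B ∧ ∀ᶠ v : V3 in 𝓝 0, (v ∈ M ↔ v ∈ B))
    (hN : ∃ B, IsPolyhedron B ∧ ∀ᶠ v : V3 in 𝓝 0, (v ∈ N ↔ v ∈ B)) :
    ∃ B, IsPolyhedron B ∧ ∀ᶠ v : V3 in 𝓝 0, (v ∈ M ∪ N ↔ v ∈ B) := by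
  obtain ⟨B, hB, h⟩ := hM
  obtain ⟨B', hB', h'⟩ := hN
  refine ⟨_, hB.union hB', ?_⟩
  filter_upwards [h, h'] with v hv hv'
  rw [mem_union, mem_union, hv, hv']

theorem exists_isPolyhedron_planeModel :
    ∃ B, IsPolyhedron B ∧ ∀ᶠ v : V3 in 𝓝 0, (v ∈ planeModel ↔ v ∈ B) := by
  let T : V3 ≃ᵃ[ℝ] V3 := (LinearEquiv.neg ℝ).toAffineEquiv
  have h := exists_isPolyhedron_union exists_isPolyhedron_halfModel
    (exists_isPolyhedron_of_mem_iff (N := {v : V3 | v 2 = 0 ∧ v 1 ≤ 0}) (PLAut.ofAffine T)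
      ⟨T, fun _ => rfl⟩ (neg_zero) (M := halfModel) (fun v => by
        change v 2 = 0 ∧ v 1 ≤ 0 ↔ -v 2 = 0 ∧ 0 ≤ -v 1
        simp) exists_isPolyhedron_halfModel)
  convert h using 8
  ext v
  simp only [planeModel, halfModel, mem_union, mem_ofPred_eq, ← and_or_left]
  exact (and_iff_left (le_total 0 (v 1))).symm

theorem exists_isPolyhedron_bookModel :
    ∃ B, IsPolyhedron B ∧ ∀ᶠ v : V3 in 𝓝 0, (v ∈ bookModel ↔ v ∈ B) :=
  exists_isPolyhedron_union exists_isPolyhedron_planeModel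
    (exists_isPolyhedron_of_mem_iff (N := {v : V3 | v 1 = 0 ∧ 0 ≤ v 2})
      (PLAut.perm (Equiv.swap 1 2)) ⟨_, fun _ => rfl⟩ rfl (M := halfModel) (fun _ => Iff.rfl)
      exists_isPolyhedron_halfModel)

/-! ### Points at which a polyhedron is locally modelled on a subset of `ℝ³` -/

namespace ClosedOrbifold

variable {X : ClosedOrbifold} {P : Set X.carrier} {x : X.carrier}

variable (X) in
/-- In some PL chart centred at `x`, the set `P` coincides near `x` with `M`. -/
def ModeledAt (P : Set X.carrier) (x : X.carrier) (M : Set V3) : Prop :=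
  ∃ φ ∈ X.charts, x ∈ φ.source ∧ φ x = 0 ∧ ∀ᶠ y in 𝓝 x, (y ∈ P ↔ φ y ∈ M)

theorem modeledAt_of_plAut {φ : OpenPartialHomeomorph X.carrier V3} (hφ : φ ∈ X.charts)
    (hx : x ∈ φ.source) (Θ : PLAut) (h0 : Θ (φ x) = 0) {M : Set V3}
    (h : ∀ᶠ y in 𝓝 x, (y ∈ P ↔ Θ (φ y) ∈ M)) : X.ModeledAt P x M :=
  ⟨_, trans_plAut_mem_charts hφ Θ, by simpa using hx, h0, h⟩

theorem ModeledAt.hasLink {M L : Set V3} (h : X.ModeledAt P x M) (hx : x ∈ P)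
    (hg : PLGermEquiv M 0 (cone L) 0) : X.HasLink P x L := by
  obtain ⟨φ, hφ, hxφ, h0, h⟩ := h
  exact hasLink_of_germ hφ hxφ hx h (by rwa [h0])

theorem ModeledAt.germ {M L : Set V3} (h : X.ModeledAt P x M) (hx : x ∈ P)
    (hL : X.HasLink P x L) : PLGermEquiv M 0 (cone L) 0 := by
  obtain ⟨φ, hφ, hxφ, h0, h⟩ := h
  have h1 := PLGermEquiv.of_eventually (eventually_mem_image_iff hxφ h)
  have hm : φ x ∈ φ '' (P ∩ φ.source) := ⟨x, ⟨hx, hxφ⟩, rfl⟩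
  have h2 := (h1.symm hm).trans (hL.germ hx hφ hxφ) (h1.mem hm)
  rwa [h0] at h2

theorem ModeledAt.exists_isPolyhedron {M : Set V3} (h : X.ModeledAt P x M)
    (hM : ∃ B, IsPolyhedron B ∧ ∀ᶠ v : V3 in 𝓝 0, (v ∈ M ↔ v ∈ B)) :
    ∃ φ ∈ X.charts, x ∈ φ.source ∧ ∃ B : Set V3, IsPolyhedron B ∧
      ∀ᶠ y in 𝓝 x, (y ∈ P ↔ φ y ∈ B) := by
  obtain ⟨φ, hφ, hxφ, h0, h⟩ := h
  obtain ⟨B, hB, hMB⟩ := hM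
  refine ⟨φ, hφ, hxφ, B, hB, ?_⟩
  have hc := φ.continuousAt hxφ
  rw [ContinuousAt, h0] at hc
  filter_upwards [h, hc.eventually hMB] with y hy hy'
  rw [hy, hy']

theorem isSimple_of_modeledAt (hP : IsCompact P)
    (h : ∀ x ∈ P, X.ModeledAt P x planeModel ∨ X.ModeledAt P x halfModel ∨
      X.ModeledAt P x bookModel) : X.IsSimple P := by
  refine ⟨⟨hP, fun x hx => ?_⟩, fun x hx => ?_⟩
  · rcases h x hx with h | h | h
    · exact h.exists_isPolyhedron exists_isPolyhedron_planeModel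
    · exact h.exists_isPolyhedron exists_isPolyhedron_halfModel
    · exact h.exists_isPolyhedron exists_isPolyhedron_bookModel
  · rcases h x hx with h | h | h
    · exact ⟨_, circleLink_subset_vertexLink, isPolyhedron_circleLink,
        h.hasLink hx (germ_of_flatten fun _ => mem_cone_circleLink)⟩
    · exact ⟨_, arcLink_subset_vertexLink, isPolyhedron_arcLink,
        h.hasLink hx (germ_of_flatten fun _ => mem_cone_arcLink)⟩
    · exact ⟨_, thetaLink_subset_vertexLink, isPolyhedron_thetaLink,
        h.hasLink hx (germ_of_flatten fun _ => mem_cone_thetaLink)⟩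

end ClosedOrbifold

/-! ### A book of three half-planes does not embed piecewise linearly in a plane -/

section HalfDisc

variable {F : Type*} [NormedAddCommGroup F] [NormedSpace ℝ F]

/-- The half-disc of radius `ε` centred at the point `(s₀, 0)` of the boundary of the
half-plane. -/
def halfDisc (s₀ ε : ℝ) : Set (ℝ × ℝ) := {q | |q.1 - s₀| < ε ∧ 0 ≤ q.2 ∧ q.2 < ε}

theorem affine_eq_combination (A : ℝ × ℝ →ᵃ[ℝ] F) :
    ∃ c u w : F, ∀ q, A q = c + q.1 • u + q.2 • w := by
  refine ⟨A 0, A.linear (1, 0), A.linear (0, 1), fun q => ?_⟩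
  have h := A.map_vadd 0 q
  rw [vadd_eq_add, add_zero, vadd_eq_add] at h
  rw [h, add_comm, add_assoc, ← map_smul, ← map_smul, ← map_add]
  simp

/-- Two affine functions which coincide either at all or at none of the points of the boundary
line near `s₀` coincide, in the interior of a small half-disc, either at all or at no points. -/
theorem eventually_ne_of_affine {A A' : ℝ × ℝ →ᵃ[ℝ] F} {s₀ : ℝ}
    (h : (∀ s : ℝ, A (s, 0) = A' (s, 0)) ∨ A (s₀, 0) ≠ A' (s₀, 0)) :
    ∀ᶠ q in 𝓝 (s₀, (0 : ℝ)), 0 < q.2 → A q = A' q → ∀ q', A q' = A' q' := by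
  obtain ⟨c, u, w, hA⟩ := affine_eq_combination A
  obtain ⟨c', u', w', hA'⟩ := affine_eq_combination A'
  have hcont : ∀ {A : ℝ × ℝ →ᵃ[ℝ] F} {c u w : F}, (∀ q, A q = c + q.1 • u + q.2 • w) →
      Continuous A := fun {A c u w} h => by
    have : (A : ℝ × ℝ → F) = fun q => c + q.1 • u + q.2 • w := funext h
    rw [this]
    fun_prop
  rcases h with h | h
  · refine Eventually.of_forall fun q hq hqq q' => ?_
    simp only [hA, hA', zero_smul, add_zero] at h
    have h0 := h 0
    have h1 := h 1
    simp only [zero_smul, add_zero, one_smul] at h0 h1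
    rw [h0, add_right_inj] at h1
    rw [hA, hA', h0, h1, add_right_inj] at hqq
    rw [hA, hA', h0, h1, smul_right_injective F hq.ne' hqq]
  · filter_upwards [((hcont hA).continuousAt.sub (hcont hA').continuousAt).eventually_ne
      (sub_ne_zero.2 h)] with q hq _ hqq
    exact absurd (sub_eq_zero.2 hqq) hq

/-- A piecewise affine map on a half-disc is affine near all but finitely many points of the
diameter. -/
theorem exists_affine_near_boundary {f : ℝ × ℝ → F} {ε : ℝ} (hc : ContinuousOn f (halfDisc 0 ε))
    (hf : FinitelyAffineOn f (halfDisc 0 ε)) :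
    ∃ Z : Set ℝ, Z.Finite ∧ ∀ s₀, |s₀| < ε → s₀ ∉ Z →
      ∃ c u w : F, ∀ᶠ δ in 𝓝[>] (0 : ℝ), ∀ q ∈ halfDisc s₀ δ, f q = c + q.1 • u + q.2 • w := by
  obtain ⟨T, hT, hf⟩ := hf
  -- the parameters at which two affine pieces meet without agreeing along the boundary line
  let Z : Set ℝ := ⋃ A ∈ T, ⋃ A' ∈ T,
    {s | A (s, 0) = A' (s, 0) ∧ ¬ ∀ s : ℝ, A (s, 0) = A' (s, 0)}
  refine ⟨Z, hT.biUnion fun A _ => hT.biUnion fun A' _ => ?_, fun s₀ hs₀ hZ => ?_⟩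
  · apply Set.Subsingleton.finite
    rintro s ⟨hs, hn⟩ t ⟨ht, -⟩
    by_contra hst
    apply hn
    intro r
    obtain ⟨c, u, w, hA⟩ := affine_eq_combination A
    obtain ⟨c', u', w', hA'⟩ := affine_eq_combination A'
    simp only [hA, hA', zero_smul, add_zero] at hs ht ⊢
    have hu : (s - t) • u = (s - t) • u' := by
      rw [sub_smul, sub_smul, ← add_sub_add_left_eq_sub (s • u) (t • u) c, hs, ht,
        add_sub_add_left_eq_sub]
    have hu := smul_right_injective F (sub_ne_zero.2 hst) hu
    rw [hu, add_left_inj] at hs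
    rw [hu, hs]
  have hev : ∀ᶠ q in 𝓝 (s₀, (0 : ℝ)), ∀ A ∈ T, ∀ A' ∈ T,
      0 < q.2 → A q = A' q → ∀ q', A q' = A' q' := by
    rw [eventually_all_finite hT]
    intro A hA
    rw [eventually_all_finite hT]
    intro A' hA'
    apply eventually_ne_of_affine
    by_contra! h
    exact hZ (mem_biUnion hA (mem_biUnion hA' ⟨h.2, fun h' => h.1.elim fun s hs => hs (h' s)⟩))
  obtain ⟨δ₀, hδ₀, hev⟩ := Metric.eventually_nhds_iff.1 hev
  obtain ⟨δ, hδ, hδδ₀, hδε⟩ : ∃ δ > 0, δ ≤ δ₀ ∧ |s₀| + δ ≤ ε :=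
    ⟨min δ₀ (ε - |s₀|), lt_min hδ₀ (sub_pos.2 hs₀), min_le_left _ _, by
      linarith [min_le_right δ₀ (ε - |s₀|)]⟩
  have hsub : halfDisc s₀ δ ⊆ halfDisc 0 ε := by
    rintro q ⟨h1, h2, h3⟩
    refine ⟨?_, h2, by linarith [abs_nonneg s₀]⟩
    have := abs_sub_abs_le_abs_sub q.1 s₀
    rw [sub_zero]
    linarith
  let Q : Set (ℝ × ℝ) := Ioo (s₀ - δ) (s₀ + δ) ×ˢ Ioo 0 δ
  have hQ : Q ⊆ halfDisc s₀ δ := by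
    rintro q ⟨⟨h1, h2⟩, h3, h4⟩
    exact ⟨abs_lt.2 ⟨by linarith, by linarith⟩, h3.le, h4⟩
  have hQc : IsPreconnected Q := (isPreconnected_Ioo).prod isPreconnected_Ioo
  have hQ₀ : (s₀, δ / 2) ∈ Q :=
    ⟨⟨by simp; linarith, by simp; linarith⟩, by simp; linarith, by simp; linarith⟩
  obtain ⟨A, hA, hAf⟩ := hf _ (hsub (hQ hQ₀))
  have hcontA : ∀ A : ℝ × ℝ →ᵃ[ℝ] F, Continuous A := fun A => by
    obtain ⟨c, u, w, h⟩ := affine_eq_combination A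
    have : (A : ℝ × ℝ → F) = fun q => c + q.1 • u + q.2 • w := funext h
    rw [this]
    fun_prop
  have hfQ : Continuous fun q : Q => f q :=
    continuousOn_iff_continuous_domRestrict.1 (hc.mono (hQ.trans hsub))
  have hcl : ∀ A' : ℝ × ℝ →ᵃ[ℝ] F, IsClosed {q : Q | f q = A' q} := fun A' =>
    isClosed_eq hfQ ((hcontA A').comp continuous_subtype_val)
  have hclopen : IsClopen {q : Q | f q = A q} := by
    refine ⟨hcl A, ?_⟩
    have : {q : Q | f q = A q} = (⋃ A' ∈ T \ {A' | ∀ q, A' q = A q}, {q : Q | f q = A' q})ᶜ := by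
      ext q
      simp only [mem_ofPred_eq, mem_compl_iff, mem_iUnion, not_exists]
      constructor
      · rintro hq A' ⟨hA', hn⟩ hq'
        refine hn (hev ?_ A' hA' A hA q.2.2.1 (hq'.symm.trans hq))
        obtain ⟨h1, h2, h3⟩ := hQ q.2
        rw [Prod.dist_eq, max_lt_iff, Real.dist_eq, Real.dist_eq, sub_zero, abs_of_nonneg h2]
        exact ⟨by linarith, by linarith⟩
      · intro h
        obtain ⟨A', hA', hq⟩ := hf q (hsub (hQ q.2))
        by_cases h' : ∀ q, A' q = A q
        · rw [hq, h']
        · exact absurd hq (h A' ⟨hA', h'⟩)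
    rw [this, isOpen_compl_iff]
    exact (hT.subset sdiff_subset).isClosed_biUnion fun A' _ => hcl A'
  have := isPreconnected_iff_preconnectedSpace.1 hQc
  have huniv := hclopen.eq_univ ⟨⟨_, hQ₀⟩, hAf⟩
  have hfA : ∀ q ∈ Q, f q = A q := fun q hq => by
    have : (⟨q, hq⟩ : Q) ∈ {q : Q | f q = A q} := huniv ▸ mem_univ _
    exact this
  have hfA' : ∀ q ∈ halfDisc s₀ δ, f q = A q := by
    rintro ⟨s, t⟩ ⟨h1, h2, h3⟩
    simp only at h1 h2 h3
    have h1' := abs_lt.1 h1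
    rcases h2.eq_or_lt with rfl | h2
    · -- on the diameter the value is a limit of values in the interior
      have hlim : Tendsto (fun t : ℝ => (s, t)) (𝓝[>] 0) (𝓝 (s, 0)) :=
        ((Continuous.prodMk_right s).tendsto 0).mono_left nhdsWithin_le_nhds
      have hmem : ∀ᶠ t in 𝓝[>] (0 : ℝ), (s, t) ∈ Q := by
        filter_upwards [Ioo_mem_nhdsGT hδ] with t ht
        exact ⟨⟨by simp; linarith, by simp; linarith⟩, ht⟩
      refine tendsto_nhds_unique (f := fun t : ℝ => f (s, t)) (l := 𝓝[>] 0) ?_ ?_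
      · refine (hc (s, 0) (hsub ⟨h1, le_rfl, h3⟩)).tendsto.comp ?_
        exact tendsto_nhdsWithin_iff.2 ⟨hlim, hmem.mono fun t ht => hsub (hQ ht)⟩
      · refine (((hcontA A).tendsto _).comp hlim).congr' ?_
        filter_upwards [hmem] with t ht using (hfA _ ht).symm
    · exact hfA _ ⟨⟨by simp; linarith, by simp; linarith⟩, h2, h3⟩
  obtain ⟨c, u, w, hcuw⟩ := affine_eq_combination A
  refine ⟨c, u, w, ?_⟩
  filter_upwards [Ioo_mem_nhdsGT hδ] with δ' hδ' q hq
  rw [← hcuw]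
  exact hfA' q ⟨hq.1.trans hδ'.2, hq.2.1, hq.2.2.trans hδ'.2⟩

end HalfDisc

/-- Parametrization of the three pages of the book. -/
def page (i : Fin 3) : ℝ × ℝ →ₗ[ℝ] V3 :=
  LinearMap.pi ![LinearMap.fst ℝ ℝ ℝ, (![1, -1, 0] : Fin 3 → ℝ) i • LinearMap.snd ℝ ℝ ℝ,
    (![0, 0, 1] : Fin 3 → ℝ) i • LinearMap.snd ℝ ℝ ℝ]

theorem page_zero (i : Fin 3) (q : ℝ × ℝ) : page i q 0 = q.1 := rfl

theorem page_one (i : Fin 3) (q : ℝ × ℝ) : page i q 1 = (![1, -1, 0] : Fin 3 → ℝ) i * q.2 := rfl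

theorem page_two (i : Fin 3) (q : ℝ × ℝ) : page i q 2 = (![0, 0, 1] : Fin 3 → ℝ) i * q.2 := rfl

theorem page_mem_bookModel (i : Fin 3) {q : ℝ × ℝ} (hq : 0 ≤ q.2) : page i q ∈ bookModel := by
  simp only [bookModel, mem_ofPred_eq, page_one, page_two]
  fin_cases i <;> simp [hq]

theorem page_zero_right (i : Fin 3) (s : ℝ) : page i (s, 0) = page 0 (s, 0) := by
  ext j
  fin_cases j <;> simp [page_zero, page_one, page_two]

/-- Distinct pages meet only along the axis. -/
theorem eq_of_page_eq {i j : Fin 3} (hij : i ≠ j) {q q' : ℝ × ℝ} (hq : 0 ≤ q.2) (hq' : 0 ≤ q'.2)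
    (h : page i q = page j q') : q.1 = q'.1 ∧ q.2 = 0 ∧ q'.2 = 0 := by
  have h0 := congrFun h 0
  have h1 := congrFun h 1
  have h2 := congrFun h 2
  rw [page_zero, page_zero] at h0
  rw [page_one, page_one] at h1
  rw [page_two, page_two] at h2
  refine ⟨h0, ?_⟩
  fin_cases i <;> fin_cases j <;> simp at h1 h2 hij ⊢ <;> constructor <;> linarith

/-- Two half-planes bounded by the same line in a plane overlap if they are on the same side of
the line. Here `u` spans the line, and the half-planes contain `w` and `w'`. -/
theorem exists_overlap {u w w' : ℝ × ℝ}
    (h : 0 ≤ (u.1 * w.2 - u.2 * w.1) * (u.1 * w'.2 - u.2 * w'.1)) :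
    ∃ α β γ : ℝ, 0 ≤ β ∧ 0 ≤ γ ∧ ¬ (α = 0 ∧ β = 0 ∧ γ = 0) ∧ α • u + β • w = γ • w' := by
  set d := u.1 * w.2 - u.2 * w.1 with hd
  set d' := u.1 * w'.2 - u.2 * w'.1 with hd'
  by_cases hdd : d = 0 ∧ d' = 0
  · by_cases hu : u = 0
    · exact ⟨1, 0, 0, le_rfl, le_rfl, by simp, by simp [hu]⟩
    · refine ⟨-(u.1 * w.1 + u.2 * w.2), u.1 ^ 2 + u.2 ^ 2, 0, by positivity, le_rfl, ?_, ?_⟩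
      · rintro ⟨-, h, -⟩
        apply hu
        have h1 : u.1 ^ 2 = 0 := by nlinarith [sq_nonneg u.1, sq_nonneg u.2]
        have h2 : u.2 ^ 2 = 0 := by nlinarith [sq_nonneg u.1, sq_nonneg u.2]
        exact Prod.ext (pow_eq_zero_iff two_ne_zero |>.1 h1)
          (pow_eq_zero_iff two_ne_zero |>.1 h2)
      · have := hdd.1
        ext
        · simp; linear_combination u.2 * hd - u.2 * this
        · simp; linear_combination (-u.1) * hd + u.1 * this
  · have key : ∀ σ : ℝ, (-σ * (w.1 * w'.2 - w.2 * w'.1)) • u + (σ * d') • w = (σ * d) • w' := by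
      intro σ
      ext
      · simp [hd, hd']; ring
      · simp [hd, hd']; ring
    have hne : ∀ σ : ℝ, σ ≠ 0 → ¬ (σ * d' = 0 ∧ σ * d = 0) := fun σ hσ h' =>
      hdd ⟨(mul_eq_zero.1 h'.2).resolve_left hσ, (mul_eq_zero.1 h'.1).resolve_left hσ⟩
    rcases mul_nonneg_iff.1 h with ⟨h1, h2⟩ | ⟨h1, h2⟩
    · exact ⟨_, 1 * d', 1 * d, by linarith, by linarith, fun h => hne 1 one_ne_zero h.2, key 1⟩
    · exact ⟨_, -1 * d', -1 * d, by linarith, by linarith,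
        fun h => hne (-1) (by norm_num) h.2, key (-1)⟩

/-- Among three real numbers, two do not have opposite signs. -/
theorem exists_ne_mul_nonneg (d : Fin 3 → ℝ) : ∃ i j, i ≠ j ∧ 0 ≤ d i * d j := by
  by_contra! h
  have h1 := h 0 1 (by decide)
  have h2 := h 0 2 (by decide)
  have h3 := h 1 2 (by decide)
  rcases le_total 0 (d 0) with h0 | h0 <;>
    nlinarith [mul_nonneg_of_nonpos_of_nonpos h1.le h2.le, sq_nonneg (d 0)]

/-- A neighbourhood of the origin in the book of three half-planes admits no injective PL map to
a plane. At a generic point of the axis such a map would be affine on each page, and two of the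
pages would be mapped to the same side of the image of the axis. -/
theorem no_injective_plOn_bookModel {S : Set V3} (hS : S ∈ 𝓝[bookModel] (0 : V3)) {h : V3 → V3}
    (hi : InjOn h S) (hpl : PLOn h S) (hm : MapsTo h S planeModel) : False := by
  have hS0 : (0 : V3) ∈ S := mem_of_mem_nhdsWithin (Or.inl rfl) hS
  obtain ⟨U, hU, hfU⟩ := hpl.2 0 hS0
  obtain ⟨ε, hε, hεS⟩ := Metric.mem_nhdsWithin_iff.1 hS
  obtain ⟨ε', hε', hεU⟩ := Metric.mem_nhdsWithin_iff.1 hU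
  set η := min ε ε' with hη_def
  have hη : 0 < η := lt_min hε hε'
  have hpage : ∀ i, ∀ q ∈ halfDisc 0 η, page i q ∈ S ∩ U := by
    rintro i q ⟨h1, h2, h3⟩
    have hball : page i q ∈ Metric.ball (0 : V3) η := by
      rw [mem_ball_zero_iff, pi_norm_lt_iff hη]
      rw [sub_zero] at h1
      intro j
      rw [Real.norm_eq_abs]
      fin_cases j
      · exact h1
      · change |page i q 1| < η
        rw [page_one]
        fin_cases i <;> simp [abs_of_nonneg h2, h3, hη]
      · change |page i q 2| < η
        rw [page_two]
        fin_cases i <;> simp [abs_of_nonneg h2, h3, hη]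
    have hqS : page i q ∈ S :=
      hεS ⟨Metric.ball_subset_ball (min_le_left _ _) hball, page_mem_bookModel i h2⟩
    exact ⟨hqS, hεU ⟨Metric.ball_subset_ball (min_le_right _ _) hball, hqS⟩⟩
  have hpc : ∀ i, Continuous (page i) := fun i => (page i).continuous_of_finiteDimensional
  have hex : ∀ i, ∃ Z : Set ℝ, Z.Finite ∧ ∀ s₀, |s₀| < η → s₀ ∉ Z →
      ∃ c u w : V3, ∀ᶠ δ in 𝓝[>] (0 : ℝ), ∀ q ∈ halfDisc s₀ δ,
        h (page i q) = c + q.1 • u + q.2 • w := fun i => by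
    refine exists_affine_near_boundary (f := h ∘ page i)
      (hpl.1.comp (hpc i).continuousOn fun q hq => (hpage i q hq).1) ?_
    exact (hfU.comp (FinitelyAffineOn.linear (page i) univ)).mono fun q hq =>
      ⟨mem_univ _, (hpage i q hq).2⟩
  choose Z hZ hZaff using hex
  obtain ⟨s₀, hs₀, hs₀Z⟩ : ∃ s ∈ Ioo (-η) η, s ∉ ⋃ i, Z i :=
    (Ioo_infinite (by linarith)).exists_notMem_finite (finite_iUnion hZ)
  rw [mem_iUnion, not_exists] at hs₀Z
  choose c u w hcuw using fun i => hZaff i s₀ (abs_lt.2 hs₀) (hs₀Z i)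
  have hall := eventually_all.2 hcuw
  obtain ⟨δ, hall, hδ, hδη⟩ := (hall.and (Ioo_mem_nhdsGT (sub_pos.2 (abs_lt.2 hs₀)))).exists
  have hδpage : ∀ i, ∀ q ∈ halfDisc s₀ δ, page i q ∈ S := fun i q hq => by
    refine (hpage i q ⟨?_, hq.2.1, ?_⟩).1
    · have := abs_sub_abs_le_abs_sub q.1 s₀
      have := hq.1
      rw [sub_zero]
      linarith
    · have := hq.2.2
      have := abs_nonneg s₀
      linarith
  -- the three affine maps agree on the axis
  have haxis : ∀ i s, |s - s₀| < δ → c i + s • u i = c 0 + s • u 0 := fun i s hs => by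
    have h1 := hall i (s, 0) ⟨hs, le_rfl, hδ⟩
    have h2 := hall 0 (s, 0) ⟨hs, le_rfl, hδ⟩
    rw [page_zero_right] at h1
    simpa using h1.symm.trans h2
  have hu : ∀ i, u i = u 0 := fun i => by
    have h1 := haxis i s₀ (by simpa using hδ)
    have h2 := haxis i (s₀ + δ / 2) (by rw [add_sub_cancel_left, abs_of_pos] <;> linarith)
    rw [add_smul, add_smul, ← add_assoc, ← add_assoc, h1, add_right_inj] at h2
    exact smul_right_injective V3 (by positivity : δ / 2 ≠ 0) h2
  have hc : ∀ i, c i = c 0 := fun i => by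
    have h1 := haxis i s₀ (by simpa using hδ)
    rwa [hu i, add_left_inj] at h1
  have hval : ∀ i, ∀ q ∈ halfDisc s₀ δ, h (page i q) = c 0 + q.1 • u 0 + q.2 • w i :=
    fun i q hq => by rw [hall i q hq, hu, hc]
  -- everything happens in the plane
  have hz : ∀ i, ∀ q ∈ halfDisc s₀ δ, c 0 2 + q.1 * u 0 2 + q.2 * w i 2 = 0 := fun i q hq => by
    have h1 : h (page i q) 2 = 0 := hm (hδpage i q hq)
    rw [hval i q hq] at h1
    exact h1
  have hu2 : u 0 2 = 0 := by
    have h1 := hz 0 (s₀, 0) ⟨by simpa using hδ, le_rfl, hδ⟩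
    have h2 := hz 0 (s₀ + δ / 2, 0)
      ⟨by simp only [add_sub_cancel_left]; rw [abs_of_pos] <;> linarith, le_rfl, hδ⟩
    simp only [zero_mul, add_zero] at h1 h2
    have : δ / 2 * u 0 2 = 0 := by linarith
    exact (mul_eq_zero.1 this).resolve_left (by positivity)
  have hw2 : ∀ i, w i 2 = 0 := fun i => by
    have h1 := hz i (s₀, 0) ⟨by simpa using hδ, le_rfl, hδ⟩
    have h2 := hz i (s₀, δ / 2) ⟨by simpa using hδ, by simp; linarith, by simp; linarith⟩
    simp only [zero_mul, add_zero] at h1 h2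
    have : δ / 2 * w i 2 = 0 := by linarith
    exact (mul_eq_zero.1 this).resolve_left (by positivity)
  obtain ⟨i, j, hij, hd⟩ := exists_ne_mul_nonneg fun i => u 0 0 * w i 1 - u 0 1 * w i 0
  obtain ⟨α, β, γ, hβ, hγ, hne, heq⟩ :=
    exists_overlap (u := (u 0 0, u 0 1)) (w := (w i 0, w i 1)) (w' := (w j 0, w j 1)) hd
  have heq' : α • u 0 + β • w i = γ • w j := by
    ext k
    fin_cases k
    · exact congrArg Prod.fst heq
    · exact congrArg Prod.snd heq
    · simp [hu2, hw2]
  obtain ⟨r, hr, hrα, hrβ, hrγ⟩ : ∃ r > 0, r * |α| < δ ∧ r * β < δ ∧ r * γ < δ := by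
    have hN : 0 < |α| + β + γ + 1 := by positivity
    have hα := abs_nonneg α
    have hr : 0 < δ / (|α| + β + γ + 1) := div_pos hδ hN
    have hrN : δ / (|α| + β + γ + 1) * (|α| + β + γ + 1) = δ := div_mul_cancel₀ _ hN.ne'
    refine ⟨_, hr, ?_, ?_, ?_⟩ <;>
      nlinarith [mul_nonneg hr.le hα, mul_nonneg hr.le hβ, mul_nonneg hr.le hγ]
  have hq : (s₀ + r * α, r * β) ∈ halfDisc s₀ δ := by
    refine ⟨?_, by positivity, hrβ⟩
    simp only [add_sub_cancel_left]
    rwa [abs_mul, abs_of_pos hr]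
  have hq' : (s₀, r * γ) ∈ halfDisc s₀ δ := ⟨by simpa using hδ, by positivity, hrγ⟩
  have hpp : page i (s₀ + r * α, r * β) = page j (s₀, r * γ) := by
    apply hi (hδpage i _ hq) (hδpage j _ hq')
    rw [hval i _ hq, hval j _ hq', add_smul, mul_smul, mul_smul, mul_smul, ← heq', smul_add]
    abel
  obtain ⟨h1, h2, h3⟩ := eq_of_page_eq hij (by positivity) (by positivity) hpp
  refine hne ⟨?_, (mul_eq_zero.1 h2).resolve_left hr.ne', (mul_eq_zero.1 h3).resolve_left hr.ne'⟩
  exact (mul_eq_zero.1 (by simpa using h1 : r * α = 0)).resolve_left hr.ne'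

theorem not_germ_bookModel {A : Set V3} (hA : A ⊆ planeModel) (a : V3) :
    ¬ PLGermEquiv bookModel 0 A a := by
  rintro ⟨h, -, h2, h3, -, -, h6, -⟩
  exact no_injective_plOn_bookModel h2 h.injOn h6 fun x hx => hA (h3 (h.map_source hx))

/-! ### The local models are pairwise inequivalent -/

theorem zero_mem_bookModel : (0 : V3) ∈ bookModel := Or.inl rfl

/-- A germ equivalence of sets induces germ equivalences at the nearby points. -/
theorem PLGermEquiv.eventually {A B : Set V3} {a b : V3} (h : PLGermEquiv A a B b) (ha : a ∈ A) :
    ∃ h : PartialEquiv V3 V3, h.source ⊆ A ∧ h.source ∈ 𝓝[A] a ∧ h.target ⊆ B ∧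
      h.target ∈ 𝓝[B] b ∧ h a = b ∧ ContinuousOn h h.source ∧ ContinuousOn h.symm h.target ∧
      ∀ᶠ y in 𝓝[A] a, y ∈ h.source ∧ PLGermEquiv A y B (h y) := by
  obtain ⟨h, h1, h2, h3, h4, h5, h6, h7⟩ := h
  refine ⟨h, h1, h2, h3, h4, h5, h6.1, h7.1, ?_⟩
  have has : a ∈ h.source := mem_of_mem_nhdsWithin ha h2
  have hc : Tendsto h (𝓝[A] a) (𝓝[B] b) := by
    rw [← h5]
    refine Tendsto.mono_left ((h6.1 a has).tendsto_nhdsWithin fun x hx => h3 (h.map_source hx)) ?_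
    rw [nhdsWithin_le_iff]
    exact h2
  have h4' : ∀ᶠ z in 𝓝[B] b, h.target ∈ 𝓝[B] z := eventually_eventually_nhdsWithin.2 h4
  filter_upwards [h2, eventually_eventually_nhdsWithin.2 h2, hc.eventually h4'] with y hy hy' hy''
  exact ⟨hy, h, h1, hy', h3, hy'', rfl, h6, h7⟩

theorem germ_bookModel_of_mem_axis {b : V3} (h1 : b 1 = 0) (h2 : b 2 = 0) :
    PLGermEquiv bookModel b bookModel 0 := by
  refine PLGermEquiv.of_plAut' (PLAut.translate b) (Eventually.of_forall fun v => ?_)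
    (by rw [PLAut.translate_apply, sub_self])
  simp [bookModel, PLAut.translate_apply, h1, h2]

theorem germ_planeModel {b : V3} (h2 : b 2 = 0) : PLGermEquiv planeModel b planeModel 0 := by
  refine PLGermEquiv.of_plAut' (PLAut.translate b) (Eventually.of_forall fun v => ?_)
    (by rw [PLAut.translate_apply, sub_self])
  simp [planeModel, PLAut.translate_apply, h2]

theorem eventually_coord_ne {v : V3} {i : Fin 3} {c : ℝ} (h : v i ≠ c) :
    ∀ᶠ w in 𝓝 v, w i ≠ c := (continuous_apply i).continuousAt.eventually_ne h

theorem eventually_coord_pos {v : V3} {i : Fin 3} (h : 0 < v i) :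
    ∀ᶠ w in 𝓝 v, 0 < w i := (continuous_apply i).continuousAt.eventually (lt_mem_nhds h)

theorem germ_planeModel_of_not_mem_axis {b : V3} (hb : b ∈ bookModel) (h : ¬ (b 1 = 0 ∧ b 2 = 0)) :
    PLGermEquiv bookModel b planeModel 0 := by
  by_cases h2 : b 2 = 0
  · refine (PLGermEquiv.of_eventually ?_).trans (germ_planeModel h2) hb
    filter_upwards [eventually_coord_ne (fun h1 => h ⟨h1, h2⟩ : b 1 ≠ 0)] with v hv
    simp [bookModel, planeModel, hv]
  · obtain ⟨h1, h2'⟩ := hb.resolve_left h2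
    have hpos : 0 < b 2 := lt_of_le_of_ne h2' (Ne.symm h2)
    refine (PLGermEquiv.of_plAut' (PLAut.perm (Equiv.swap 1 2)) ?_ rfl).trans
      (germ_planeModel (b := PLAut.perm (Equiv.swap 1 2) b) (by simpa [PLAut.perm_apply] using h1))
      hb
    filter_upwards [eventually_coord_pos hpos] with v hv
    simp [bookModel, planeModel, PLAut.perm_apply, hv.ne', hv.le]

/-- The germ of the book is that of the book at the origin only at the points of the axis. -/
theorem mem_axis_of_germ {b : V3} (h : PLGermEquiv bookModel 0 bookModel b) :
    b 1 = 0 ∧ b 2 = 0 := by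
  by_contra hb
  exact not_germ_bookModel subset_rfl 0
    (h.trans (germ_planeModel_of_not_mem_axis (h.mem zero_mem_bookModel) hb) zero_mem_bookModel)

theorem germ_vertexModel_axis₀ {t : ℝ} (ht : t ≠ 0) :
    PLGermEquiv bookModel 0 vertexModel ![t, 0, 0] := by
  refine PLGermEquiv.symm (PLGermEquiv.trans (B := bookModel) (b := ![t, 0, 0])
    (PLGermEquiv.of_eventually ?_) (germ_bookModel_of_mem_axis rfl rfl) (Or.inl rfl)) (Or.inl rfl)
  filter_upwards [eventually_coord_ne (v := ![t, 0, 0]) (i := 0) (c := 0) ht] with v hv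
  simp [bookModel, vertexModel, hv]

theorem germ_vertexModel_axis₁ {t : ℝ} (ht : 0 < t) :
    PLGermEquiv bookModel 0 vertexModel ![0, t, 0] := by
  refine PLGermEquiv.symm (PLGermEquiv.trans (B := bookModel)
    (b := PLAut.perm (Equiv.swap 0 1) ![0, t, 0])
    (PLGermEquiv.of_plAut' (PLAut.perm (Equiv.swap 0 1)) ?_ rfl)
    (germ_bookModel_of_mem_axis rfl rfl) (Or.inl rfl)) (Or.inl rfl)
  filter_upwards [eventually_coord_pos (v := ![0, t, 0]) (i := 1) ht] with v hv
  have : Equiv.swap (0 : Fin 3) 1 2 = 2 := by decide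
  simp [bookModel, vertexModel, PLAut.perm_apply, hv.ne', hv.le, this]

/-- The point at parameter `t` on the `i`-th of three rays in the singular set of the model of a
vertex. -/
def ray (i : Fin 3) (t : ℝ) : V3 :=
  ![(![1, -1, 0] : Fin 3 → ℝ) i * t, (![0, 0, 1] : Fin 3 → ℝ) i * t, 0]

theorem continuous_ray (i : Fin 3) : Continuous (ray i) := by
  unfold ray
  fun_prop

theorem ray_map_zero (i : Fin 3) : ray i 0 = 0 := by
  ext j
  fin_cases j <;> simp [ray]

theorem ray_mem (i : Fin 3) (t : ℝ) : ray i t ∈ vertexModel := Or.inl rfl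

theorem germ_ray (i : Fin 3) {t : ℝ} (ht : 0 < t) :
    PLGermEquiv bookModel 0 vertexModel (ray i t) := by
  fin_cases i
  · convert germ_vertexModel_axis₀ ht.ne' using 2
    simp [ray]
  · convert germ_vertexModel_axis₀ (neg_ne_zero.2 ht.ne') using 2
    simp [ray]
  · convert germ_vertexModel_axis₁ ht using 2
    simp [ray]

theorem ray_injective {i j : Fin 3} {s t : ℝ} (hs : 0 ≤ s) (ht : 0 < t)
    (h : ray i s = ray j t) : i = j ∧ s = t := by
  have h0 := congrFun h 0
  have h1 := congrFun h 1
  fin_cases i <;> fin_cases j <;> simp [ray] at h0 h1 ⊢ <;> linarith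

theorem not_germ_vertexModel_of_subset {A : Set V3} (hA : A ⊆ planeModel) (a : V3) :
    ¬ PLGermEquiv vertexModel 0 A a := by
  intro h
  obtain ⟨h, -, -, -, -, -, -, -, hev⟩ := h.eventually (Or.inl rfl)
  have hlim : Tendsto (ray 0) (𝓝[>] 0) (𝓝[vertexModel] 0) := by
    refine tendsto_nhdsWithin_iff.2 ⟨?_, Eventually.of_forall (ray_mem 0)⟩
    rw [← ray_map_zero 0]
    exact ((continuous_ray 0).tendsto 0).mono_left nhdsWithin_le_nhds
  obtain ⟨t, ⟨-, ht⟩, ht0⟩ := ((hlim.eventually hev).and self_mem_nhdsWithin).exists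
  exact not_germ_bookModel hA _ ((germ_ray 0 ht0).trans ht zero_mem_bookModel)

/-- Near a vertex there are three rays of points at which the polyhedron is modelled on the book.
They cannot be mapped injectively to the axis of the book. -/
theorem not_germ_vertexModel_bookModel : ¬ PLGermEquiv vertexModel 0 bookModel 0 := by
  intro h
  obtain ⟨h, -, h2, -, -, h5, h6, -, hev⟩ := h.eventually (Or.inl rfl)
  have hlim : ∀ i, Tendsto (ray i) (𝓝[≥] 0) (𝓝[vertexModel] 0) := fun i => by
    refine tendsto_nhdsWithin_iff.2 ⟨?_, Eventually.of_forall (ray_mem i)⟩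
    rw [← ray_map_zero i]
    exact ((continuous_ray i).tendsto 0).mono_left nhdsWithin_le_nhds
  have hall := eventually_all.2 fun i => (hlim i).eventually hev
  obtain ⟨ε, hε, hall⟩ := mem_nhdsGE_iff_exists_Ico_subset.1 hall
  obtain ⟨η, hη, hηε⟩ := exists_between (show (0 : ℝ) < ε from hε)
  have hall : ∀ i, ∀ t ∈ Icc 0 η, ray i t ∈ h.source ∧
      PLGermEquiv vertexModel (ray i t) bookModel (h (ray i t)) := fun i t ht =>
    hall ⟨ht.1, ht.2.trans_lt hηε⟩ i
  have haxis : ∀ i, ∀ t ∈ Icc 0 η, h (ray i t) 1 = 0 ∧ h (ray i t) 2 = 0 := by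
    intro i t ht
    rcases ht.1.eq_or_lt with rfl | ht0
    · rw [ray_map_zero, h5]
      exact ⟨rfl, rfl⟩
    · exact mem_axis_of_germ ((germ_ray i ht0).trans (hall i t ht).2 zero_mem_bookModel)
  let f : Fin 3 → ℝ → ℝ := fun i t => h (ray i t) 0
  have hf0 : ∀ i, f i 0 = 0 := fun i => by simp only [f, ray_map_zero, h5, Pi.zero_apply]
  have hfc : ∀ i, ContinuousOn (f i) (Icc 0 η) := fun i =>
    (continuous_apply 0).comp_continuousOn
      (h6.comp (continuous_ray i).continuousOn fun t ht => (hall i t ht).1)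
  have hinj : ∀ i j, ∀ s ∈ Icc 0 η, ∀ t ∈ Icc 0 η, 0 < t → f i s = f j t → i = j ∧ s = t := by
    intro i j s hs t ht ht0 hst
    refine ray_injective hs.1 ht0 (h.injOn (hall i s hs).1 (hall j t ht).1 ?_)
    ext k
    fin_cases k
    · exact hst
    · exact (haxis i s hs).1.trans (haxis j t ht).1.symm
    · exact (haxis i s hs).2.trans (haxis j t ht).2.symm
  have hηm : η ∈ Icc 0 η := ⟨hη.le, le_rfl⟩
  have h0m : (0 : ℝ) ∈ Icc 0 η := ⟨le_rfl, hη.le⟩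
  have hne : ∀ i, f i η ≠ 0 := fun i hi =>
    hη.ne (hinj i i 0 h0m η hηm hη (by rw [hf0, hi])).2
  obtain ⟨i, j, hij, hd⟩ := exists_ne_mul_nonneg fun i => f i η
  -- by the intermediate value theorem, one of the two values is attained on both rays
  have key : ∀ i j, i ≠ j → f i η ∈ uIcc 0 (f j η) → False := fun i j hij hm => by
    obtain ⟨t, ht, hft⟩ := intermediate_value_uIcc (a := 0) (b := η)
      (by rw [uIcc_of_le hη.le]; exact hfc j) (by rw [hf0]; exact hm)
    rw [uIcc_of_le hη.le] at ht
    exact hij (hinj j i t ht η hηm hη hft).1.symm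
  rcases mul_nonneg_iff.1 hd with ⟨h1, h2⟩ | ⟨h1, h2⟩
  · rcases le_total (f i η) (f j η) with h | h
    · exact key i j hij (by rw [uIcc_of_le h2]; exact ⟨h1, h⟩)
    · exact key j i hij.symm (by rw [uIcc_of_le h1]; exact ⟨h2, h⟩)
  · rcases le_total (f i η) (f j η) with h | h
    · exact key j i hij.symm (by rw [uIcc_of_ge h1]; exact ⟨h, h2⟩)
    · exact key i j hij (by rw [uIcc_of_ge h2]; exact ⟨h, h1⟩)

namespace ClosedOrbifold

variable {X : ClosedOrbifold} {P : Set X.carrier} {x : X.carrier}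

theorem vertices_eq_empty_of_modeledAt
    (h : ∀ x ∈ P, X.ModeledAt P x planeModel ∨ X.ModeledAt P x halfModel ∨
      X.ModeledAt P x bookModel) : X.vertices P = ∅ := by
  refine eq_empty_of_forall_notMem ?_
  rintro x ⟨hx, hl⟩
  have key : ∀ {M}, (0 : V3) ∈ M → X.ModeledAt P x M → PLGermEquiv vertexModel 0 M 0 :=
    fun h0 hM => ((hM.germ hx hl).trans (germ_of_flatten' fun _ => mem_cone_vertexLink) h0).symm h0
  rcases h x hx with h | h | h
  · exact not_germ_vertexModel_of_subset subset_rfl 0 (key rfl h)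
  · exact not_germ_vertexModel_of_subset (fun v (hv : v ∈ halfModel) => hv.1) 0
      (key (M := halfModel) ⟨rfl, le_rfl⟩ h)
  · exact not_germ_vertexModel_bookModel (key zero_mem_bookModel h)

end ClosedOrbifold

/-! ### Compact connected one-dimensional manifolds are circles -/

section OneManifold

variable {M : Type*} [TopologicalSpace M]

/-- A continuous path which is injective near `s` is open at `s`, if `M` is a line near the image
of `s`. -/
theorem image_mem_nhds_of_injOn {g : ℝ → M} (hg : IsOpenEmbedding g) {k : ℝ → M}
    (hk : Continuous k) {s : ℝ} (hs : k s ∈ range g) {N : Set ℝ} (hN : N ∈ 𝓝 s)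
    (hi : InjOn k N) : k '' N ∈ 𝓝 (k s) := by
  have hV : k ⁻¹' range g ∈ 𝓝 s := hk.continuousAt (hg.isOpen_range.mem_nhds hs)
  obtain ⟨δ, hδ, hδN⟩ := (Metric.nhds_basis_closedBall.mem_iff).1 (inter_mem hN hV)
  rw [Real.closedBall_eq_Icc] at hδN
  let ψ : ℝ → ℝ := fun t => Function.invFun g (k t)
  have hgψ : ∀ t ∈ Icc (s - δ) (s + δ), g (ψ t) = k t := fun t ht =>
    Function.invFun_eq (hδN ht).2
  have hψc : ContinuousOn ψ (Icc (s - δ) (s + δ)) := by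
    rw [hg.isInducing.continuousOn_iff]
    exact hk.continuousOn.congr hgψ
  have hψi : InjOn ψ (Icc (s - δ) (s + δ)) := fun t ht t' ht' h =>
    hi (hδN ht).1 (hδN ht').1 (by rw [← hgψ t ht, ← hgψ t' ht', h])
  have hle : s - δ ≤ s + δ := by linarith
  have hsm : s ∈ Icc (s - δ) (s + δ) := ⟨by linarith, by linarith⟩
  have hnhds : ψ '' Icc (s - δ) (s + δ) ∈ 𝓝 (ψ s) := by
    have hiv := intermediate_value_uIcc (a := s - δ) (b := s + δ) (by rwa [uIcc_of_le hle])
    rw [uIcc_of_le hle] at hiv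
    refine mem_of_superset ?_ hiv
    rcases hψc.strictMonoOn_of_injOn_Icc' hle hψi with h | h
    · have h1 := h (left_mem_Icc.2 hle) hsm (by linarith)
      have h2 := h hsm (right_mem_Icc.2 hle) (by linarith)
      rw [uIcc_of_le (h1.trans h2).le]
      exact Icc_mem_nhds h1 h2
    · have h1 := h (left_mem_Icc.2 hle) hsm (by linarith)
      have h2 := h hsm (right_mem_Icc.2 hle) (by linarith)
      rw [uIcc_of_ge (h2.trans h1).le]
      exact Icc_mem_nhds h2 h1
  have := hg.isOpenMap.image_mem_nhds hnhds
  rw [hgψ s hsm] at this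
  refine mem_of_superset this ?_
  rintro _ ⟨_, ⟨t, ht, rfl⟩, rfl⟩
  exact ⟨t, (hδN ht).1, (hgψ t ht).symm⟩

theorem isOpenEmbedding_of_injective (hM : ∀ m : M, ∃ g : ℝ → M, IsOpenEmbedding g ∧ m ∈ range g)
    {k : ℝ → M} (hk : Continuous k) (hi : Function.Injective k) : IsOpenEmbedding k := by
  refine .of_continuous_injective_isOpenMap hk hi (IsOpenMap.of_nhds_le fun s => ?_)
  intro N hN
  obtain ⟨g, hg, hs⟩ := hM (k s)
  exact mem_of_superset (image_mem_nhds_of_injOn hg hk hs (mem_map.1 hN) hi.injOn)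
    (image_preimage_subset _ _)

/-- There is an embedded circle in `M`. -/
def HasSimpleLoop (M : Type*) [TopologicalSpace M] : Prop :=
  ∃ T > 0, ∃ k : ℝ → M, ContinuousOn k (Icc 0 T) ∧ k 0 = k T ∧ InjOn k (Ico 0 T)

/-- An embedded circle in a connected one-dimensional manifold is the whole manifold. -/
theorem HasSimpleLoop.nonempty_homeomorph [T2Space M] [PreconnectedSpace M]
    (hM : ∀ m : M, ∃ g : ℝ → M, IsOpenEmbedding g ∧ m ∈ range g) (h : HasSimpleLoop M) :
    Nonempty (M ≃ₜ Circle) := by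
  obtain ⟨T, hT, k, hk, hkT, hi⟩ := h
  have : Fact (0 < T) := ⟨hT⟩
  let L : AddCircle T → M := AddCircle.liftIco T 0 k
  have hLc : Continuous L := AddCircle.liftIco_zero_continuous hkT hk
  have hrep : ∀ x : AddCircle T, ∃ t ∈ Ico 0 T, (t : AddCircle T) = x := fun x => by
    obtain ⟨t, ht, rfl⟩ := AddCircle.coe_image_Ico_eq T 0 ▸ mem_univ x
    exact ⟨t, by simpa using ht, rfl⟩
  have hLk : ∀ t ∈ Ico 0 T, L (t : AddCircle T) = k t := fun t ht =>
    AddCircle.liftIco_zero_coe_apply ht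
  have hLi : Function.Injective L := by
    intro x y hxy
    obtain ⟨s, hs, rfl⟩ := hrep x
    obtain ⟨t, ht, rfl⟩ := hrep y
    rw [hLk s hs, hLk t ht] at hxy
    rw [hi hs ht hxy]
  have hopen : IsOpen (range L) := by
    rw [isOpen_iff_mem_nhds]
    rintro _ ⟨x, rfl⟩
    obtain ⟨s, -, rfl⟩ := hrep x
    obtain ⟨g, hg, hs⟩ := hM (L s)
    have hcont : Continuous fun t : ℝ => L t := hLc.comp (AddCircle.continuous_mk' T)
    refine mem_of_superset (image_mem_nhds_of_injOn hg hcont hs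
      (Ioo_mem_nhds (show s - T / 2 < s by linarith) (show s < s + T / 2 by linarith)) ?_) ?_
    · intro t ht t' ht' h
      have h := hLi h
      have hsub : Ioo (s - T / 2) (s + T / 2) ⊆ Ico (s - T / 2) (s - T / 2 + T) := fun x hx =>
        ⟨hx.1.le, by linarith [hx.2]⟩
      exact (AddCircle.coe_eq_coe_iff_of_mem_Ico (hsub ht) (hsub ht')).1 h
    · rintro _ ⟨t, -, rfl⟩
      exact mem_range_self _
  have huniv : range L = univ :=
    IsClopen.eq_univ ⟨(isCompact_range hLc).isClosed, hopen⟩ (range_nonempty L)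
  have hhom : IsHomeomorph L :=
    isHomeomorph_iff_continuous_bijective.2 ⟨hLc, hLi, range_eq_univ.1 huniv⟩
  exact ⟨(hhom.homeomorph L).symm.trans (AddCircle.homeomorphCircle hT.ne')⟩

theorem exists_exit {f : ℝ → M} (hf : Continuous f) {V : Set M} (hV : IsOpen V) (h0 : f 0 ∈ V)
    {s : ℝ} (hs : s < 0) (hsV : f s ∉ V) : ∃ a < 0, f a ∉ V ∧ ∀ t ∈ Ioc a 0, f t ∈ V := by
  let S : Set ℝ := Iic 0 ∩ f ⁻¹' Vᶜ
  have hS : IsClosed S := isClosed_Iic.inter (hV.isClosed_compl.preimage hf)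
  have hbdd : BddAbove S := ⟨0, fun x hx => hx.1⟩
  have hmem : sSup S ∈ S := hS.csSup_mem ⟨s, hs.le, hsV⟩ hbdd
  refine ⟨sSup S, lt_of_le_of_ne hmem.1 fun h => hmem.2 (by rwa [h]), hmem.2, fun t ht => ?_⟩
  by_contra htV
  exact absurd (le_csSup hbdd ⟨ht.2, htV⟩) (not_le.2 ht.1)

/-- If the line `f` leaves the line `g` at the parameter `a`, then before that it runs through a
whole end of `g`. -/
theorem exists_end [T2Space M] {f g : ℝ → M} (hf : Continuous f) (hg : IsOpenEmbedding g)
    (h0 : f 0 = g 0) {a : ℝ} (ha : a < 0) (haV : f a ∉ range g)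
    (hV : ∀ t ∈ Ioc a 0, f t ∈ range g) :
    (∀ u, 0 ≤ u → ∃ t ∈ Ioc a 0, f t = g u) ∨ ∀ u ≤ 0, ∃ t ∈ Ioc a 0, f t = g u := by
  let φ : ℝ → ℝ := fun t => Function.invFun g (f t)
  have hgφ : ∀ t ∈ Ioc a 0, g (φ t) = f t := fun t ht => Function.invFun_eq (hV t ht)
  have hφc : ContinuousOn φ (Ioc a 0) := by
    rw [hg.isInducing.continuousOn_iff]
    exact hf.continuousOn.congr hgφ
  have hφ0 : φ 0 = 0 := hg.injective (by rw [hgφ 0 ⟨ha, le_rfl⟩, h0])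
  have hconn : OrdConnected (φ '' Ioc a 0) := (isPreconnected_Ioc.image φ hφc).ordConnected
  have h0m : 0 ∈ φ '' Ioc a 0 := ⟨0, ⟨ha, le_rfl⟩, hφ0⟩
  have hunb : ∀ R, ∃ t ∈ Ioc a 0, R < |φ t| := by
    by_contra! h
    obtain ⟨R, hR⟩ := h
    -- otherwise `f a` lies in the compact set `g '' [-R, R]`
    have hcl : IsClosed (g '' Icc (-R) R) := (isCompact_Icc.image hg.continuous).isClosed
    have hmem : f a ∈ g '' Icc (-R) R := by
      refine hcl.mem_of_tendsto (b := 𝓝[>] a)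
        ((hf.tendsto a).mono_left nhdsWithin_le_nhds) ?_
      filter_upwards [Ioc_mem_nhdsGT ha] with t ht
      exact ⟨φ t, abs_le.1 (hR t ht), hgφ t ht⟩
    obtain ⟨u, -, hu⟩ := hmem
    exact haV ⟨u, hu⟩
  have hmem : ∀ u ∈ φ '' Ioc a 0, ∃ t ∈ Ioc a 0, f t = g u := by
    rintro _ ⟨t, ht, rfl⟩
    exact ⟨t, ht, (hgφ t ht).symm⟩
  by_contra! h
  obtain ⟨⟨u, hu, hu'⟩, v, hv, hv'⟩ := h
  obtain ⟨t, ht, htR⟩ := hunb (max u (-v))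
  have htm : φ t ∈ φ '' Ioc a 0 := ⟨t, ht, rfl⟩
  rcases lt_abs.1 htR with h | h
  · obtain ⟨t', ht', h'⟩ := hmem u (hconn.out h0m htm ⟨hu, ((le_max_left _ _).trans_lt h).le⟩)
    exact hu' t' ht' h'
  · obtain ⟨t', ht', h'⟩ := hmem v (hconn.out htm h0m
      ⟨by linarith [(le_max_right u (-v)).trans_lt h], hv⟩)
    exact hv' t' ht' h'

/-- Two lines in a one-dimensional manifold which overlap along an end of each are part of a single
line, unless they form a circle. -/
theorem glue_of_end (hM : ∀ m : M, ∃ g : ℝ → M, IsOpenEmbedding g ∧ m ∈ range g) [T2Space M]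
    {f g : ℝ → M} (hf : IsOpenEmbedding f) (hg : IsOpenEmbedding g) (h0 : f 0 = g 0) {a : ℝ}
    (ha : a < 0) (hV : ∀ t ∈ Ioc a 0, f t ∈ range g)
    (hend : ∀ u ≤ 0, ∃ t ∈ Ioc a 0, f t = g u) (hpos : ∀ t, 0 < t → f t ∈ range g) :
    (∃ k : ℝ → M, IsOpenEmbedding k ∧ range f ∪ range g ⊆ range k) ∨ HasSimpleLoop M := by
  have hsign : ∀ t ∈ Ioc a 0, ∀ u, f t = g u → u ≤ 0 := by
    intro t ht u hu
    by_contra! hu0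
    let φ : ℝ → ℝ := fun t => Function.invFun g (f t)
    have hgφ : ∀ t ∈ Ioc a 0, g (φ t) = f t := fun t ht => Function.invFun_eq (hV t ht)
    have hφc : ContinuousOn φ (Ioc a 0) := by
      rw [hg.isInducing.continuousOn_iff]
      exact hf.continuous.continuousOn.congr hgφ
    obtain ⟨t', ht', htg⟩ := hend (-1) (by norm_num)
    have h1 : φ t = u := hg.injective (by rw [hgφ t ht, hu])
    have h2 : φ t' = -1 := hg.injective (by rw [hgφ t' ht', htg])
    have htt : ∀ t ∈ Ioc a 0, φ t ≠ 0 → t < 0 := fun t ht h =>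
      lt_of_le_of_ne ht.2 fun h' => h (hg.injective (by rw [hgφ t ht, h', h0]))
    have hlt := max_lt (htt t ht (by rw [h1]; exact hu0.ne'))
      (htt t' ht' (by rw [h2]; norm_num))
    have hsub : uIcc t t' ⊆ Ioc a 0 := fun x hx =>
      ⟨(lt_min ht.1 ht'.1).trans_le hx.1, hx.2.trans hlt.le⟩
    obtain ⟨x, hx, hx0⟩ := intermediate_value_uIcc (hφc.mono hsub)
      (show (0 : ℝ) ∈ uIcc (φ t) (φ t') by
        rw [h1, h2, uIcc_of_ge (by linarith)]
        exact ⟨by norm_num, hu0.le⟩)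
    have hfx : f x = f 0 := by rw [← hgφ x (hsub hx), hx0, h0]
    have := hf.injective hfx
    have := hx.2.trans_lt hlt
    linarith
  let k : ℝ → M := fun s => if s ≤ 0 then f s else g s
  have hkf : ∀ s ≤ 0, k s = f s := fun s hs => if_pos hs
  have hkg : ∀ s, 0 < s → k s = g s := fun s hs => if_neg (not_le.2 hs)
  have hkc : Continuous k :=
    Continuous.if_le hf.continuous hg.continuous continuous_id continuous_const
      fun s hs => by
        have : s = 0 := hs
        rw [this, h0]
  by_cases hk : Function.Injective k
  · refine Or.inl ⟨k, isOpenEmbedding_of_injective hM hkc hk, ?_⟩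
    have hgk : range g ⊆ range k := by
      rintro _ ⟨u, rfl⟩
      rcases le_or_gt u 0 with hu | hu
      · obtain ⟨t, ht, h⟩ := hend u hu
        exact ⟨t, (hkf t ht.2).trans h⟩
      · exact ⟨u, hkg u hu⟩
    refine union_subset ?_ hgk
    rintro _ ⟨t, rfl⟩
    rcases le_or_gt t 0 with ht | ht
    · exact ⟨t, hkf t ht⟩
    · exact hgk (hpos t ht)
  right
  obtain ⟨s, s', hs, hs', hss⟩ : ∃ s s', s ≤ 0 ∧ 0 < s' ∧ f s = g s' := by
    simp only [Function.Injective, not_forall] at hk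
    obtain ⟨s, s', h, hne⟩ := hk
    rcases le_or_gt s 0 with hs | hs <;> rcases le_or_gt s' 0 with hs' | hs'
    · rw [hkf s hs, hkf s' hs'] at h
      exact absurd (hf.injective h) hne
    · rw [hkf s hs, hkg s' hs'] at h
      exact ⟨s, s', hs, hs', h⟩
    · rw [hkg s hs, hkf s' hs'] at h
      exact ⟨s', s, hs', hs, h.symm⟩
    · rw [hkg s hs, hkg s' hs'] at h
      exact absurd (hg.injective h) hne
  have hsa : s ≤ a := by
    by_contra! h
    exact absurd (hsign s ⟨h, hs⟩ s' hss) (not_le.2 hs')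
  -- the first return of `g` to `f '' [s, a]`
  let B : Set ℝ := Icc 0 s' ∩ g ⁻¹' (f '' Icc s a)
  have hB : IsCompact B := isCompact_Icc.inter_right
    ((isCompact_Icc.image hf.continuous).isClosed.preimage hg.continuous)
  obtain ⟨r', ⟨⟨hr'0, hr's⟩, r, hr, hrr⟩, hmin⟩ :=
    hB.exists_isLeast ⟨s', ⟨hs'.le, le_rfl⟩, s, ⟨le_rfl, hsa⟩, hss⟩
  have hr' : 0 < r' := by
    refine lt_of_le_of_ne hr'0 fun h => ?_
    rw [← h, ← h0] at hrr
    have := hf.injective hrr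
    linarith [hr.2]
  have hr0 : r < 0 := hr.2.trans_lt ha
  have hcross : ∀ q q', r ≤ q → q ≤ 0 → 0 < q' → q' < r' → f q ≠ g q' := by
    intro q q' h1 h2 h3 h4 h
    rcases le_or_gt q a with hq | hq
    · exact absurd (hmin ⟨⟨h3.le, h4.le.trans hr's⟩, q, ⟨hr.1.trans h1, hq⟩, h⟩) (not_le.2 h4)
    · exact absurd (hsign q ⟨hq, h2⟩ q' h) (not_le.2 h3)
  refine ⟨r' - r, by linarith, fun t => k (r + t),
    (hkc.comp (continuous_const.add continuous_id)).continuousOn, ?_, ?_⟩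
  · change k (r + 0) = k (r + (r' - r))
    rw [add_zero, add_sub_cancel, hkf r hr0.le, hkg r' hr', hrr]
  · intro t ht t' ht' h
    simp only at h
    suffices r + t = r + t' by linarith
    have := ht.1; have := ht.2; have := ht'.1; have := ht'.2
    rcases le_or_gt (r + t) 0 with hq | hq <;> rcases le_or_gt (r + t') 0 with hq' | hq'
    · rw [hkf _ hq, hkf _ hq'] at h
      exact hf.injective h
    · rw [hkf _ hq, hkg _ hq'] at h
      exact absurd h (hcross _ _ (by linarith) hq hq' (by linarith))
    · rw [hkg _ hq, hkf _ hq'] at h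
      exact absurd h.symm (hcross _ _ (by linarith) hq' hq (by linarith))
    · rw [hkg _ hq, hkg _ hq'] at h
      exact hg.injective h

theorem isOpenEmbedding_comp_neg {f : ℝ → M} (hf : IsOpenEmbedding f) :
    IsOpenEmbedding fun t => f (-t) := hf.comp (Homeomorph.neg ℝ).isOpenEmbedding

theorem range_comp_neg {M : Type*} (f : ℝ → M) : (range fun t => f (-t)) = range f :=
  (Homeomorph.neg ℝ).surjective.range_comp f

theorem isOpenEmbedding_comp_add {f : ℝ → M} (hf : IsOpenEmbedding f) (c : ℝ) :
    IsOpenEmbedding fun t => f (t + c) := hf.comp (Homeomorph.addRight c).isOpenEmbedding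

theorem range_comp_add {M : Type*} (f : ℝ → M) (c : ℝ) : (range fun t => f (t + c)) = range f :=
  (Homeomorph.addRight c).surjective.range_comp f

/-- Two overlapping lines in a one-dimensional manifold, none of which contains the other, are part
of a single line, unless they form a circle. -/
theorem glue_of_overlap (hM : ∀ m : M, ∃ g : ℝ → M, IsOpenEmbedding g ∧ m ∈ range g) [T2Space M]
    {f g : ℝ → M} (hf : IsOpenEmbedding f) (hg : IsOpenEmbedding g)
    (hfg : (range f ∩ range g).Nonempty) (h1 : ¬ range f ⊆ range g) (h2 : ¬ range g ⊆ range f) :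
    (∃ k : ℝ → M, IsOpenEmbedding k ∧ range f ∪ range g ⊆ range k) ∨ HasSimpleLoop M := by
  -- normalize the parametrizations so that `f 0 = g 0` and `f` leaves `g` at a negative parameter
  obtain ⟨f, hf, hfr, h0, s, hs, hsV⟩ : ∃ f' : ℝ → M, IsOpenEmbedding f' ∧ range f' = range f ∧
      (f' 0 ∈ range g) ∧ ∃ s < 0, f' s ∉ range g := by
    obtain ⟨_, ⟨t, rfl⟩, ht⟩ := hfg
    obtain ⟨_, ⟨s, rfl⟩, hs⟩ := not_subset.1 h1
    have hf' := isOpenEmbedding_comp_add hf t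
    rcases lt_trichotomy s t with h | rfl | h
    · exact ⟨_, hf', range_comp_add f t, by simpa using ht, s - t, by linarith, by simpa using hs⟩
    · exact absurd ht hs
    · refine ⟨_, isOpenEmbedding_comp_neg hf', ?_, by simpa using ht, t - s, by linarith,
        by simpa using hs⟩
      rw [range_comp_neg (fun x => f (x + t)), range_comp_add]
  rw [← hfr] at h2 ⊢
  clear! hfg
  obtain ⟨g, hg, hgr, h0⟩ : ∃ g' : ℝ → M, IsOpenEmbedding g' ∧ range g' = range g ∧ f 0 = g' 0 := by
    obtain ⟨t, ht⟩ := h0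
    exact ⟨_, isOpenEmbedding_comp_add hg t, range_comp_add g t, by simpa using ht.symm⟩
  rw [← hgr] at hsV h2 ⊢
  obtain ⟨a, ha, haV, hV⟩ := exists_exit hf.continuous hg.isOpen_range (h0 ▸ mem_range_self 0) hs hsV
  obtain ⟨g, hg, hgr, h0, hend⟩ : ∃ g' : ℝ → M, IsOpenEmbedding g' ∧ range g' = range g ∧
      f 0 = g' 0 ∧ ∀ u ≤ 0, ∃ t ∈ Ioc a 0, f t = g' u := by
    rcases exists_end hf.continuous hg h0 ha haV hV with h | h
    · refine ⟨_, isOpenEmbedding_comp_neg hg, range_comp_neg g, by simpa using h0, fun u hu => ?_⟩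
      exact h (-u) (by linarith)
    · exact ⟨g, hg, rfl, h0, h⟩
  rw [← hgr] at haV hV h2 ⊢
  refine glue_of_end hM hf hg h0 ha hV hend fun t ht => ?_
  -- if `f` left `g` also in the other direction, it would contain both ends of `g`
  by_contra htV
  have hf' := isOpenEmbedding_comp_neg hf
  have h0' : f (-0) = g 0 := by rw [neg_zero, h0]
  obtain ⟨b, hb, hbV, hV'⟩ := exists_exit (f := fun t => f (-t)) hf'.continuous hg.isOpen_range
    (h0' ▸ mem_range_self 0) (neg_lt_zero.2 ht) (by simpa using htV)
  rcases exists_end hf'.continuous hg h0' hb hbV hV' with h | h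
  · apply h2
    rintro _ ⟨u, rfl⟩
    rcases le_total u 0 with hu | hu
    · obtain ⟨t, -, h⟩ := hend u hu
      exact ⟨t, h⟩
    · obtain ⟨t, -, h⟩ := h u hu
      exact ⟨_, h⟩
  · obtain ⟨t, ht, htg⟩ := h (-1) (by norm_num)
    obtain ⟨t', ht', htg'⟩ := hend (-1) (by norm_num)
    have htt : -t = t' := hf.injective (htg.trans htg'.symm)
    have : t = 0 := by linarith [ht.2, ht'.2]
    subst this
    rw [neg_zero, h0] at htg
    have := hg.injective htg
    norm_num at this

/-- A compact connected one-dimensional manifold is a circle. -/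
theorem nonempty_homeomorph_circle [T2Space M] [CompactSpace M] [ConnectedSpace M]
    (hM : ∀ m : M, ∃ g : ℝ → M, IsOpenEmbedding g ∧ m ∈ range g) : Nonempty (M ≃ₜ Circle) := by
  classical
  apply HasSimpleLoop.nonempty_homeomorph hM
  by_contra hloop
  -- consider a cover by the least possible number of lines
  have hex : ∃ n, ∃ S : Finset (ℝ → M), S.card ≤ n ∧ (∀ f ∈ S, IsOpenEmbedding f) ∧
      ∀ m, ∃ f ∈ S, m ∈ range f := by
    choose g hg hgm using hM
    obtain ⟨t, ht⟩ := CompactSpace.elim_nhds_subcover (fun m => range (g m)) fun m =>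
      (hg m).isOpen_range.mem_nhds (hgm m)
    refine ⟨_, t.image g, le_rfl, ?_, fun m => ?_⟩
    · intro f hf
      obtain ⟨m, -, rfl⟩ := Finset.mem_image.1 hf
      exact hg m
    · have hm : m ∈ ⋃ x ∈ t, range (g x) := by rw [ht]; trivial
      obtain ⟨x, hx, hm⟩ := mem_iUnion₂.1 hm
      exact ⟨_, Finset.mem_image_of_mem g hx, hm⟩
  obtain ⟨S, hcard, hS, hcov⟩ := Nat.find_spec hex
  have hmin : ∀ S' : Finset (ℝ → M), (∀ f ∈ S', IsOpenEmbedding f) →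
      (∀ m, ∃ f ∈ S', m ∈ range f) → S.card ≤ S'.card := fun S' h1 h2 =>
    hcard.trans (Nat.find_min' hex ⟨S', le_rfl, h1, h2⟩)
  obtain ⟨f, hfS, -⟩ := hcov (Classical.arbitrary M)
  have hf := hS f hfS
  have hne : range f ≠ univ := fun h =>
    have : IsHomeomorph f := ⟨hf.continuous, hf.isOpenMap, hf.injective, range_eq_univ.1 h⟩
    have : CompactSpace ℝ := (this.homeomorph f).symm.compactSpace
    noncompact_univ ℝ isCompact_univ
  obtain ⟨g, hgS, hgf, hfg⟩ : ∃ g ∈ S, g ≠ f ∧ (range f ∩ range g).Nonempty := by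
    by_contra! h
    refine hne (IsClopen.eq_univ ⟨?_, hf.isOpen_range⟩ (range_nonempty f))
    rw [← isOpen_compl_iff]
    have : (range f)ᶜ = ⋃ g ∈ S.erase f, range g := by
      ext m
      simp only [mem_compl_iff, mem_iUnion, exists_prop]
      constructor
      · intro hm
        obtain ⟨g, hg, hmg⟩ := hcov m
        exact ⟨g, Finset.mem_erase.2 ⟨fun h => hm (h ▸ hmg), hg⟩, hmg⟩
      · rintro ⟨g, hg, hmg⟩ hm
        obtain ⟨hgf, hg⟩ := Finset.mem_erase.1 hg
        exact (h g hg hgf).subset ⟨hm, hmg⟩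
    rw [this]
    exact isOpen_biUnion fun g hg => (hS g (Finset.mem_of_mem_erase hg)).isOpen_range
  have hg := hS g hgS
  have herase : ∀ f ∈ S, ∀ g ∈ S, g ≠ f → ¬ range f ⊆ range g := by
    intro f hf g hg hgf hsub
    have := hmin (S.erase f) (fun k hk => hS k (Finset.mem_of_mem_erase hk)) fun m => by
      obtain ⟨k, hk, hm⟩ := hcov m
      by_cases hkf : k = f
      · exact ⟨g, Finset.mem_erase.2 ⟨hgf, hg⟩, hsub (hkf ▸ hm)⟩
      · exact ⟨k, Finset.mem_erase.2 ⟨hkf, hk⟩, hm⟩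
    have := Finset.card_erase_lt_of_mem hf
    omega
  rcases glue_of_overlap hM hf hg hfg (herase f hfS g hgS hgf) (herase g hgS f hfS hgf.symm) with
    ⟨k, hk, hsub⟩ | h
  · have h1 := hmin (insert k ((S.erase f).erase g)) ?_ ?_
    · have h2 := Finset.card_insert_le k ((S.erase f).erase g)
      have h3 := Finset.card_erase_lt_of_mem hfS
      have h4 := Finset.card_erase_lt_of_mem (Finset.mem_erase.2 ⟨hgf, hgS⟩)
      omega
    · intro e he
      rcases Finset.mem_insert.1 he with rfl | he
      · exact hk
      · exact hS e (Finset.mem_of_mem_erase (Finset.mem_of_mem_erase he))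
    · intro m
      obtain ⟨e, he, hm⟩ := hcov m
      by_cases hef : e = f
      · exact ⟨k, Finset.mem_insert_self _ _, hsub (Or.inl (hef ▸ hm))⟩
      by_cases heg : e = g
      · exact ⟨k, Finset.mem_insert_self _ _, hsub (Or.inr (heg ▸ hm))⟩
      exact ⟨e, Finset.mem_insert_of_mem (Finset.mem_erase.2 ⟨heg, Finset.mem_erase.2 ⟨hef, he⟩⟩),
        hm⟩
  · exact hloop h

end OneManifold

/-! ### Special polyhedra have vertices -/

theorem isCompact_connectedComponentIn {M : Type*} [TopologicalSpace M] {K : Set M}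
    (hK : IsCompact K) (x : M) : IsCompact (connectedComponentIn K x) := by
  by_cases hx : x ∈ K
  · rw [connectedComponentIn_eq_image hx]
    have := isCompact_iff_compactSpace.1 hK
    exact isClosed_connectedComponent.isCompact.image continuous_subtype_val
  · rw [connectedComponentIn_eq_empty hx]
    exact isCompact_empty

namespace ClosedOrbifold

variable {X : ClosedOrbifold} {P : Set X.carrier} {x : X.carrier}

/-- In a chart, near a point of `P` with link `L`, the set `P` is identified with the model `M`;
the identification carries germs to germs. -/
theorem HasLink.exists_model {L M : Set V3} (hL : X.HasLink P x L) (hx : x ∈ P)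
    (hM : PLGermEquiv (cone L) 0 M 0) {φ : OpenPartialHomeomorph X.carrier V3} (hφ : φ ∈ X.charts)
    (hxφ : x ∈ φ.source) :
    ∃ h : PartialEquiv V3 V3, h.source ⊆ φ '' (P ∩ φ.source) ∧ h.target ⊆ M ∧ h.target ∈ 𝓝[M] 0 ∧
      h (φ x) = 0 ∧ ContinuousOn h h.source ∧ ContinuousOn h.symm h.target ∧
      ∃ W : Set X.carrier, IsOpen W ∧ x ∈ W ∧ W ⊆ φ.source ∧ ∀ y ∈ P ∩ W, φ y ∈ h.source ∧
        PLGermEquiv (φ '' (P ∩ φ.source)) (φ y) M (h (φ y)) := by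
  have hxA : φ x ∈ φ '' (P ∩ φ.source) := ⟨x, ⟨hx, hxφ⟩, rfl⟩
  obtain ⟨h, h1, -, h3, h4, h5, h6, h7, hev⟩ :=
    ((hL.germ hx hφ hxφ).trans hM hxA).eventually hxA
  obtain ⟨O, hO, hxO, hOs⟩ := mem_nhdsWithin.1 hev
  refine ⟨h, h1, h3, h4, h5, h6, h7, φ.source ∩ φ ⁻¹' O, φ.isOpen_inter_preimage hO, ⟨hxφ, hxO⟩,
    inter_subset_left, fun y hy => hOs ⟨hy.2.2, y, ⟨hy.1, hy.2.1⟩, rfl⟩⟩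

theorem HasLink.germ_bookModel (h : X.HasLink P x thetaLink) (hx : x ∈ P)
    {φ : OpenPartialHomeomorph X.carrier V3} (hφ : φ ∈ X.charts) (hxφ : x ∈ φ.source) :
    PLGermEquiv bookModel 0 (φ '' (P ∩ φ.source)) (φ x) := by
  have hxA : φ x ∈ φ '' (P ∩ φ.source) := ⟨x, ⟨hx, hxφ⟩, rfl⟩
  exact ((h.germ hx hφ hxφ).trans (germ_of_flatten' fun _ => mem_cone_thetaLink) hxA).symm hxA

/-- If there are no vertices, the singular points are the points whose link is a circle with two
radii. -/
theorem mem_singularPoints_iff (hv : X.vertices P = ∅) :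
    x ∈ X.singularPoints P ↔ x ∈ P ∧ X.HasLink P x thetaLink := by
  refine ⟨fun ⟨hx, h⟩ => ⟨hx, h.resolve_right fun h => ?_⟩, fun ⟨hx, h⟩ => ⟨hx, Or.inl h⟩⟩
  exact (hv ▸ (⟨hx, h⟩ : x ∈ X.vertices P) : x ∈ (∅ : Set X.carrier))

theorem isClosed_singularPoints (hP : X.IsAlmostSpecial P) (hv : X.vertices P = ∅) :
    IsClosed (X.singularPoints P) := by
  have hPc : IsClosed P := hP.1.1.1.isClosed
  rw [← isOpen_compl_iff, isOpen_iff_mem_nhds]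
  intro x hx
  by_cases hxP : x ∈ P
  · have hl : X.HasLink P x circleLink := (hP.2 x hxP).resolve_right fun h => hx ⟨hxP, h⟩
    obtain ⟨φ, hφ, hxφ, -⟩ := id hl
    obtain ⟨h, -, ht, -, -, -, -, W, hW, hxW, hWφ, hgerm⟩ :=
      hl.exists_model hxP (germ_of_flatten' fun _ => mem_cone_circleLink) hφ hxφ
    filter_upwards [hW.mem_nhds hxW] with y hyW hy
    rw [mem_singularPoints_iff hv] at hy
    exact not_germ_bookModel subset_rfl _
      ((hy.2.germ_bookModel hy.1 hφ (hWφ hyW)).trans (hgerm y ⟨hy.1, hyW⟩).2 zero_mem_bookModel)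
  · filter_upwards [hPc.isOpen_compl.mem_nhds hxP] with y hy hy'
    exact hy hy'.1

/-- In an almost-special polyhedron without vertices the singular points form a one-dimensional
manifold. -/
theorem exists_line_singularPoints (hv : X.vertices P = ∅) (x : X.singularPoints P) :
    ∃ f : ℝ → X.singularPoints P, IsOpenEmbedding f ∧ x ∈ range f := by
  obtain ⟨hxP, hl⟩ := (mem_singularPoints_iff hv).1 x.2
  obtain ⟨φ, hφ, hxφ, -⟩ := id hl
  obtain ⟨h, hsA, htM, htn, h0, hc, hc', W, hW, hxW, hWφ, hgerm⟩ :=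
    hl.exists_model hxP (germ_of_flatten' fun _ => mem_cone_thetaLink) hφ hxφ
  have haxis : ∀ y ∈ P ∩ W, (y ∈ X.singularPoints P ↔ h (φ y) 1 = 0 ∧ h (φ y) 2 = 0) := by
    intro y hy
    rw [mem_singularPoints_iff hv]
    constructor
    · intro h'
      exact mem_axis_of_germ
        ((h'.2.germ_bookModel hy.1 hφ (hWφ hy.2)).trans (hgerm y hy).2 zero_mem_bookModel)
    · rintro ⟨h1, h2⟩
      have hyA : φ y ∈ φ '' (P ∩ φ.source) := ⟨y, ⟨hy.1, hWφ hy.2⟩, rfl⟩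
      refine ⟨hy.1, φ, hφ, hWφ hy.2, (hgerm y hy).2.trans ?_ hyA⟩
      exact (germ_bookModel_of_mem_axis h1 h2).trans (germ_of_flatten fun _ => mem_cone_thetaLink)
        (htM (h.map_source (hgerm y hy).1))
  have hxs : φ x ∈ h.source := (hgerm x ⟨hxP, hxW⟩).1
  have hsymm0 : h.symm 0 = φ x := by rw [← h0, h.left_inv hxs]
  -- the axis of the book
  let ι : ℝ → V3 := fun s => ![s, 0, 0]
  have hι : Continuous ι := by fun_prop
  have hι0 : ι 0 = 0 := by ext i; fin_cases i <;> rfl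
  have hιM : ∀ s, ι s ∈ bookModel := fun s => Or.inl rfl
  have hιlim : Tendsto ι (𝓝 0) (𝓝[bookModel] 0) := by
    refine tendsto_nhdsWithin_iff.2 ⟨?_, Eventually.of_forall hιM⟩
    have := hι.tendsto 0
    rwa [hι0] at this
  let G : ℝ → X.carrier := fun s => φ.symm (h.symm (ι s))
  have hG : Tendsto G (𝓝 0) (𝓝 x.1) := by
    have h0t : (0 : V3) ∈ h.target := h0 ▸ h.map_source hxs
    have h1 : Tendsto h.symm (𝓝[bookModel] 0) (𝓝 (φ x)) := by
      have := hc' 0 h0t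
      rw [ContinuousWithinAt, hsymm0] at this
      exact this.mono_left (nhdsWithin_le_iff.2 htn)
    have h2 : Tendsto φ.symm (𝓝 (φ x)) (𝓝 x.1) := by
      have := φ.symm.continuousAt (φ.map_source hxφ)
      rwa [ContinuousAt, φ.left_inv hxφ] at this
    exact h2.comp (h1.comp hιlim)
  obtain ⟨δ, hδ, hδs⟩ := Metric.nhds_basis_ball.mem_iff.1
    (inter_mem (hιlim htn) (hG (hW.mem_nhds hxW)))
  have hGA : ∀ s ∈ Metric.ball (0 : ℝ) δ, G s ∈ P ∧ h.symm (ι s) ∈ φ.target ∧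
      φ (G s) = h.symm (ι s) := by
    intro s hs
    obtain ⟨y, hy, hys⟩ := hsA (h.map_target (hδs hs).1)
    have : G s = y := by
      simp only [G]
      rw [← hys, φ.left_inv hy.2]
    rw [this, ← hys]
    exact ⟨hy.1, φ.map_source hy.2, rfl⟩
  have hhG : ∀ s ∈ Metric.ball (0 : ℝ) δ, h (φ (G s)) = ι s := fun s hs => by
    rw [(hGA s hs).2.2, h.right_inv (hδs hs).1]
  have hGS : ∀ s ∈ Metric.ball (0 : ℝ) δ, G s ∈ X.singularPoints P := fun s hs => by
    rw [haxis _ ⟨(hGA s hs).1, (hδs hs).2⟩, hhG s hs]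
    exact ⟨rfl, rfl⟩
  let W' : Set (X.singularPoints P) := Subtype.val ⁻¹' W
  have hW' : IsOpen W' := hW.preimage continuous_subtype_val
  let κ : X.singularPoints P → ℝ := fun y => h (φ y) 0
  have hκc : ContinuousOn κ W' := by
    refine (continuous_apply 0).comp_continuousOn ?_
    exact hc.comp (φ.continuousOn.comp continuous_subtype_val.continuousOn fun y hy => hWφ hy)
      fun y hy => (hgerm y ⟨y.2.1, hy⟩).1
  have hκι : ∀ y ∈ W', ι (κ y) = h (φ y) := fun y hy => by
    obtain ⟨h1, h2⟩ := (haxis y ⟨y.2.1, hy⟩).1 y.2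
    ext i
    fin_cases i
    exacts [rfl, h1.symm, h2.symm]
  classical
  let inv : ℝ → X.singularPoints P := fun s =>
    if hs : s ∈ Metric.ball (0 : ℝ) δ then ⟨G s, hGS s hs⟩ else x
  have hinv : ∀ s ∈ Metric.ball (0 : ℝ) δ, (inv s : X.carrier) = G s := fun s hs => by
    simp only [inv, dif_pos hs]
  let e : OpenPartialHomeomorph (X.singularPoints P) ℝ :=
    { toFun := κ
      invFun := inv
      source := W' ∩ κ ⁻¹' Metric.ball 0 δ
      target := Metric.ball 0 δ
      map_source' := fun y hy => hy.2
      map_target' := fun s hs => by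
        refine ⟨?_, ?_⟩
        · change (inv s : X.carrier) ∈ W
          rw [hinv s hs]
          exact (hδs hs).2
        · change h (φ (inv s)) 0 ∈ Metric.ball 0 δ
          rw [hinv s hs, hhG s hs]
          exact hs
      left_inv' := fun y hy => by
        apply Subtype.ext
        rw [hinv _ hy.2]
        change φ.symm (h.symm (ι (κ y))) = y
        rw [hκι y hy.1, h.left_inv (hgerm y ⟨y.2.1, hy.1⟩).1, φ.left_inv (hWφ hy.1)]
      right_inv' := fun s hs => by
        change h (φ (inv s)) 0 = s
        rw [hinv s hs, hhG s hs]
        rfl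
      open_source := hκc.isOpen_inter_preimage hW' Metric.isOpen_ball
      open_target := Metric.isOpen_ball
      continuousOn_toFun := hκc.mono inter_subset_left
      continuousOn_invFun := by
        rw [Topology.IsInducing.subtypeVal.continuousOn_iff]
        refine ContinuousOn.congr (f := G) ?_ hinv
        exact φ.symm.continuousOn.comp (hc'.comp hι.continuousOn fun s hs => (hδs hs).1)
          fun s hs => (hGA s hs).2.1 }
  have hsrc : ((OpenPartialHomeomorph.univBall (0 : ℝ) δ).trans e.symm).source = univ := by
    rw [eq_univ_iff_forall]
    intro s
    rw [OpenPartialHomeomorph.trans_source, OpenPartialHomeomorph.univBall_source]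
    refine ⟨trivial, ?_⟩
    have := (OpenPartialHomeomorph.univBall (0 : ℝ) δ).map_source
      (x := s) (by rw [OpenPartialHomeomorph.univBall_source]; trivial)
    rwa [OpenPartialHomeomorph.univBall_target _ hδ] at this
  refine ⟨_, OpenPartialHomeomorph.isOpenEmbedding _ hsrc, 0, ?_⟩
  change inv (OpenPartialHomeomorph.univBall (0 : ℝ) δ 0) = x
  rw [OpenPartialHomeomorph.univBall_apply_zero]
  apply Subtype.ext
  rw [hinv 0 (Metric.mem_ball_self hδ)]
  change φ.symm (h.symm (ι 0)) = x
  rw [hι0, hsymm0, φ.left_inv hxφ]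

/-- A nonempty special polyhedron has a vertex: otherwise either its singular points form circles,
or it is a closed surface, whose components are not open discs. -/
theorem IsSpecial.vertices_nonempty (hP : X.IsSpecial P) (hne : P.Nonempty) :
    (X.vertices P).Nonempty := by
  rw [nonempty_iff_ne_empty]
  intro hv
  obtain ⟨hP, hcirc, hdisc⟩ := hP
  rcases (X.singularPoints P).eq_empty_or_nonempty with hS | ⟨x, hx⟩
  · obtain ⟨x, hx⟩ := hne
    obtain ⟨e⟩ := hdisc x ⟨hx, by rw [hS]; exact notMem_empty _⟩
    rw [hS, sdiff_empty] at e
    have := isCompact_iff_compactSpace.1 (isCompact_connectedComponentIn hP.1.1.1 x)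
    have := e.compactSpace
    exact noncompact_univ (EuclideanSpace ℝ (Fin 2)) isCompact_univ
  · refine hcirc x hx ?_
    let C : Set X.carrier := connectedComponentIn (X.singularPoints P) x
    have hCs : C ⊆ X.singularPoints P := connectedComponentIn_subset _ _
    have : CompactSpace C := isCompact_iff_compactSpace.1
      (isCompact_connectedComponentIn (isClosed_singularPoints hP hv).isCompact x)
    have : ConnectedSpace C :=
      isConnected_iff_connectedSpace.1 (isConnected_connectedComponentIn_iff.2 hx)
    refine nonempty_homeomorph_circle fun c => ?_
    obtain ⟨f, hf, t, ht⟩ := exists_line_singularPoints hv ⟨c, hCs c.2⟩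
    have hfC : ∀ s, (f s : X.carrier) ∈ C := by
      have hr : IsPreconnected (range fun s => (f s : X.carrier)) :=
        isPreconnected_range (continuous_subtype_val.comp hf.continuous)
      have := hr.subset_connectedComponentIn (F := X.singularPoints P) (x := c.1)
        ⟨t, congrArg (fun y : X.singularPoints P => y.1) ht⟩ (range_subset_iff.2 fun s => (f s).2)
      rw [← connectedComponentIn_eq c.2] at this
      exact range_subset_iff.1 this
    have hcont : Continuous fun s => (⟨f s, hfC s⟩ : C) :=
      (continuous_subtype_val.comp hf.continuous).subtype_mk _
    have hincl : Continuous (inclusion hCs) := continuous_inclusion hCs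
    refine ⟨fun s => ⟨f s, hfC s⟩, ⟨.of_comp hcont hincl hf.isEmbedding, ?_⟩, t,
      Subtype.ext (congrArg (fun y : X.singularPoints P => y.1) ht)⟩
    have : (range fun s => (⟨f s, hfC s⟩ : C)) = inclusion hCs ⁻¹' range f := by
      ext y
      constructor
      · rintro ⟨s, rfl⟩
        exact ⟨s, rfl⟩
      · rintro ⟨s, hs⟩
        exact ⟨s, Subtype.ext (congrArg (fun y : X.singularPoints P => y.1) hs)⟩
    rw [this]
    exact hf.isOpen_range.preimage hincl

end ClosedOrbifold

/-! ### Lower bounds for the complexity -/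

theorem not_isCompact_of_ray {K : Set V3} (hK : K ⊆ openDisc) {v : V3} (hv : v ∉ openDisc)
    (h : ∀ t ∈ Ioo (0 : ℝ) 1, t • v ∈ K) : ¬ IsCompact K := by
  intro hc
  refine hv (hK (hc.isClosed.mem_of_tendsto (f := fun t : ℝ => t • v) (b := 𝓝[<] (1 : ℝ)) ?_ ?_))
  · have : Tendsto (fun t : ℝ => t • v) (𝓝 1) (𝓝 ((1 : ℝ) • v)) :=
      Continuous.tendsto (by fun_prop) 1
    rw [one_smul] at this
    exact this.mono_left nhdsWithin_le_nhds
  · filter_upwards [Ioo_mem_nhdsLT (zero_lt_one (α := ℝ))] with t ht using h t ht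

theorem smul_mem_openDisc {v : V3} (hv : ∑ i, |v i| = 1) {t : ℝ} (ht : t ∈ Ioo (0 : ℝ) 1) :
    t • v ∈ openDisc := by
  simp only [openDisc, mem_ofPred_eq, Pi.smul_apply, smul_eq_mul, abs_mul, abs_of_pos ht.1]
  rw [← Finset.mul_sum, hv, mul_one]
  exact ht.2

/-- The singular set of an open discal orbifold is not compact, unless it is empty. -/
theorem not_isCompact_singular {l : V3 → ℕ} (hl : IsDiscalLabel l)
    (hne : {y ∈ openDisc | l y ≠ 1}.Nonempty) : ¬ IsCompact {y ∈ openDisc | l y ≠ 1} := by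
  have key : ∀ v : V3, ∑ i, |v i| = 1 → (∀ t ∈ Ioo (0 : ℝ) 1, l (t • v) ≠ 1) →
      ¬ IsCompact {y ∈ openDisc | l y ≠ 1} := fun v hv h =>
    not_isCompact_of_ray (fun y hy => hy.1) (v := v) (fun h' => absurd hv (ne_of_lt h'))
      fun t ht => ⟨smul_mem_openDisc hv ht, h t ht⟩
  cases hl with
  | ordinary =>
    obtain ⟨y, -, hy⟩ := hne
    exact absurd rfl hy
  | cyclic p hp =>
    refine key ![0, 0, 1] (by simp [Fin.sum_univ_three]) fun t ht => ?_
    have : (2 : ℕ) ≤ p := hp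
    simp [cyclicLabel]
    omega
  | vertex p q r h =>
    refine key ![1, 0, 0] (by simp [Fin.sum_univ_three]) fun t ht => ?_
    have h0 : t • (![1, 0, 0] : V3) ≠ 0 := fun h => ht.1.ne' (by simpa using congrFun h 0)
    rw [vertexLabel, if_neg h0, if_pos (by simpa using ht.1)]
    rcases h with ⟨n, hn, h⟩ | ⟨n, hn, -, h⟩
    all_goals
      have hp : p ∈ ({p, q, r} : Multiset ℕ) := by simp
      rw [h] at hp
      simp only [Multiset.insert_eq_cons, Multiset.mem_cons, Multiset.mem_singleton] at hp
      omega

theorem IsDiscalLabel.eq_zero {l : V3 → ℕ} (hl : IsDiscalLabel l) {y : V3} (hy : l y = 0) :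
    y = 0 := by
  cases hl with
  | ordinary => exact absurd hy one_ne_zero
  | cyclic p hp =>
    unfold cyclicLabel at hy
    split_ifs at hy
    omega
  | vertex p q r h =>
    obtain ⟨h1, h2, h3⟩ := h.one_le
    unfold vertexLabel at hy
    split_ifs at hy
    · assumption
    all_goals omega

namespace ClosedOrbifold

variable {X : ClosedOrbifold} {P : Set X.carrier} {x : X.carrier}

/-- The support is compact, and hence it is not covered by disjoint open discs. -/
theorem IsSpine.nonempty (hP : X.IsSpine P) (x : X.carrier) : P.Nonempty := by
  by_contra! h
  subst h
  obtain ⟨φ, -, hs, ht, -⟩ := hP.2.2 x (by simp)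
  have hc : IsCompact φ.source := by
    rw [hs, compl_empty]
    exact isCompact_connectedComponentIn isCompact_univ x
  have : IsCompact openDisc := by
    rw [← ht, ← φ.image_source_eq_target]
    exact hc.image_of_continuousOn φ.continuousOn
  refine not_isCompact_of_ray subset_rfl (v := ![0, 0, 1]) (by simp [openDisc, Fin.sum_univ_three])
    (fun t ht => smul_mem_openDisc (by simp [Fin.sum_univ_three]) ht) this

/-- A spine meets the singular set, if this is compact, connected and nonempty. -/
theorem IsSpine.inter_singularSet_nonempty (hP : X.IsSpine P) (hF : IsCompact X.singularSet)
    (hF' : IsConnected X.singularSet) : (P ∩ X.singularSet).Nonempty := by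
  by_contra! h
  obtain ⟨x, hx⟩ := hF'.nonempty
  have hsub : X.singularSet ⊆ Pᶜ := fun y hy hyP => (h ▸ (⟨hyP, hy⟩ : y ∈ P ∩ X.singularSet) :
    y ∈ (∅ : Set X.carrier))
  obtain ⟨φ, -, hs, ht, l, hl, hlab⟩ := hP.2.2 x (hsub hx)
  have hFs : X.singularSet ⊆ φ.source := by
    rw [hs]
    exact hF'.isPreconnected.subset_connectedComponentIn hx hsub
  have himg : φ '' X.singularSet = {y ∈ openDisc | l y ≠ 1} := by
    ext y
    constructor
    · rintro ⟨z, hz, rfl⟩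
      refine ⟨ht ▸ φ.map_source (hFs hz), ?_⟩
      rw [← hlab z (hFs hz)]
      exact hz
    · rintro ⟨hy, hly⟩
      rw [← ht] at hy
      refine ⟨φ.symm y, ?_, φ.right_inv hy⟩
      change X.label _ ≠ 1
      rwa [hlab _ (φ.map_target hy), φ.right_inv hy]
  refine not_isCompact_singular hl ?_ ?_
  · rw [← himg]
    exact ⟨_, mem_image_of_mem φ hx⟩
  · rw [← himg]
    exact hF.image_of_continuousOn (φ.continuousOn.mono hFs)

/-- A spine meets each connected set which contains two vertices of the singular set. -/
theorem IsSpine.inter_nonempty (hP : X.IsSpine P) {E : Set X.carrier} (hE : IsPreconnected E)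
    {x y : X.carrier} (hx : x ∈ E) (hy : y ∈ E) (hxy : x ≠ y) (hx0 : X.label x = 0)
    (hy0 : X.label y = 0) : (P ∩ E).Nonempty := by
  by_contra! h
  have hsub : E ⊆ Pᶜ := fun y hy hyP => (h ▸ (⟨hyP, hy⟩ : y ∈ P ∩ E) : y ∈ (∅ : Set X.carrier))
  obtain ⟨φ, -, hs, ht, l, hl, hlab⟩ := hP.2.2 x (hsub hx)
  have hEs : E ⊆ φ.source := by
    rw [hs]
    exact hE.subset_connectedComponentIn hx hsub
  have key : ∀ z ∈ E, X.label z = 0 → φ z = 0 := fun z hz hz0 =>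
    hl.eq_zero (by rw [← hlab z (hEs hz), hz0])
  exact hxy (φ.injOn (hEs hx) (hEs hy) ((key x hx hx0).trans (key y hy hy0).symm))

/-- A spine avoids the vertices of the singular set. -/
theorem IsSpine.label_ne_zero (hP : X.IsSpine P) (hx : x ∈ P) : X.label x ≠ 0 := by
  intro h
  obtain ⟨φ, -, -, h0, p, hp, hev⟩ := hP.2.1 x ⟨hx, by rw [singularSet, mem_ofPred_eq, h]; omega⟩
  have := hev.self_of_nhds.2
  rw [h, h0, cyclicLabel, if_pos ⟨rfl, rfl⟩] at this
  omega

theorem summable_enat {ι : Type*} (f : ι → ℕ∞) : Summable f :=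
  ⟨_, hasSum_of_isLUB _ (isLUB_iSup (f := fun s : Finset ι => ∑ i ∈ s, f i))⟩

theorem add_sum_le_spineComplexity {ι : Type*} [Fintype ι] (f : ι → X.carrier)
    (hf : Function.Injective f) (hfP : ∀ i, f i ∈ P ∩ X.singularSet) :
    (X.vertices P).encard + ((∑ i, (X.label (f i) - 1) : ℕ) : ℕ∞) ≤ X.spineComplexity P := by
  refine add_le_add le_rfl ?_
  let g : ι ↪ ↥(P ∩ X.singularSet) :=
    ⟨fun i => ⟨f i, hfP i⟩, fun i j h => hf (congrArg Subtype.val h)⟩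
  have h := (summable_enat fun x : ↥(P ∩ X.singularSet) =>
    ((X.label x - 1 : ℕ) : ℕ∞)).sum_le_tsum (Finset.univ.map g) fun _ _ => zero_le
  rw [Finset.sum_map] at h
  exact_mod_cast h

theorem spineComplexity_le {ι : Type*} [Fintype ι] (f : ι → X.carrier)
    (hv : X.vertices P = ∅) (hf : P ∩ X.singularSet ⊆ range f) :
    X.spineComplexity P ≤ ((∑ i, (X.label (f i) - 1) : ℕ) : ℕ∞) := by
  classical
  rw [spineComplexity, hv, encard_empty, zero_add]
  choose g hg using fun x : ↥(P ∩ X.singularSet) => hf x.2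
  have hgi : Function.Injective g := fun x y h => Subtype.ext (by rw [← hg x, ← hg y, h])
  have := Fintype.ofInjective g hgi
  rw [tsum_fintype]
  simp_rw [← hg]
  rw [Nat.cast_sum, ← Finset.sum_image (f := fun i => ((X.label (f i) - 1 : ℕ) : ℕ∞)) (g := g)
    (s := Finset.univ) (fun x _ y _ h => hgi h)]
  exact Finset.sum_le_sum_of_subset (Finset.subset_univ _)

/-- If the contributions of the singular points to the complexities of the spines are at least `n`,
and some spine has complexity `n`, then the minimal spines have no vertices, and hence are not
special. -/
theorem complexity_eq_of_spine {n : ℕ} (x : X.carrier)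
    (hlow : ∀ P, X.IsSpine P → (X.vertices P).encard + n ≤ X.spineComplexity P)
    (hP : X.IsSpine P) (hPn : X.spineComplexity P ≤ n) :
    X.complexity = n ∧ ∀ P, X.IsMinimalSpine P → ¬ X.IsSpecial P := by
  have hc : X.complexity = n := by
    refine le_antisymm ((iInf₂_le P hP).trans hPn) ?_
    exact le_iInf₂ fun Q hQ => le_add_self.trans (hlow Q hQ)
  refine ⟨hc, fun Q hQ hQs => ?_⟩
  have h1 := hlow Q hQ.1
  rw [hQ.2.1, hc] at h1
  have h2 : (X.vertices Q).encard = 0 := by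
    by_contra h
    have : (1 : ℕ∞) + n ≤ n := (add_le_add (Order.one_le_iff_ne_zero.2 h) le_rfl).trans h1
    have : 1 + n ≤ n := by exact_mod_cast this
    omega
  exact (hQs.vertices_nonempty (hQ.1.nonempty x)).ne_empty (encard_eq_zero.1 h2)

/-- For an orbifold whose singular set is connected, without vertices, and of order `p`, a spine
meeting the singular set once has complexity `p - 1`. -/
theorem complexity_eq_of_connected {p : ℕ} (x : X.carrier)
    (hlab : ∀ y ∈ X.singularSet, X.label y = p)
    (hS : 2 ≤ p → IsCompact X.singularSet ∧ IsConnected X.singularSet)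
    (hP : X.IsSpine P) (hv : X.vertices P = ∅) (hxP : P ∩ X.singularSet ⊆ {x})
    (hxl : X.label x = p) :
    X.complexity = ((p - 1 : ℕ) : ℕ∞) ∧ ∀ P, X.IsMinimalSpine P → ¬ X.IsSpecial P := by
  refine complexity_eq_of_spine x (fun Q hQ => ?_) hP ?_
  · rcases le_or_gt 2 p with hp | hp
    · obtain ⟨y, hy⟩ := hQ.inter_singularSet_nonempty (hS hp).1 (hS hp).2
      have := add_sum_le_spineComplexity (fun _ : Unit => y) (fun _ _ _ => rfl) fun _ => hy
      simpa [hlab y hy.2] using this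
    · have : p - 1 = 0 := by omega
      rw [this]
      exact add_le_add le_rfl (zero_le (a := (_ : ℕ∞)))
  · have := spineComplexity_le (fun _ : Unit => x) hv (by rwa [range_const])
    simpa [hxl] using this

/-- The domain of a chart onto the open disc, if it is open and closed in the complement of `P`, is
a component of the complement. -/
theorem component_eq_source {φ : OpenPartialHomeomorph X.carrier V3} (ht : φ.target = openDisc)
    (hx : x ∈ φ.source) (hs : φ.source ⊆ Pᶜ) (hcl : IsOpen (Pᶜ \ φ.source)) :
    φ.source = connectedComponentIn Pᶜ x := by
  have hconn : IsPreconnected φ.source := by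
    rw [← φ.symm_image_target_eq_source, ht]
    refine IsPreconnected.image ?_ _ (ht ▸ φ.symm.continuousOn)
    have : Convex ℝ openDisc := by
      have h : ConvexOn ℝ univ fun y : V3 => ∑ i, |y i| := by
        refine ⟨convex_univ, fun y _ z _ a b ha hb _ => ?_⟩
        simp only [Pi.add_apply, Pi.smul_apply, smul_eq_mul]
        rw [Finset.mul_sum, Finset.mul_sum, ← Finset.sum_add_distrib]
        refine Finset.sum_le_sum fun i _ => (abs_add_le _ _).trans ?_
        rw [abs_mul, abs_mul, abs_of_nonneg ha, abs_of_nonneg hb]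
      have he : openDisc = {y : V3 | y ∈ univ ∧ ∑ i, |y i| < 1} :=
        Set.ext fun y => (and_iff_right (mem_univ y)).symm
      rw [he]
      exact h.convex_lt 1
    exact this.isPreconnected
  refine (hconn.subset_connectedComponentIn hx hs).antisymm ?_
  refine isPreconnected_connectedComponentIn.subset_left_of_subset_union φ.open_source hcl
    disjoint_sdiff_right ?_ ⟨x, mem_connectedComponentIn (hs hx), hx⟩
  intro y hy
  by_cases hys : y ∈ φ.source
  · exact Or.inl hys
  · exact Or.inr ⟨connectedComponentIn_subset _ _ hy, hys⟩

end ClosedOrbifold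

/-! ### Spines of the spherical orbifolds -/

/-- A variant of `exists_openPartialHomeomorph` for maps which are only continuous on the domain. -/
theorem exists_openPartialHomeomorph_of_continuousOn {E : Type*} [TopologicalSpace E] {S : Set E}
    (f : E → V3) (g : V3 → E) (U : Set E) (W : Set V3)
    (hU : IsOpen U) (hW : IsOpen W) (hf : ContinuousOn f U) (hg : Continuous g)
    (hfg : ∀ s ∈ S, s ∈ U → f s ∈ W ∧ g (f s) = s)
    (hgf : ∀ y ∈ W, g y ∈ S ∧ g y ∈ U ∧ f (g y) = y) (hS : S.Nonempty) :
    ∃ e : OpenPartialHomeomorph S V3, e.source = {s : S | (s : E) ∈ U} ∧ e.target = W ∧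
      (∀ s, e s = f s) ∧ ∀ y ∈ W, (e.symm y : E) = g y := by
  classical
  obtain ⟨s₀, hs₀⟩ := hS
  let inv : V3 → S := fun y => if h : y ∈ W then ⟨g y, (hgf y h).1⟩ else ⟨s₀, hs₀⟩
  have hinv : ∀ y ∈ W, (inv y : E) = g y := fun y hy => by simp [inv, hy]
  refine ⟨{ toFun := fun s => f s
            invFun := inv
            source := {s : S | (s : E) ∈ U}
            target := W
            map_source' := fun s hs => (hfg s s.2 hs).1
            map_target' := fun y hy => by
              change (inv y : E) ∈ U
              rw [hinv y hy]
              exact (hgf y hy).2.1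
            left_inv' := fun s hs => by
              apply Subtype.ext
              rw [hinv _ (hfg s s.2 hs).1]
              exact (hfg s s.2 hs).2
            right_inv' := fun y hy => by
              rw [hinv y hy]
              exact (hgf y hy).2.2
            open_source := hU.preimage continuous_subtype_val
            open_target := hW
            continuousOn_toFun := hf.comp continuous_subtype_val.continuousOn fun _ hs => hs
            continuousOn_invFun := by
              rw [Topology.IsInducing.subtypeVal.continuousOn_iff]
              exact hg.continuousOn.congr fun y hy => hinv y hy }, rfl, rfl, fun _ => rfl, hinv⟩

theorem FinitelyAffineOn.of_eq_or_eq {E F : Type*} [NormedAddCommGroup E] [NormedSpace ℝ E]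
    [NormedAddCommGroup F] [NormedSpace ℝ F] {f g h : E → F} {s : Set E}
    (hf : FinitelyAffineOn f s) (hg : FinitelyAffineOn g s) (hh : ∀ x, h x = f x ∨ h x = g x) :
    FinitelyAffineOn h s := by
  obtain ⟨T, hT, hf⟩ := hf
  obtain ⟨T', hT', hg⟩ := hg
  refine ⟨T ∪ T', hT.union hT', fun x hx => ?_⟩
  obtain ⟨A, hA, hAx⟩ := hf x hx
  obtain ⟨B, hB, hBx⟩ := hg x hx
  rcases hh x with h | h
  · exact ⟨A, Or.inl hA, h.trans hAx⟩
  · exact ⟨B, Or.inr hB, h.trans hBx⟩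

theorem isOpen_openDisc : IsOpen openDisc := isOpen_lt (by fun_prop) continuous_const

theorem sum_abs_octSphere (x : octSphere) : |x.1 0| + |x.1 1| + |x.1 2| + |x.1 3| = 1 := by
  rw [← Fin.sum_univ_four (fun i => |x.1 i|)]
  exact x.2

/-- The `2`-disc which is the spine of the cyclic spherical orbifolds: the cone from a point of the
singular circle `x₀ = x₁ = 0` over the circle `x₂ = x₃ = 0`. -/
def octDisc : Set octSphere := {x | x.1 3 = 0 ∧ 0 ≤ x.1 2}

/-- The coordinate `t` on the complement of the ray `x₃ = 0, 0 ≤ x₂` in the plane: a PL angle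
scaled by the distance from the origin. -/
def slitCoord (a b : ℝ) : ℝ := if 0 ≤ b then b / 2 + max a 0 else b / 2 - max a 0

theorem continuousAt_slitCoord {q : ℝ × ℝ} (hq : ¬ (q.2 = 0 ∧ 0 ≤ q.1)) :
    ContinuousAt (fun q : ℝ × ℝ => slitCoord q.1 q.2) q := by
  rcases lt_trichotomy q.2 0 with h | h | h
  · have : ContinuousAt (fun q : ℝ × ℝ => q.2 / 2 - max q.1 0) q := by fun_prop
    refine this.congr ?_
    filter_upwards [continuous_snd.continuousAt.eventually (gt_mem_nhds h)] with r hr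
    rw [slitCoord, if_neg (not_le.2 hr)]
  · have h1 : q.1 < 0 := not_le.1 fun h1 => hq ⟨h, h1⟩
    have : ContinuousAt (fun q : ℝ × ℝ => q.2 / 2) q := by fun_prop
    refine this.congr ?_
    filter_upwards [continuous_fst.continuousAt.eventually (gt_mem_nhds h1)] with r hr
    rw [slitCoord, max_eq_right hr.le, add_zero, sub_zero, ite_self]
  · have : ContinuousAt (fun q : ℝ × ℝ => q.2 / 2 + max q.1 0) q := by fun_prop
    refine this.congr ?_
    filter_upwards [continuous_snd.continuousAt.eventually (lt_mem_nhds h)] with r hr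
    rw [slitCoord, if_pos (le_of_lt hr)]

theorem slitCoord_left_inv {a b : ℝ} (h : ¬ (b = 0 ∧ 0 ≤ a)) :
    |slitCoord a b| < |a| + |b| ∧ 2 * |slitCoord a b| - (|a| + |b|) = a ∧
      |2 * slitCoord a b + (|a| + |b|)| - |2 * slitCoord a b - (|a| + |b|)| -
        2 * slitCoord a b = b := by
  unfold slitCoord
  rcases le_or_gt 0 b with hb | hb
  · rw [if_pos hb]
    rcases le_or_gt a 0 with ha | ha
    · have hpos : 0 < b - a := by
        rcases ha.eq_or_lt with rfl | ha
        · have : 0 < b := lt_of_le_of_ne hb fun h' => h ⟨h'.symm, le_rfl⟩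
          linarith
        · linarith
      rw [max_eq_right ha, abs_of_nonpos ha, abs_of_nonneg hb, add_zero, abs_of_nonneg (by linarith),
        abs_of_nonneg (show 0 ≤ 2 * (b / 2) + (-a + b) by linarith),
        abs_of_nonpos (show 2 * (b / 2) - (-a + b) ≤ 0 by linarith)]
      refine ⟨?_, ?_, ?_⟩ <;> linarith
    · have hb' : 0 < b := lt_of_le_of_ne hb fun h' => h ⟨h'.symm, ha.le⟩
      rw [max_eq_left ha.le, abs_of_pos ha, abs_of_nonneg hb,
        abs_of_nonneg (show 0 ≤ b / 2 + a by linarith),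
        abs_of_nonneg (show 0 ≤ 2 * (b / 2 + a) + (a + b) by linarith),
        abs_of_nonneg (show 0 ≤ 2 * (b / 2 + a) - (a + b) by linarith)]
      refine ⟨?_, ?_, ?_⟩ <;> linarith
  · rw [if_neg (not_le.2 hb)]
    rcases le_or_gt a 0 with ha | ha
    · rw [max_eq_right ha, abs_of_nonpos ha, abs_of_neg hb, sub_zero, abs_of_neg (by linarith),
        abs_of_nonneg (show 0 ≤ 2 * (b / 2) + (-a + -b) by linarith),
        abs_of_nonpos (show 2 * (b / 2) - (-a + -b) ≤ 0 by linarith)]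
      refine ⟨?_, ?_, ?_⟩ <;> linarith
    · rw [max_eq_left ha.le, abs_of_pos ha, abs_of_neg hb,
        abs_of_neg (show b / 2 - a < 0 by linarith),
        abs_of_nonpos (show 2 * (b / 2 - a) + (a + -b) ≤ 0 by linarith),
        abs_of_nonpos (show 2 * (b / 2 - a) - (a + -b) ≤ 0 by linarith)]
      refine ⟨?_, ?_, ?_⟩ <;> linarith

theorem slitCoord_right_inv {t ρ : ℝ} (h : |t| < ρ) :
    |2 * |t| - ρ| + |(|2 * t + ρ| - |2 * t - ρ| - 2 * t)| = ρ ∧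
      ¬ (|2 * t + ρ| - |2 * t - ρ| - 2 * t = 0 ∧ 0 ≤ 2 * |t| - ρ) ∧
      slitCoord (2 * |t| - ρ) (|2 * t + ρ| - |2 * t - ρ| - 2 * t) = t := by
  obtain ⟨h1, h2⟩ := abs_lt.1 h
  rcases le_or_gt 0 t with ht | ht
  · rw [abs_of_nonneg ht, abs_of_nonneg (show 0 ≤ 2 * t + ρ by linarith)]
    rcases le_or_gt (2 * t) ρ with h3 | h3
    · rw [abs_of_nonpos (show 2 * t - ρ ≤ 0 by linarith),
        show 2 * t + ρ - -(2 * t - ρ) - 2 * t = 2 * t by ring, abs_of_nonneg (by linarith)]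
      refine ⟨by ring, fun h => by linarith [h.1, h.2], ?_⟩
      rw [slitCoord, if_pos (by linarith), max_eq_right (by linarith)]
      ring
    · rw [abs_of_pos (show 0 < 2 * t - ρ by linarith),
        show 2 * t + ρ - (2 * t - ρ) - 2 * t = 2 * (ρ - t) by ring, abs_of_nonneg (by linarith)]
      refine ⟨by ring, fun h => by linarith [h.1, h.2], ?_⟩
      rw [slitCoord, if_pos (by linarith), max_eq_left (by linarith)]
      ring
  · rw [abs_of_neg ht, abs_of_nonpos (show 2 * t - ρ ≤ 0 by linarith)]
    rcases le_or_gt (-(2 * t)) ρ with h3 | h3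
    · rw [abs_of_nonneg (show 0 ≤ 2 * t + ρ by linarith),
        show 2 * t + ρ - -(2 * t - ρ) - 2 * t = 2 * t by ring,
        abs_of_nonpos (show 2 * -t - ρ ≤ 0 by linarith), abs_of_nonpos (by linarith)]
      refine ⟨by ring, fun h => by linarith [h.1, h.2], ?_⟩
      rw [slitCoord, if_neg (by linarith), max_eq_right (by linarith)]
      ring
    · rw [abs_of_neg (show 2 * t + ρ < 0 by linarith),
        show -(2 * t + ρ) - -(2 * t - ρ) - 2 * t = -(2 * (ρ + t)) by ring,
        abs_of_nonneg (show 0 ≤ 2 * -t - ρ by linarith), abs_of_nonpos (by linarith)]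
      refine ⟨by ring, fun h => by linarith [h.1, h.2], ?_⟩
      rw [slitCoord, if_neg (by linarith), max_eq_left (by linarith)]
      ring

/-- The complement of the disc is an open `3`-disc. -/
theorem exists_octDisc_compl_chart :
    ∃ e ∈ polyhedralAtlas (id : octSphere → octSphere), e.source = octDiscᶜ ∧
      e.target = openDisc ∧ ∀ s, e s 0 = s.1 0 ∧ e s 1 = s.1 1 := by
  let f : (Fin 4 → ℝ) → V3 := fun x => ![x 0, x 1, slitCoord (x 2) (x 3)]
  let ρ : V3 → ℝ := fun y => 1 - (|y 0| + |y 1|)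
  let g : V3 → Fin 4 → ℝ := fun y => ![y 0, y 1, 2 * |y 2| - ρ y,
    |2 * y 2 + ρ y| - |2 * y 2 - ρ y| - 2 * y 2]
  let U : Set (Fin 4 → ℝ) := {x | ¬ (x 3 = 0 ∧ 0 ≤ x 2)}
  have hU : IsOpen U :=
    ((isClosed_eq (continuous_apply 3) continuous_const).inter
      (isClosed_le continuous_const (continuous_apply 2))).isOpen_compl
  have hdisc : ∀ y : V3, y ∈ openDisc ↔ |y 2| < ρ y := fun y => by
    simp only [openDisc, mem_ofPred_eq, Fin.sum_univ_three, ρ]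
    constructor <;> intro h <;> linarith
  obtain ⟨e, hes, het, hef, heg⟩ := exists_openPartialHomeomorph_of_continuousOn (S := octSphere)
    f g U openDisc hU isOpen_openDisc
    (by
      intro x hx
      apply ContinuousAt.continuousWithinAt
      refine continuousAt_pi.2 fun i => ?_
      fin_cases i
      · exact (continuous_apply 0).continuousAt
      · exact (continuous_apply 1).continuousAt
      · exact (continuousAt_slitCoord (q := (x 2, x 3)) hx).comp
          (f := fun x : Fin 4 → ℝ => (x 2, x 3)) (by fun_prop))
    (by
      refine continuous_pi fun i => ?_
      fin_cases i <;> simp [g, ρ] <;> fun_prop)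
    (by
      intro s hs hsU
      have hs' : |s 0| + |s 1| + |s 2| + |s 3| = 1 := sum_abs_octSphere ⟨s, hs⟩
      have hρ : ρ (f s) = |s 2| + |s 3| := by
        change 1 - (|s 0| + |s 1|) = _
        linarith
      obtain ⟨h1, h2, h3⟩ := slitCoord_left_inv hsU
      refine ⟨?_, ?_⟩
      · rw [hdisc, hρ]
        exact h1
      · ext i
        fin_cases i
        · rfl
        · rfl
        · change 2 * |slitCoord (s 2) (s 3)| - ρ (f s) = s 2
          rw [hρ, h2]
        · change |2 * slitCoord (s 2) (s 3) + ρ (f s)| - |2 * slitCoord (s 2) (s 3) - ρ (f s)| -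
            2 * slitCoord (s 2) (s 3) = s 3
          rw [hρ, h3])
    (by
      intro y hy
      rw [hdisc] at hy
      obtain ⟨h1, h2, h3⟩ := slitCoord_right_inv hy
      refine ⟨?_, h2, ?_⟩
      · change ∑ i, |g y i| = 1
        rw [Fin.sum_univ_four]
        change |y 0| + |y 1| + |2 * |y 2| - ρ y| +
          |(|2 * y 2 + ρ y| - |2 * y 2 - ρ y| - 2 * y 2)| = 1
        have : ρ y = 1 - (|y 0| + |y 1|) := rfl
        linarith
      · ext i
        fin_cases i
        exacts [rfl, rfl, h3])
    octSphere_nonempty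
  refine ⟨e, ⟨?_, ?_⟩, ?_, het, fun s => by rw [hef]; exact ⟨rfl, rfl⟩⟩
  · have hc : ∀ i, FinitelyAffineOn (fun x : Fin 4 → ℝ => x i) univ := fun i =>
      finitelyAffineOn_coord i univ
    have h3 := ((hc 3).const_mul (1 / 2)).congr (g := fun x => x 3 / 2) fun x _ => by ring
    have hm := (hc 2).max (FinitelyAffineOn.const 0 univ)
    have hs := FinitelyAffineOn.of_eq_or_eq (h := fun x : Fin 4 → ℝ => slitCoord (x 2) (x 3))
      (h3.add hm) (h3.sub hm) fun x => by unfold slitCoord; exact ite_eq_or_eq _ _ _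
    obtain ⟨T, hT, h⟩ := finitelyAffineOn_vec3 (hc 0) (hc 1) hs
    exact ⟨T, hT, fun s _ => by rw [hef]; exact h s (mem_univ _)⟩
  · have hc : ∀ i, FinitelyAffineOn (fun y : V3 => y i) univ := fun i =>
      finitelyAffineOn_coord i univ
    have hρ : FinitelyAffineOn ρ univ :=
      (FinitelyAffineOn.const 1 univ).sub ((hc 0).abs.add (hc 1).abs)
    have h2 := (hc 2).const_mul 2
    have hg : FinitelyAffineOn g univ := by
      apply FinitelyAffineOn.pi
      intro i
      fin_cases i
      · exact hc 0
      · exact hc 1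
      · exact ((hc 2).abs.const_mul 2).sub hρ
      · exact ((h2.add hρ).abs.sub (h2.sub hρ).abs).sub h2
    obtain ⟨T, hT, h⟩ := hg
    refine ⟨T, hT, fun y hy => ?_⟩
    rw [het] at hy
    obtain ⟨A, hA, hAy⟩ := h y (mem_univ _)
    exact ⟨A, hA, e.symm y, by rw [heg y hy, hAy], rfl⟩
  · rw [hes]
    rfl

theorem mem_charts_mirror {l : V3 → ℕ} (hl : IsDiscalLabel l)
    {e : OpenPartialHomeomorph octSphere V3}
    (he : e ∈ polyhedralAtlas (id : octSphere → octSphere)) : e ∈ (mirror l hl).charts :=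
  plGroupoid.subset_maximalAtlas (M := octSphere) he

theorem modeledAt_mirror {l : V3 → ℕ} (hl : IsDiscalLabel l)
    {e : OpenPartialHomeomorph octSphere V3}
    (he : e ∈ polyhedralAtlas (id : octSphere → octSphere)) {P : Set octSphere} {x : octSphere}
    (hx : x ∈ e.source) {M : Set V3} (h : ∀ᶠ y in 𝓝 x, (y ∈ P ↔ e y - e x ∈ M)) :
    (mirror l hl).ModeledAt P x M := by
  have h0 : PLAut.translate (e x) (e x) = 0 := by rw [PLAut.translate_apply, sub_self]
  have h' : ∀ᶠ y in 𝓝 x, (y ∈ P ↔ PLAut.translate (e x) (e y) ∈ M) :=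
    h.mono fun y hy => by rwa [PLAut.translate_apply]
  exact ClosedOrbifold.modeledAt_of_plAut (X := mirror l hl) (mem_charts_mirror hl he) hx _ h0 h'

theorem modeledAt_octDisc {l : V3 → ℕ} (hl : IsDiscalLabel l) (x : octSphere) (hx : x ∈ octDisc) :
    (mirror l hl).ModeledAt octDisc x planeModel ∨ (mirror l hl).ModeledAt octDisc x halfModel ∨
      (mirror l hl).ModeledAt octDisc x bookModel := by
  obtain ⟨h3, h2⟩ := hx
  rcases h2.eq_or_lt with h2 | h2
  · right; left
    obtain ⟨i, ε, hε, hi⟩ := exists_octSphere_hemisphere x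
    obtain ⟨e, he, hes, -, hef⟩ := exists_octSphere_chart i ε hε
    have hef' : ∀ s j, e s j = s.1 (i.succAbove j) := fun s j => by rw [hef]
    refine modeledAt_mirror hl he (by rw [hes]; exact hi) (Eventually.of_forall fun y => ?_)
    have key : i.succAbove 2 = 3 ∧ i.succAbove 1 = 2 := by
      fin_cases i
      · decide
      · decide
      · simp [← h2] at hi
      · simp [h3] at hi
    change (y.1 3 = 0 ∧ 0 ≤ y.1 2) ↔ e y 2 - e x 2 = 0 ∧ 0 ≤ e y 1 - e x 1
    rw [hef', hef', hef', hef', key.1, key.2, h3, ← h2, sub_zero, sub_zero]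
  · left
    obtain ⟨e, he, hes, -, hef⟩ := exists_octSphere_chart 2 1 (Or.inl rfl)
    have hef' : ∀ s j, e s j = s.1 ((2 : Fin 4).succAbove j) := fun s j => by rw [hef]
    have hxe : x ∈ e.source := by rw [hes]; simpa using h2
    refine modeledAt_mirror hl he hxe ?_
    filter_upwards [e.open_source.mem_nhds hxe] with y hy
    rw [hes] at hy
    have hy2 : 0 < y.1 2 := by simpa using hy
    change (y.1 3 = 0 ∧ 0 ≤ y.1 2) ↔ e y 2 - e x 2 = 0
    rw [hef', hef', show (2 : Fin 4).succAbove 2 = 3 by decide, h3, sub_zero]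
    exact and_iff_left hy2.le

theorem isSpine_octDisc {p : ℕ} (hp : 1 ≤ p) : (sphereCyclic p hp).IsSpine octDisc := by
  have hl := isDiscalLabel_cyclicLabel hp
  have hc : IsClosed octDisc :=
    (isClosed_eq ((continuous_apply 3).comp continuous_subtype_val) continuous_const).inter
      (isClosed_le continuous_const ((continuous_apply 2).comp continuous_subtype_val))
  refine ⟨ClosedOrbifold.isSimple_of_modeledAt hc.isCompact (modeledAt_octDisc hl), ?_, ?_⟩
  · rintro (x : octSphere) ⟨⟨h3, h2⟩, hx⟩
    replace hx : cyclicLabel p (fun i => x.1 i.castSucc) ≠ 1 := hx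
    unfold cyclicLabel at hx
    split_ifs at hx with h01
    swap
    · exact absurd rfl hx
    obtain ⟨h0, h1⟩ : x.1 0 = 0 ∧ x.1 1 = 0 := h01
    have h2' : 0 < x.1 2 := by
      have := sum_abs_octSphere x
      rw [h0, h1, h3, abs_zero, zero_add, zero_add, add_zero, abs_of_nonneg h2] at this
      linarith
    obtain ⟨e, he, hes, -, hef⟩ := exists_octSphere_chart 2 1 (Or.inl rfl)
    have hxe : x ∈ e.source := by rw [hes]; simpa using h2'
    have hx0 : e x = 0 := by
      rw [hef]
      ext j
      fin_cases j
      exacts [h0, h1, h3]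
    refine ⟨e, mem_charts_mirror hl he, hxe, hx0, p, by omega, ?_⟩
    have hev : ∀ᶠ y : octSphere in 𝓝 x, (y ∈ octDisc ↔ e y 2 = 0) ∧
        cyclicLabel p (fun i => y.1 i.castSucc) = cyclicLabel p (e y) := by
      filter_upwards [e.open_source.mem_nhds hxe] with y hy
      rw [hes] at hy
      have hy2 : 0 < y.1 2 := by simpa using hy
      rw [hef]
      exact ⟨and_iff_left hy2.le, rfl⟩
    exact hev
  · intro x hx
    obtain ⟨e, he, hes, het, hef⟩ := exists_octDisc_compl_chart
    refine ⟨e, mem_charts_mirror hl he, ?_, het, _, hl, fun y _ => ?_⟩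
    · refine ClosedOrbifold.component_eq_source (X := sphereCyclic p hp) het (hes ▸ hx) hes.subset ?_
      have hopen : IsOpen (octDiscᶜ \ e.source : Set octSphere) := by
        rw [hes, Set.sdiff_self]
        exact isOpen_empty
      exact hopen
    · change cyclicLabel p (fun i => y.1 i.castSucc) = cyclicLabel p (e y)
      unfold cyclicLabel
      rw [(hef y).1, (hef y).2]
      rfl

theorem isConnected_compl_zero : IsConnected ({0}ᶜ : Set ℂ) :=
  isConnected_compl_singleton_of_one_lt_rank (by rw [Complex.rank_real_complex]; norm_num) 0

/-- The circle `x₀ = x₁ = 0`. -/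
theorem isConnected_octCircle : IsConnected {x : octSphere | x.1 0 = 0 ∧ x.1 1 = 0} := by
  let N : ℂ → ℝ := fun z => |z.re| + |z.im|
  have hN : ∀ z : ({0}ᶜ : Set ℂ), N z ≠ 0 := fun z hz => z.2 (by
    have h1 := abs_nonneg z.1.re
    have h2 := abs_nonneg z.1.im
    exact Complex.ext (abs_eq_zero.1 (show |z.1.re| = 0 by simp only [N] at hz; linarith))
      (abs_eq_zero.1 (show |z.1.im| = 0 by simp only [N] at hz; linarith)))
  have hN0 : ∀ z, 0 ≤ N z := fun z => by positivity
  let f : ({0}ᶜ : Set ℂ) → octSphere := fun z =>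
    ⟨![0, 0, z.1.re / N z, z.1.im / N z], by
      change ∑ i, |(_ : Fin 4 → ℝ) i| = 1
      rw [Fin.sum_univ_four]
      simp only [Matrix.cons_val_zero, Matrix.cons_val_one, Matrix.cons_val, abs_zero, zero_add,
        abs_div, abs_of_nonneg (hN0 z)]
      rw [← add_div]
      exact div_self (hN z)⟩
  have hNc : Continuous fun z : ({0}ᶜ : Set ℂ) => N z := by
    have : Continuous N := by fun_prop
    exact this.comp continuous_subtype_val
  have hre : Continuous fun z : ({0}ᶜ : Set ℂ) => z.1.re :=
    Complex.continuous_re.comp continuous_subtype_val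
  have him : Continuous fun z : ({0}ᶜ : Set ℂ) => z.1.im :=
    Complex.continuous_im.comp continuous_subtype_val
  have hf : Continuous f := by
    refine Continuous.subtype_mk (continuous_pi fun i => ?_) _
    fin_cases i
    exacts [continuous_const, continuous_const, hre.div hNc hN, him.div hNc hN]
  have := isConnected_iff_connectedSpace.1 isConnected_compl_zero
  convert isConnected_range hf using 1
  ext x
  constructor
  · rintro ⟨h0, h1⟩
    have hs := sum_abs_octSphere x
    rw [h0, h1, abs_zero, zero_add, zero_add] at hs
    have hz : (⟨x.1 2, x.1 3⟩ : ℂ) ≠ 0 := by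
      intro h
      rw [show x.1 2 = 0 from congrArg Complex.re h, show x.1 3 = 0 from congrArg Complex.im h,
        abs_zero, add_zero] at hs
      exact zero_ne_one hs
    refine ⟨⟨⟨x.1 2, x.1 3⟩, hz⟩, Subtype.ext ?_⟩
    ext i
    fin_cases i
    · exact h0.symm
    · exact h1.symm
    · change x.1 2 / (|x.1 2| + |x.1 3|) = x.1 2
      rw [hs, div_one]
    · change x.1 3 / (|x.1 2| + |x.1 3|) = x.1 3
      rw [hs, div_one]
  · rintro ⟨z, rfl⟩
    exact ⟨rfl, rfl⟩

theorem sphereCyclic_complexity {p : ℕ} (hp : 1 ≤ p) :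
    (sphereCyclic p hp).complexity = ((p - 1 : ℕ) : ℕ∞) ∧
      ∀ P, (sphereCyclic p hp).IsMinimalSpine P → ¬ (sphereCyclic p hp).IsSpecial P := by
  let x : octSphere := ⟨![0, 0, 1, 0], by
    change ∑ i, |(_ : Fin 4 → ℝ) i| = 1
    simp [Fin.sum_univ_four]⟩
  have hlab : ∀ y : octSphere, (sphereCyclic p hp).label y ≠ 1 →
      (y.1 0 = 0 ∧ y.1 1 = 0) ∧ (sphereCyclic p hp).label y = p := by
    intro y hy
    change cyclicLabel p (fun i => y.1 i.castSucc) ≠ 1 at hy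
    change _ ∧ cyclicLabel p (fun i => y.1 i.castSucc) = p
    unfold cyclicLabel at hy ⊢
    split_ifs at hy ⊢ with h
    · exact ⟨h, rfl⟩
    · exact absurd rfl hy
  refine ClosedOrbifold.complexity_eq_of_connected (X := sphereCyclic p hp) x
    (fun y hy => (hlab y hy).2) (fun hp2 => ?_) (isSpine_octDisc hp)
    (ClosedOrbifold.vertices_eq_empty_of_modeledAt
      (modeledAt_octDisc (isDiscalLabel_cyclicLabel hp))) ?_ (if_pos ⟨rfl, rfl⟩)
  · have hS : (sphereCyclic p hp).singularSet = {x : octSphere | x.1 0 = 0 ∧ x.1 1 = 0} := by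
      refine Set.ext fun (y : octSphere) => ⟨fun hy => (hlab y hy).1, fun hy => ?_⟩
      have hy' : cyclicLabel p (fun i => y.1 i.castSucc) = p := if_pos hy
      change cyclicLabel p (fun i => y.1 i.castSucc) ≠ 1
      omega
    rw [hS]
    refine ⟨IsClosed.isCompact ?_, isConnected_octCircle⟩
    exact (isClosed_eq ((continuous_apply 0).comp continuous_subtype_val) continuous_const).inter
      (isClosed_eq ((continuous_apply 1).comp continuous_subtype_val) continuous_const)
  · rintro (y : octSphere) ⟨⟨h3, h2⟩, hy⟩
    obtain ⟨h0, h1⟩ := (hlab y hy).1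
    have hs := sum_abs_octSphere y
    rw [h0, h1, h3, abs_zero, zero_add, zero_add, add_zero, abs_of_nonneg h2] at hs
    apply Subtype.ext
    ext i
    fin_cases i
    exacts [h0, h1, hs, h3]

/-- The equatorial `2`-sphere, which is the spine of the vertex spherical orbifolds. -/
def equator : Set octSphere := {x | x.1 3 = 0}

theorem modeledAt_equator {l : V3 → ℕ} (hl : IsDiscalLabel l) (x : octSphere) (hx : x ∈ equator) :
    (mirror l hl).ModeledAt equator x planeModel := by
  have h3 : x.1 3 = 0 := hx
  obtain ⟨i, ε, hε, hi⟩ := exists_octSphere_hemisphere x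
  obtain ⟨e, he, hes, -, hef⟩ := exists_octSphere_chart i ε hε
  have hef' : ∀ s j, e s j = s.1 (i.succAbove j) := fun s j => by rw [hef]
  refine modeledAt_mirror hl he (by rw [hes]; exact hi) (Eventually.of_forall fun y => ?_)
  have key : i.succAbove 2 = 3 := by
    fin_cases i
    · decide
    · decide
    · decide
    · simp [h3] at hi
  change y.1 3 = 0 ↔ e y 2 - e x 2 = 0
  rw [hef', hef', key, h3, sub_zero]

/-- The point of the `i`-th edge of the singular set on the equator. -/
def axisPoint (i : Fin 3) : octSphere :=
  ⟨Pi.single i.castSucc 1, by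
    change ∑ j, |(Pi.single i.castSucc (1 : ℝ) : Fin 4 → ℝ) j| = 1
    fin_cases i <;> simp [Fin.sum_univ_four, Pi.single_apply]⟩

theorem eq_axisPoint {x : octSphere} {i : Fin 3} (h3 : x.1 3 = 0) (h0 : 0 ≤ x.1 i.castSucc)
    (h : ∀ j, j ≠ i → x.1 j.castSucc = 0) : x = axisPoint i := by
  have hs : ∑ j, |x.1 j| = 1 := x.2
  rw [Fin.sum_univ_castSucc, show Fin.last 3 = 3 from rfl, h3, abs_zero, add_zero,
    Finset.sum_eq_single i (fun j _ hj => by rw [h j hj, abs_zero]) (by simp),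
    abs_of_nonneg h0] at hs
  apply Subtype.ext
  ext j
  induction j using Fin.lastCases with
  | last =>
    change x.1 3 = (Pi.single i.castSucc (1 : ℝ) : Fin 4 → ℝ) (Fin.last 3)
    rw [Pi.single_eq_of_ne (Fin.castSucc_lt_last i).ne', h3]
  | cast j =>
    change x.1 j.castSucc = (Pi.single i.castSucc (1 : ℝ) : Fin 4 → ℝ) j.castSucc
    by_cases hj : j = i
    · rw [hj, Pi.single_eq_same, hs]
    · rw [h j hj, Pi.single_eq_of_ne (fun h' => hj (Fin.castSucc_injective _ h'))]

theorem vertexLabel_of_pos {p q r : ℕ} {y : V3} {i : Fin 3} (hi : 0 < y i) :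
    vertexLabel p q r y = cyclicLabel ((![p, q, r] : Fin 3 → ℕ) i)
      ![y (i.succAbove 0), y (i.succAbove 1), 0] := by
  have h0 : y ≠ 0 := by rintro rfl; simp at hi
  fin_cases i
  · have : 0 < y 0 := hi
    simp [vertexLabel, cyclicLabel, h0, this, this.ne']
    congr
  · have : 0 < y 1 := hi
    simp [vertexLabel, cyclicLabel, h0, this, this.ne', Fin.succAbove]
  · have : 0 < y 2 := hi
    simp [vertexLabel, cyclicLabel, h0, this, this.ne', Fin.succAbove]

theorem exists_axisPoint_of_label_ne {p q r : ℕ} {x : octSphere} (hx : x ∈ equator)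
    (hl : vertexLabel p q r (fun i => x.1 i.castSucc) ≠ 1) : ∃ i, x = axisPoint i := by
  unfold vertexLabel at hl
  split_ifs at hl with h h h h
  · have hs : ∑ j, |x.1 j| = 1 := x.2
    rw [Fin.sum_univ_castSucc, show Fin.last 3 = 3 from rfl, show x.1 3 = 0 from hx, abs_zero,
      add_zero, Finset.sum_eq_zero fun j _ => by rw [congrFun h j, Pi.zero_apply, abs_zero]] at hs
    exact absurd hs zero_ne_one
  · exact ⟨0, eq_axisPoint hx h.1.le fun j hj => by fin_cases j <;> simp_all⟩
  · exact ⟨1, eq_axisPoint hx h.1.le fun j hj => by fin_cases j <;> simp_all⟩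
  · exact ⟨2, eq_axisPoint hx h.1.le fun j hj => by fin_cases j <;> simp_all⟩
  · exact absurd rfl hl

theorem label_axisPoint {p q r : ℕ} (h : Admissible p q r) (i : Fin 3) :
    (sphereVertex p q r h).label (axisPoint i) = (![p, q, r] : Fin 3 → ℕ) i := by
  change vertexLabel p q r (fun j => (axisPoint i).1 j.castSucc) = _
  rw [vertexLabel_of_pos (i := i) (by simp [axisPoint]), cyclicLabel, if_pos]
  constructor
  · change (Pi.single i.castSucc (1 : ℝ) : Fin 4 → ℝ) (i.succAbove 0).castSucc = 0
    exact Pi.single_eq_of_ne (fun h => Fin.succAbove_ne i 0 (Fin.castSucc_injective _ h)) _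
  · change (Pi.single i.castSucc (1 : ℝ) : Fin 4 → ℝ) (i.succAbove 1).castSucc = 0
    exact Pi.single_eq_of_ne (fun h => Fin.succAbove_ne i 1 (Fin.castSucc_injective _ h)) _

theorem Admissible.two_le {p q r : ℕ} (h : Admissible p q r) (i : Fin 3) :
    2 ≤ (![p, q, r] : Fin 3 → ℕ) i := by
  have key : ∀ x ∈ ({p, q, r} : Multiset ℕ), 2 ≤ x := by
    rcases h with ⟨n, hn, h⟩ | ⟨n, hn, -, h⟩ <;> rw [h] <;> intro x hx <;>
      simp only [Multiset.insert_eq_cons, Multiset.mem_cons, Multiset.mem_singleton] at hx <;>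
      omega
  fin_cases i
  exacts [key p (by simp), key q (by simp), key r (by simp)]

theorem isSpine_equator {p q r : ℕ} (h : Admissible p q r) :
    (sphereVertex p q r h).IsSpine equator := by
  have hl := IsDiscalLabel.vertex p q r h
  have hc : Continuous fun x : octSphere => x.1 3 :=
    (continuous_apply 3).comp continuous_subtype_val
  refine ⟨ClosedOrbifold.isSimple_of_modeledAt (isClosed_eq hc continuous_const).isCompact
    fun x hx => Or.inl (modeledAt_equator hl x hx), ?_, ?_⟩
  · rintro (x : octSphere) ⟨hx, hxl⟩
    obtain ⟨i, rfl⟩ := exists_axisPoint_of_label_ne hx hxl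
    obtain ⟨e, he, hes, -, hef⟩ := exists_octSphere_chart i.castSucc 1 (Or.inl rfl)
    have hxe : axisPoint i ∈ e.source := by rw [hes]; simp [axisPoint]
    have h2 : i.castSucc.succAbove 2 = 3 := by fin_cases i <;> decide
    have hx0 : e (axisPoint i) = 0 := by
      rw [hef]
      ext j
      exact Pi.single_eq_of_ne (Fin.succAbove_ne _ j) _
    refine ⟨e, mem_charts_mirror hl he, hxe, hx0, _, h.two_le i, ?_⟩
    · have hev : ∀ᶠ y : octSphere in 𝓝 (axisPoint i), (y ∈ equator ↔ e y 2 = 0) ∧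
          vertexLabel p q r (fun i => y.1 i.castSucc) =
            cyclicLabel ((![p, q, r] : Fin 3 → ℕ) i) (e y) := by
        filter_upwards [e.open_source.mem_nhds hxe] with y hy
        rw [hes] at hy
        have hyi : 0 < y.1 i.castSucc := by simpa using hy
        refine ⟨?_, ?_⟩
        · have : e y 2 = y.1 3 := by rw [hef, ← h2]
          rw [this]
          rfl
        · rw [vertexLabel_of_pos (i := i) hyi, hef]
          have e0 : i.castSucc.succAbove 0 = (i.succAbove 0).castSucc := by
            fin_cases i <;> decide
          have e1 : i.castSucc.succAbove 1 = (i.succAbove 1).castSucc := by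
            fin_cases i <;> decide
          simp only [cyclicLabel, Matrix.cons_val_zero, Matrix.cons_val_one, e0, e1]
          congr
      exact hev
  · intro (x : octSphere) hx
    have hx3 : x.1 3 ≠ 0 := hx
    obtain ⟨ε, hε, hεx⟩ : ∃ ε : ℝ, (ε = 1 ∨ ε = -1) ∧ 0 < ε * x.1 3 := by
      rcases lt_or_gt_of_ne hx3 with h | h
      · exact ⟨-1, Or.inr rfl, by linarith⟩
      · exact ⟨1, Or.inl rfl, by linarith⟩
    obtain ⟨e, he, hes, het, hef⟩ := exists_octSphere_chart 3 ε hε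
    refine ⟨e, mem_charts_mirror hl he, ?_, het, _, hl, fun y _ => ?_⟩
    · refine ClosedOrbifold.component_eq_source (X := sphereVertex p q r h) het
        (by rw [hes]; exact hεx) ?_ ?_
      · rw [hes]
        intro y hy hy3
        have h1 : 0 < ε * y.1 3 := hy
        rw [show y.1 3 = 0 from hy3, mul_zero] at h1
        exact lt_irrefl _ h1
      · have : (equatorᶜ \ e.source : Set octSphere) = {y | ε * y.1 3 < 0} := by
          rw [hes]
          ext y
          simp only [equator, Set.mem_sdiff, mem_compl_iff, mem_ofPred_eq, not_lt]
          constructor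
          · rintro ⟨h1, h2⟩
            refine lt_of_le_of_ne h2 (mul_ne_zero ?_ h1)
            rcases hε with rfl | rfl <;> norm_num
          · intro h
            refine ⟨fun h' => ?_, h.le⟩
            rw [h', mul_zero] at h
            exact lt_irrefl _ h
        have hopen : IsOpen (equatorᶜ \ e.source : Set octSphere) := by
          rw [this]
          exact isOpen_lt (continuous_const.mul hc) continuous_const
        exact hopen
    · have hey : ∀ y : octSphere, e y = fun i => y.1 i.castSucc := fun y => by
        rw [hef, show (3 : Fin 4) = Fin.last 3 from rfl, Fin.succAbove_last]
      exact congrArg (vertexLabel p q r) (hey y).symm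

/-- Each spine meets each of the three edges of the singular set, which join the two vertices. -/
theorem IsSpine.exists_mem_edge {p q r : ℕ} (h : Admissible p q r) {P : Set octSphere}
    (hP : (sphereVertex p q r h).IsSpine P) (i : Fin 3) :
    ∃ x ∈ P, 0 < x.1 i.castSucc ∧ ∀ j, j ≠ i → x.1 j.castSucc = 0 := by
  let γ : ℝ → Fin 4 → ℝ := fun s => Pi.single i.castSucc (1 - |s|) + Pi.single 3 s
  have hγ : Continuous γ := by
    refine Continuous.add ?_ ?_
    · exact (continuous_single (A := fun _ : Fin 4 => ℝ) i.castSucc).comp (by fun_prop)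
    · exact continuous_single (A := fun _ : Fin 4 => ℝ) 3
  have hi3 : i.castSucc ≠ 3 := (Fin.castSucc_lt_last i).ne
  have hγi : ∀ s, γ s i.castSucc = 1 - |s| := fun s => by simp [γ, hi3]
  have hγ3 : ∀ s, γ s 3 = s := fun s => by simp [γ, hi3.symm]
  have hγj : ∀ s j, j ≠ i → γ s j.castSucc = 0 := fun s j hj => by
    change (Pi.single i.castSucc (1 - |s|) : Fin 4 → ℝ) j.castSucc +
      (Pi.single (Fin.last 3) s : Fin 4 → ℝ) j.castSucc = 0
    rw [Pi.single_eq_of_ne (fun h' => hj (Fin.castSucc_injective _ h')),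
      Pi.single_eq_of_ne (Fin.castSucc_lt_last j).ne, add_zero]
  have hγS : ∀ s : Icc (-1 : ℝ) 1, γ s ∈ octSphere := fun s => by
    change ∑ j, |γ s j| = 1
    rw [Fin.sum_univ_castSucc, show Fin.last 3 = 3 from rfl, hγ3,
      Finset.sum_eq_single i (fun j _ hj => by rw [hγj _ j hj, abs_zero]) (by simp), hγi,
      abs_of_nonneg (sub_nonneg.2 (abs_le.2 s.2))]
    ring
  let E : Set octSphere := range fun s : Icc (-1 : ℝ) 1 => ⟨γ s, hγS s⟩
  have : PreconnectedSpace (Icc (-1 : ℝ) 1) :=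
    isPreconnected_iff_preconnectedSpace.1 isPreconnected_Icc
  have hE : IsPreconnected E :=
    isPreconnected_range (Continuous.subtype_mk (hγ.comp continuous_subtype_val) _)
  have hlab : ∀ s : Icc (-1 : ℝ) 1, |s.1| = 1 → (sphereVertex p q r h).label ⟨γ s, hγS s⟩ = 0 := by
    intro s hs
    refine if_pos ?_
    ext j
    change γ s j.castSucc = 0
    by_cases hj : j = i
    · rw [hj, hγi, hs, sub_self]
    · exact hγj _ j hj
  obtain ⟨_, hx, s, rfl⟩ := hP.inter_nonempty hE (x := ⟨γ _, hγS ⟨1, by norm_num⟩⟩)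
    (y := ⟨γ _, hγS ⟨-1, by norm_num⟩⟩)
    ⟨_, rfl⟩ ⟨_, rfl⟩ (fun h => by
      have := congrFun (congrArg (fun x : octSphere => x.1) h) 3
      simp only [hγ3] at this
      norm_num at this) (hlab _ (by norm_num)) (hlab _ (by norm_num))
  refine ⟨_, hx, ?_, fun j hj => hγj s j hj⟩
  change 0 < γ s i.castSucc
  rw [hγi, sub_pos]
  refine lt_of_le_of_ne (abs_le.2 s.2) fun hs => ?_
  exact hP.label_ne_zero hx (hlab s hs)

theorem sphereVertex_complexity {p q r : ℕ} (h : Admissible p q r) :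
    (sphereVertex p q r h).complexity = (((p - 1) + (q - 1) + (r - 1) : ℕ) : ℕ∞) ∧
      ∀ P, (sphereVertex p q r h).IsMinimalSpine P → ¬ (sphereVertex p q r h).IsSpecial P := by
  have hsum : ∀ f : Fin 3 → octSphere,
      (∀ i, (sphereVertex p q r h).label (f i) = (![p, q, r] : Fin 3 → ℕ) i) →
      ∑ i, ((sphereVertex p q r h).label (f i) - 1) = (p - 1) + (q - 1) + (r - 1) := by
    intro f hf
    simp only [hf]
    exact Fin.sum_univ_three _
  refine ClosedOrbifold.complexity_eq_of_spine (X := sphereVertex p q r h) (axisPoint 0)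
    (fun P hP => ?_) (isSpine_equator h) ?_
  · choose f hfP hfi hfj using fun i => IsSpine.exists_mem_edge h hP i
    have hlab : ∀ i, (sphereVertex p q r h).label (f i) = (![p, q, r] : Fin 3 → ℕ) i := by
      intro i
      change vertexLabel p q r (fun j => (f i).1 j.castSucc) = _
      rw [vertexLabel_of_pos (i := i) (hfi i), cyclicLabel, if_pos]
      exact ⟨hfj i _ (Fin.succAbove_ne i 0), hfj i _ (Fin.succAbove_ne i 1)⟩
    have := ClosedOrbifold.add_sum_le_spineComplexity (X := sphereVertex p q r h) (P := P) f
      (fun i j hij => by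
        by_contra hne
        have h1 := hfi i
        rw [hij, hfj j i hne] at h1
        exact lt_irrefl _ h1)
      (fun i => ⟨hfP i, by
        change (sphereVertex p q r h).label (f i) ≠ 1
        have := h.two_le i
        rw [hlab]
        omega⟩)
    rwa [hsum f hlab] at this
  · have := ClosedOrbifold.spineComplexity_le (X := sphereVertex p q r h) (P := equator) axisPoint
      (ClosedOrbifold.vertices_eq_empty_of_modeledAt fun x hx =>
        Or.inl (modeledAt_equator (.vertex p q r h) x hx))
      (fun x hx => by
        obtain ⟨i, hi⟩ := exists_axisPoint_of_label_ne hx.1 hx.2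
        exact ⟨i, hi.symm⟩)
    rwa [hsum axisPoint (label_axisPoint h)] at this

/-! ### Charts of the sphere in `ℂ²` and of its quotients -/

section LensChart

variable (n : ℕ) [hn : Fact (n ∣ 6)]

/-- A chart of the sphere on whose domain the quotient map is injective descends to a chart of the
quotient. -/
theorem exists_lens_chart_of_injOn {e : OpenPartialHomeomorph hexSphere V3}
    (he : e ∈ polyhedralAtlas (id : hexSphere → hexSphere)) (hinj : InjOn (lensMk n) e.source) :
    ∃ φ ∈ polyhedralAtlas (lensMk n), φ.source = lensMk n '' e.source ∧ φ.target = e.target ∧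
      ∀ t ∈ e.source, φ (lensMk n t) = e t := by
  obtain ⟨s₀, hs₀⟩ := hexSphere_nonempty
  have : Nonempty hexSphere := ⟨⟨s₀, hs₀⟩⟩
  let L : OpenPartialHomeomorph hexSphere (LensSpace n) :=
    OpenPartialHomeomorph.ofContinuousOpen (hinj.toPartialEquiv (lensMk n) e.source)
      (isLocalHomeomorph_lensMk n).continuous.continuousOn (isLocalHomeomorph_lensMk n).isOpenMap
      e.open_source
  have hLsource : L.source = e.source := rfl
  have hLtarget : L.target = lensMk n '' e.source := rfl
  have hL : ∀ s, L s = lensMk n s := fun _ => rfl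
  have hLs : ∀ s ∈ e.source, L.symm (lensMk n s) = s := fun s hs => L.left_inv hs
  have hLt : ∀ x ∈ L.target, lensMk n (L.symm x) = x := fun x hx => L.right_inv hx
  have hmem : ∀ x ∈ L.target, L.symm x ∈ e.source := fun x hx => L.map_target hx
  have hsource : (L.symm.trans e).source = lensMk n '' e.source := by
    rw [OpenPartialHomeomorph.trans_source, OpenPartialHomeomorph.symm_source]
    exact inter_eq_left.2 hmem
  have htarget : (L.symm.trans e).target = e.target := by
    rw [OpenPartialHomeomorph.trans_target, OpenPartialHomeomorph.symm_target]
    exact inter_eq_left.2 fun y hy => e.map_target hy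
  obtain ⟨⟨T, hT, hTe⟩, ⟨T', hT', hTe'⟩⟩ := he
  refine ⟨L.symm.trans e, ⟨?_, ?_⟩, hsource, htarget, fun t ht => ?_⟩
  · let r : rootsOfUnity n ℂ → (ℂ × ℂ →ₗ[ℝ] ℂ × ℂ) := fun ζ =>
      LinearMap.lsmul ℂ (ℂ × ℂ) ((ζ : ℂˣ) : ℂ) |>.restrictScalars ℝ
    refine ⟨image2 (fun A ζ => A.comp (r ζ).toAffineMap) T univ, hT.image2 _ finite_univ, ?_⟩
    intro t ht
    rw [hsource] at ht
    obtain ⟨ζ, hζ⟩ := (lensMk_eq_iff n).1 (hLt _ ht)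
    obtain ⟨A, hA, hAt⟩ := hTe _ (hmem _ ht)
    refine ⟨_, mem_image2_of_mem hA (mem_univ ζ), ?_⟩
    change e (L.symm (lensMk n t)) = A (((ζ : ℂˣ) : ℂ) • t.1)
    refine hAt.trans (congrArg A ?_)
    exact congrArg Subtype.val hζ.symm
  · refine ⟨T', hT', fun y hy => ?_⟩
    rw [htarget] at hy
    obtain ⟨A, hA, t, ht, hte⟩ := hTe' y hy
    exact ⟨A, hA, t, ht, congrArg (lensMk n) hte⟩
  · change e (L.symm (lensMk n t)) = e t
    rw [hLs t ht]

/-- A nontrivial square or cube root of unity moves the sector off itself. -/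
theorem eq_one_of_mul_mem_sector (hn6 : n ≠ 6) {ζ z : ℂ} (hζ : ζ ^ n = 1) (hz : z ∈ sector)
    (hζz : ζ * z ∈ sector) : ζ = 1 := by
  have h6 : ζ ^ 6 = 1 := by
    obtain ⟨k, hk⟩ := hn.out
    rw [hk, pow_mul, hζ, one_pow]
  obtain ⟨k, hk, rfl⟩ := isPrimitiveRoot_ofHex.eq_pow_of_pow_eq_one h6
  have hA : ∀ (k : ℕ) (z : ℂ), hexA (ofHex 0 1 ^ (k + 1) * z) = -hexB (ofHex 0 1 ^ k * z) :=
    fun k z => by rw [pow_succ', mul_assoc, hexA_rotate]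
  have hB : ∀ (k : ℕ) (z : ℂ), hexB (ofHex 0 1 ^ (k + 1) * z) =
      hexA (ofHex 0 1 ^ k * z) + hexB (ofHex 0 1 ^ k * z) :=
    fun k z => by rw [pow_succ', mul_assoc, hexB_rotate]
  obtain ⟨h1, h2⟩ := hz
  obtain ⟨h3, h4⟩ := hζz
  rw [← pow_mul, isPrimitiveRoot_ofHex.pow_eq_one_iff_dvd] at hζ
  have hcase : k = 0 ∨ k = 1 + 1 ∨ k = 1 + 1 + 1 ∨ k = 1 + 1 + 1 + 1 := by
    have hn' : n ≤ 6 := Nat.le_of_dvd (by norm_num) hn.out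
    have hn'' := hn.out
    interval_cases n <;> interval_cases k <;> omega
  rcases hcase with rfl | rfl | rfl | rfl
  · rw [pow_zero]
  all_goals
    simp only [hA, hB, pow_one, hexA_rotate, hexB_rotate] at h3 h4
    linarith

/-- If nontrivial roots of unity move `D` off itself, then the quotient map is injective where one
of the coordinates lies in `D`. -/
theorem injOn_lensMk {D : Set ℂ} (hD : ∀ ζ : ℂ, ζ ^ n = 1 → ∀ z ∈ D, ζ * z ∈ D → ζ = 1)
    (c : hexSphere → ℂ)
    (hc : ∀ (ζ : rootsOfUnity n ℂ) (s : hexSphere), c (ζ • s) = ((ζ : ℂˣ) : ℂ) * c s) :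
    InjOn (lensMk n) {s | c s ∈ D} := by
  intro s hs t ht hst
  obtain ⟨ζ, rfl⟩ := (lensMk_eq_iff n).1 hst
  have hs' : ((ζ : ℂˣ) : ℂ) * c t ∈ D := by
    rw [← hc]
    exact hs
  have h1 : ((ζ : ℂˣ) : ℂ) ^ n = 1 := by
    rw [← Units.val_pow_eq_pow_val, (mem_rootsOfUnity n _).1 ζ.2, Units.val_one]
  have h2 : ζ = 1 := Subtype.ext (Units.ext (hD _ h1 _ ht hs'))
  rw [h2, one_smul]

end LensChart

theorem eq_zero_of_hexNorm {z : ℂ} (h : hexNorm z = 0) : z = 0 := by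
  have := norm_le_hexNorm z
  rw [h, mul_zero] at this
  exact norm_le_zero_iff.1 this

/-- Half of the correction turning the hexagonal norm `max |a| |b| |a + b|` into `|a| + |b|`. -/
def shear (a b : ℝ) : ℝ := max 0 (min a (-b)) - max 0 (min (-a) b)

theorem continuous_shear : Continuous fun q : ℝ × ℝ => shear q.1 q.2 := by
  unfold shear
  fun_prop

theorem shear_half (a b : ℝ) :
    |a - shear a b / 2| + |b + shear a b / 2| = max (max |a| |b|) |a + b| ∧
      shear (a - shear a b / 2) (b + shear a b / 2) = shear a b / 2 := by
  unfold shear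
  rcases le_total 0 a with ha | ha <;> rcases le_total 0 b with hb | hb <;>
    rcases le_total 0 (a + b) with hab | hab <;> constructor <;> grind

theorem shear_double (u v : ℝ) : shear (u + shear u v) (v - shear u v) = 2 * shear u v := by
  unfold shear
  grind

theorem hexNorm_ofHex_shear (u v : ℝ) :
    hexNorm (ofHex (u + shear u v) (v - shear u v)) = |u| + |v| := by
  have h := (shear_half (u + shear u v) (v - shear u v)).1
  rw [shear_double] at h
  rw [hexNorm, hexA_ofHex, hexB_ofHex, ← h]
  congr 2 <;> ring

/-- The map `(a, b) ↦ a + b e^{iπ/3}` as a linear map. -/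
def ofHexLinear : ℝ × ℝ →ₗ[ℝ] ℂ := Complex.equivRealProdCLM.symm.toLinearMap ∘ₗ
  (LinearMap.fst ℝ ℝ ℝ + (1 / 2 : ℝ) • LinearMap.snd ℝ ℝ ℝ).prod ((√3 / 2) • LinearMap.snd ℝ ℝ ℝ)

theorem ofHexLinear_apply (q : ℝ × ℝ) : ofHexLinear q = ofHex q.1 q.2 := by
  apply Complex.ext
  · change q.1 + (1 / 2 : ℝ) * q.2 = q.1 + q.2 / 2
    ring
  · change (√3 / 2) * q.2 = q.2 * √3 / 2
    ring

theorem FinitelyAffineOn.shear {E : Type*} [NormedAddCommGroup E] [NormedSpace ℝ E] {f g : E → ℝ}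
    {s : Set E} (hf : FinitelyAffineOn f s) (hg : FinitelyAffineOn g s) :
    FinitelyAffineOn (fun x => shear (f x) (g x)) s := by
  have h0 : FinitelyAffineOn (fun _ : E => (0 : ℝ)) s := .const 0 s
  have hneg : ∀ {k : E → ℝ}, FinitelyAffineOn k s → FinitelyAffineOn (fun x => -k x) s :=
    fun hk => (h0.sub hk).congr fun x _ => (zero_sub _).symm
  exact (h0.max (hf.min (hneg hg))).sub (h0.max ((hneg hf).min hg))

/-- Let `D` be an open set of which the linear form `f` maps the part of norm `ρ` bijectively to
`(-ρ, ρ)`, for each `ρ`, with piecewise affine inverse `g`. Then the part of the sphere where the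
first coordinate lies in `D` is an open `3`-disc; the circle `w = 0` corresponds to the last
axis. -/
theorem exists_hexSphere_disc_chart {D : Set ℂ} (hD : IsOpen D) (f : ℂ →ₗ[ℝ] ℝ) (g : ℝ × ℝ → ℂ)
    (hg : Continuous g) (hg' : FinitelyAffineOn g univ)
    (hfg : ∀ z ∈ D, |f z| < hexNorm z ∧ g (hexNorm z, f z) = z)
    (hgf : ∀ ρ t, |t| < ρ → g (ρ, t) ∈ D ∧ hexNorm (g (ρ, t)) = ρ ∧ f (g (ρ, t)) = t) :
    ∃ e ∈ polyhedralAtlas (id : hexSphere → hexSphere), e.source = {s | s.1.1 ∈ D} ∧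
      e.target = openDisc ∧ ∀ s, e s 0 = 0 ∧ e s 1 = 0 ↔ s.1.2 = 0 := by
  let m : ℂ → ℝ := fun w => shear (hexA w) (hexB w) / 2
  let F : ℂ × ℂ → V3 := fun s => ![hexA s.2 - m s.2, hexB s.2 + m s.2, f s.1]
  let ρ : V3 → ℝ := fun y => 1 - (|y 0| + |y 1|)
  let G : V3 → ℂ × ℂ := fun y =>
    (g (ρ y, y 2), ofHex (y 0 + shear (y 0) (y 1)) (y 1 - shear (y 0) (y 1)))
  have hF : ∀ s : ℂ × ℂ, |F s 0| + |F s 1| = hexNorm s.2 := fun s =>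
    (shear_half (hexA s.2) (hexB s.2)).1
  have hG : ∀ y, hexNorm (G y).2 = |y 0| + |y 1| := fun y => hexNorm_ofHex_shear _ _
  have hdisc : ∀ y : V3, y ∈ openDisc ↔ |y 2| < ρ y := fun y => by
    simp only [openDisc, mem_ofPred_eq, Fin.sum_univ_three, ρ]
    constructor <;> intro h <;> linarith
  have hmc : Continuous m :=
    (continuous_shear.comp (continuous_hexA.prodMk continuous_hexB)).div_const 2
  have hFc : Continuous F := by
    refine continuous_pi fun i => ?_
    fin_cases i
    · exact (continuous_hexA.sub hmc).comp continuous_snd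
    · exact (continuous_hexB.add hmc).comp continuous_snd
    · exact f.continuous_of_finiteDimensional.comp continuous_fst
  have hsc : Continuous fun y : V3 => shear (y 0) (y 1) :=
    continuous_shear.comp (by fun_prop : Continuous fun y : V3 => (y 0, y 1))
  have hGc : Continuous G := by
    refine (hg.comp (by fun_prop)).prodMk ?_
    have := ofHexLinear.continuous_of_finiteDimensional.comp
      (((continuous_apply 0).add hsc).prodMk ((continuous_apply 1).sub hsc))
    exact this.congr fun y => ofHexLinear_apply _
  obtain ⟨e, hes, het, hef, heg⟩ := exists_openPartialHomeomorph (S := hexSphere) F G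
    {s | s.1 ∈ D} openDisc (hD.preimage continuous_fst) isOpen_openDisc hFc hGc
    (by
      intro s hs hsD
      obtain ⟨h1, h2⟩ := hfg s.1 hsD
      have hs' : hexNorm s.1 + hexNorm s.2 = 1 := hs
      have hρ : ρ (F s) = hexNorm s.1 := by
        change 1 - (|F s 0| + |F s 1|) = _
        rw [hF]
        linarith
      refine ⟨by rw [hdisc, hρ]; exact h1, Prod.ext ?_ ?_⟩
      · change g (ρ (F s), f s.1) = s.1
        rw [hρ, h2]
      · have h3 : shear (F s 0) (F s 1) = m s.2 := (shear_half (hexA s.2) (hexB s.2)).2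
        change ofHex (hexA s.2 - m s.2 + shear (F s 0) (F s 1))
          (hexB s.2 + m s.2 - shear (F s 0) (F s 1)) = s.2
        rw [h3, sub_add_cancel, add_sub_cancel_right, ofHex_hexA_hexB])
    (by
      intro y hy
      rw [hdisc] at hy
      obtain ⟨h1, h2, h3⟩ := hgf _ _ hy
      refine ⟨?_, h1, ?_⟩
      · change hexNorm (g (ρ y, y 2)) + hexNorm (G y).2 = 1
        rw [h2, hG]
        exact sub_add_cancel _ _
      · have hm : m (G y).2 = shear (y 0) (y 1) := by
          change shear (hexA (ofHex _ _)) (hexB (ofHex _ _)) / 2 = _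
          rw [hexA_ofHex, hexB_ofHex, shear_double, mul_div_cancel_left₀ _ two_ne_zero]
        ext i
        fin_cases i
        · change hexA (ofHex _ _) - m (G y).2 = y 0
          rw [hm, hexA_ofHex, add_sub_cancel_right]
        · change hexB (ofHex _ _) + m (G y).2 = y 1
          rw [hm, hexB_ofHex, sub_add_cancel]
        · exact h3)
    hexSphere_nonempty
  refine ⟨e, ⟨?_, ?_⟩, hes, het, fun s => ?_⟩
  · have hA : FinitelyAffineOn (fun s : ℂ × ℂ => hexA s.2) univ :=
      (FinitelyAffineOn.linear (hexALinear ∘ₗ LinearMap.snd ℝ ℂ ℂ) univ).congr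
        fun s _ => (hexALinear_apply _).symm
    have hB : FinitelyAffineOn (fun s : ℂ × ℂ => hexB s.2) univ :=
      (FinitelyAffineOn.linear (hexBLinear ∘ₗ LinearMap.snd ℝ ℂ ℂ) univ).congr
        fun s _ => (hexBLinear_apply _).symm
    have hm : FinitelyAffineOn (fun s : ℂ × ℂ => m s.2) univ :=
      ((hA.shear hB).const_mul (1 / 2)).congr fun s _ => by simp only [m]; ring
    obtain ⟨T, hT, h⟩ := finitelyAffineOn_vec3 (hA.sub hm) (hB.add hm)
      (FinitelyAffineOn.linear (f ∘ₗ LinearMap.fst ℝ ℂ ℂ) univ)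
    exact ⟨T, hT, fun s _ => by rw [hef]; exact h s (mem_univ _)⟩
  · have hc : ∀ i, FinitelyAffineOn (fun y : V3 => y i) univ := fun i =>
      finitelyAffineOn_coord i univ
    have hs := (hc 0).shear (hc 1)
    have hρ : FinitelyAffineOn ρ univ :=
      (FinitelyAffineOn.const 1 univ).sub ((hc 0).abs.add (hc 1).abs)
    have h1 : FinitelyAffineOn (fun y => g (ρ y, y 2)) univ :=
      (hg'.comp (hρ.prodMk (hc 2))).mono fun _ _ => ⟨trivial, trivial⟩
    have h2 := (((hc 0).add hs).prodMk ((hc 1).sub hs)).linear_comp ofHexLinear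
    obtain ⟨T, hT, h⟩ := h1.prodMk (h2.congr fun y _ => (ofHexLinear_apply _).symm)
    refine ⟨T, hT, fun y hy => ?_⟩
    rw [het] at hy
    obtain ⟨A, hA, hAy⟩ := h y (mem_univ _)
    exact ⟨A, hA, e.symm y, by rw [heg y hy, ← hAy], rfl⟩
  · have h := hF s.1
    rw [hef]
    constructor
    · rintro ⟨h0, h1⟩
      rw [h0, h1, abs_zero, add_zero] at h
      exact eq_zero_of_hexNorm h.symm
    · intro hw
      rw [hw, hexNorm_zero] at h
      have h0 := abs_nonneg (F s.1 0)
      have h1 := abs_nonneg (F s.1 1)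
      exact ⟨abs_eq_zero.1 (by linarith), abs_eq_zero.1 (by linarith)⟩

/-- The half-plane `0 < b`, a fundamental domain for the action of `±1`. -/
theorem exists_halfPlane_chart :
    ∃ e ∈ polyhedralAtlas (id : hexSphere → hexSphere), e.source = {s | s.1.1 ∈ {z | 0 < hexB z}} ∧
      e.target = openDisc ∧ ∀ s, e s 0 = 0 ∧ e s 1 = 0 ↔ s.1.2 = 0 := by
  let b : ℝ × ℝ → ℝ := fun q => min q.1 (2 * (q.1 - |q.2|))
  have hre : ∀ z, (hexALinear + (1 / 2 : ℝ) • hexBLinear) z = hexA z + hexB z / 2 := fun z => by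
    change hexALinear z + (1 / 2 : ℝ) * hexBLinear z = _
    rw [hexALinear_apply, hexBLinear_apply]
    ring
  refine exists_hexSphere_disc_chart (isOpen_lt continuous_const continuous_hexB)
    (hexALinear + (1 / 2 : ℝ) • hexBLinear) (fun q => ofHexLinear (q.2 - b q / 2, b q)) ?_ ?_ ?_ ?_
  · exact ofHexLinear.continuous_of_finiteDimensional.comp (by fun_prop)
  · have h1 := FinitelyAffineOn.linear (LinearMap.fst ℝ ℝ ℝ) univ
    have h2 := FinitelyAffineOn.linear (LinearMap.snd ℝ ℝ ℝ) univ
    have hb : FinitelyAffineOn b univ := h1.min ((h1.sub h2.abs).const_mul 2)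
    exact ((((h2.sub (hb.const_mul (1 / 2))).congr
      (g := fun q : ℝ × ℝ => q.2 - b q / 2) fun q _ => by simp; ring).prodMk hb).linear_comp
        ofHexLinear)
  · intro z hz
    have hz' : 0 < hexB z := hz
    rw [hre, ofHexLinear_apply]
    have hb : b (hexNorm z, hexA z + hexB z / 2) = hexB z := by
      simp only [b, hexNorm]
      grind
    refine ⟨?_, ?_⟩
    · simp only [hexNorm]
      grind
    · rw [hb]
      simp only [add_sub_cancel_right, ofHex_hexA_hexB]
  · intro ρ t ht
    rw [hre, ofHexLinear_apply, mem_ofPred_eq, hexNorm, hexA_ofHex, hexB_ofHex]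
    simp only [b]
    refine ⟨?_, ?_, ?_⟩ <;> grind

/-- The sector is a fundamental domain for the action of the cube roots of unity. -/
theorem exists_sector_chart :
    ∃ e ∈ polyhedralAtlas (id : hexSphere → hexSphere), e.source = {s | s.1.1 ∈ sector} ∧
      e.target = openDisc ∧ ∀ s, e s 0 = 0 ∧ e s 1 = 0 ↔ s.1.2 = 0 := by
  refine exists_hexSphere_disc_chart isOpen_sector hexBLinear
    (fun q => ofHexLinear (q.1 - max q.2 0, q.2)) ?_ ?_ ?_ ?_
  · exact ofHexLinear.continuous_of_finiteDimensional.comp (by fun_prop)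
  · have h1 := FinitelyAffineOn.linear (LinearMap.fst ℝ ℝ ℝ) univ
    have h2 := FinitelyAffineOn.linear (LinearMap.snd ℝ ℝ ℝ) univ
    exact ((h1.sub (h2.max (.const 0 univ))).prodMk h2).linear_comp ofHexLinear
  · intro z hz
    rw [hexBLinear_apply, ofHexLinear_apply, hexNorm_of_mem_sector hz, add_sub_cancel_right,
      ofHex_hexA_hexB]
    obtain ⟨h1, h2⟩ := hz
    exact ⟨by grind, rfl⟩
  · intro ρ t ht
    rw [hexBLinear_apply, ofHexLinear_apply, sector, mem_ofPred_eq, hexNorm, hexA_ofHex, hexB_ofHex]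
    refine ⟨?_, ?_, ?_⟩ <;> grind

/-! ### Spines of the quotients of the sphere in `ℂ²` -/

section LensSpine

variable (n : ℕ) [hn : Fact (n ∣ 6)]

/-- The image in the quotient of the part of the sphere where the first coordinate lies in `K`. -/
def lensSet (K : Set ℂ) : Set (LensSpace n) := lensMk n '' {s | s.1.1 ∈ K}

variable {n}

theorem lensMk_mem_lensSet {K : Set ℂ} (hK : ∀ ζ : ℂ, ζ ^ n = 1 → ∀ z ∈ K, ζ * z ∈ K)
    {s : hexSphere} : lensMk n s ∈ lensSet n K ↔ s.1.1 ∈ K := by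
  refine ⟨?_, fun h => ⟨s, h, rfl⟩⟩
  rintro ⟨t, ht, h⟩
  obtain ⟨ζ, rfl⟩ := (lensMk_eq_iff n).1 h.symm
  refine hK _ ?_ _ ht
  rw [← Units.val_pow_eq_pow_val, (mem_rootsOfUnity n _).1 ζ.2, Units.val_one]

theorem exists_lensMk_eq {ζ : ℂ} (hζ : ζ ^ n = 1) (s : hexSphere) :
    ∃ t : hexSphere, lensMk n t = lensMk n s ∧ t.1.1 = ζ * s.1.1 := by
  let u : rootsOfUnity n ℂ := rootsOfUnity.mkOfPowEq ζ hζ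
  exact ⟨u • s, (lensMk_eq_iff n).2 ⟨u, rfl⟩, rfl⟩

theorem modeledAt_lens {p : ℕ} (hp : 1 ≤ p) {P : Set (LensSpace n)}
    {e : OpenPartialHomeomorph hexSphere V3}
    (he : e ∈ polyhedralAtlas (id : hexSphere → hexSphere)) (hinj : InjOn (lensMk n) e.source)
    {s : hexSphere} (hs : s ∈ e.source) (Θ : PLAut) (h0 : Θ (e s) = 0) {M : Set V3}
    (h : ∀ t ∈ e.source, lensMk n t ∈ P ↔ Θ (e t) ∈ M) :
    (lensOrbifold n p hp).ModeledAt P (lensMk n s) M := by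
  obtain ⟨φ, hφ, hφs, -, hφe⟩ := exists_lens_chart_of_injOn n he hinj
  have hsφ : lensMk n s ∈ φ.source := by
    rw [hφs]
    exact mem_image_of_mem _ hs
  have h0' : Θ (φ (lensMk n s)) = 0 := by rw [hφe s hs, h0]
  have hev : ∀ᶠ y in 𝓝 (lensMk n s), (y ∈ P ↔ Θ (φ y) ∈ M) := by
    filter_upwards [φ.open_source.mem_nhds hsφ] with y hy
    rw [hφs] at hy
    obtain ⟨t, ht, rfl⟩ := hy
    rw [h t ht, hφe t ht]
  exact ClosedOrbifold.modeledAt_of_plAut (X := lensOrbifold n p hp)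
    (plGroupoid.subset_maximalAtlas (M := LensSpace n) hφ) hsφ Θ h0' hev

/-- A chart around the points with `z` on the negative real axis. -/
theorem exists_neg_sector_chart (hn6 : n ≠ 6) :
    ∃ e ∈ polyhedralAtlas (id : hexSphere → hexSphere), e.source = {s | -s.1.1 ∈ sector} ∧
      InjOn (lensMk n) e.source ∧ ∀ s, e s = ![-s.1.2.re, -s.1.2.im, -hexB s.1.1] := by
  have hneg : ∀ z, hexNorm (-z) = hexNorm z := fun z => by
    rw [← neg_one_mul]
    exact hexNorm_mul (by norm_num) z
  obtain ⟨e, he, hes, hef⟩ := exists_hexSphere_chart (LinearEquiv.neg ℝ) fun t => by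
    change hexNorm (-t.1) + hexNorm (-t.2) = 1 ↔ hexNorm t.1 + hexNorm t.2 = 1
    rw [hneg, hneg]
  refine ⟨e, he, hes, ?_, fun s => ?_⟩
  · rw [hes]
    exact injOn_lensMk n (D := sector) (fun ζ hζ z => eq_one_of_mul_mem_sector n hn6 hζ)
      (fun s => -s.1.1) fun ζ s => (mul_neg _ _).symm
  · rw [hef]
    ext i
    fin_cases i
    · rfl
    · rfl
    · change hexCoord (-s.1) 2 = -hexB s.1.1
      rw [map_neg, Pi.neg_apply, hexCoord_two]

/-- A chart around the points with `u w` on the positive real axis, in which `z` is a coordinate. -/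
theorem exists_snd_sector_chart (hn6 : n ≠ 6) {u : ℂ} (hu : u ^ 6 = 1) :
    ∃ e ∈ polyhedralAtlas (id : hexSphere → hexSphere), e.source = {s | u * s.1.2 ∈ sector} ∧
      InjOn (lensMk n) e.source ∧ ∀ s, e s = ![s.1.1.re, s.1.1.im, hexB (u * s.1.2)] := by
  have hu0 : u ≠ 0 := by
    rintro rfl
    norm_num at hu
  let R : (ℂ × ℂ) ≃ₗ[ℝ] (ℂ × ℂ) := (LinearEquiv.prodComm ℝ ℂ ℂ).trans
    (((LinearEquiv.smulOfUnit (Units.mk0 u hu0) : ℂ ≃ₗ[ℂ] ℂ).restrictScalars ℝ).prodCongr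
      (LinearEquiv.refl ℝ ℂ))
  obtain ⟨e, he, hes, hef⟩ := exists_hexSphere_chart R fun t => by
    change hexNorm (u * t.2) + hexNorm t.1 = 1 ↔ hexNorm t.1 + hexNorm t.2 = 1
    rw [hexNorm_mul hu, add_comm]
  refine ⟨e, he, hes, ?_, fun s => ?_⟩
  · rw [hes]
    exact injOn_lensMk n (D := sector) (fun ζ hζ z => eq_one_of_mul_mem_sector n hn6 hζ)
      (fun s => u * s.1.2) fun ζ s => mul_left_comm _ _ _
  · rw [hef]
    ext i
    fin_cases i
    · rfl
    · rfl
    · exact hexCoord_two _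

theorem isCompact_lensFibre : IsCompact (lensFibre n) := by
  refine IsCompact.image ?_ (isLocalHomeomorph_lensMk n).continuous
  exact (isClosed_eq (continuous_snd.comp continuous_subtype_val) continuous_const).isCompact

theorem isConnected_lensFibre : IsConnected (lensFibre n) := by
  have hN : ∀ z : ({0}ᶜ : Set ℂ), hexNorm z ≠ 0 := fun z hz => z.2 (eq_zero_of_hexNorm hz)
  have hscale : ∀ z (c : ℝ), 0 ≤ c → hexNorm (c * z) = c * hexNorm z := fun z c hc => by
    have hA : hexA (c * z) = c * hexA z := by simp [hexA, mul_sub, mul_div_assoc]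
    have hB : hexB (c * z) = c * hexB z := by simp [hexB]; ring
    rw [hexNorm, hA, hB, ← mul_add, abs_mul, abs_mul, abs_mul, abs_of_nonneg hc,
      ← mul_max_of_nonneg _ _ hc, ← mul_max_of_nonneg _ _ hc]
    rfl
  let f : ({0}ᶜ : Set ℂ) → hexSphere := fun z => ⟨(((hexNorm z)⁻¹ : ℝ) * z, 0), by
    change hexNorm _ + hexNorm 0 = 1
    rw [hscale _ _ (inv_nonneg.2 (hexNorm_nonneg _)), inv_mul_cancel₀ (hN z), hexNorm_zero,
      add_zero]⟩
  have hf : Continuous f := by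
    refine Continuous.subtype_mk (Continuous.prodMk ?_ continuous_const) _
    exact (Complex.continuous_ofReal.comp
      ((continuous_hexNorm.comp continuous_subtype_val).inv₀ hN)).mul continuous_subtype_val
  have := isConnected_iff_connectedSpace.1 isConnected_compl_zero
  have hrange : range f = {s | s.1.2 = 0} := by
    ext s
    refine ⟨?_, fun hs => ?_⟩
    · rintro ⟨z, rfl⟩
      rfl
    · have hs1 : hexNorm s.1.1 + hexNorm s.1.2 = 1 := s.2
      rw [show s.1.2 = 0 from hs, hexNorm_zero, add_zero] at hs1
      refine ⟨⟨s.1.1, fun h0 => ?_⟩, Subtype.ext (Prod.ext ?_ (Eq.symm hs))⟩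
      · rw [show s.1.1 = 0 from h0, hexNorm_zero] at hs1
        exact zero_ne_one hs1
      · change (((hexNorm s.1.1)⁻¹ : ℝ) : ℂ) * s.1.1 = s.1.1
        rw [hs1, inv_one, Complex.ofReal_one, one_mul]
  have := (isConnected_range hf).image (lensMk n) (isLocalHomeomorph_lensMk n).continuous.continuousOn
  rwa [hrange] at this

variable (n) in
/-- A cone `K` in `ℂ`, invariant under the `n`-th roots of unity, whose complement is the orbit of
a fundamental domain `D`: a line, for `n = 2`, or the union of three half-lines, for `n = 3`. The
spine which it defines in the quotient is a projective plane in the first case, and in the second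
a disc whose boundary is wrapped three times around a circle. The last four fields say that the
complement of this spine is an open disc, that `K` is a line near the negative real axis, that all
of its points other than `0` can be rotated to that axis, and that the spine is locally a plane or
a book along the circle `z = 0`. -/
structure SpineCone (K D : Set ℂ) : Prop where
  isClosed : IsClosed K
  mul_mem : ∀ ζ : ℂ, ζ ^ n = 1 → ∀ z ∈ K, ζ * z ∈ K
  disjoint : ∀ z ∈ D, z ∉ K
  exists_mul_mem : ∀ z, z ∉ K → ∃ ζ : ℂ, ζ ^ n = 1 ∧ ζ * z ∈ D
  eq_one_of_mul_mem : ∀ ζ : ℂ, ζ ^ n = 1 → ∀ z ∈ D, ζ * z ∈ D → ζ = 1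
  chart : ∃ e ∈ polyhedralAtlas (id : hexSphere → hexSphere), e.source = {s | s.1.1 ∈ D} ∧
    e.target = openDisc ∧ ∀ s, e s 0 = 0 ∧ e s 1 = 0 ↔ s.1.2 = 0
  mem_iff : ∀ z, -z ∈ sector → (z ∈ K ↔ hexB z = 0)
  exists_neg_mul_mem : ∀ z ∈ K, z ≠ 0 → ∃ ζ : ℂ, ζ ^ n = 1 ∧ -(ζ * z) ∈ sector
  model : ∃ M, (M = planeModel ∨ M = bookModel) ∧ ∀ c : ℝ, ∃ Θ : PLAut, Θ ![0, 0, c] = 0 ∧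
    ∀ x y t : ℝ, (⟨x, y⟩ : ℂ) ∈ K ↔ Θ ![x, y, t] ∈ M

theorem SpineCone.modeledAt {K D : Set ℂ} (h : SpineCone n K D) (hn6 : n ≠ 6) {p : ℕ}
    (hp : 1 ≤ p) (x : LensSpace n) (hx : x ∈ lensSet n K) :
    (lensOrbifold n p hp).ModeledAt (lensSet n K) x planeModel ∨
      (lensOrbifold n p hp).ModeledAt (lensSet n K) x halfModel ∨
      (lensOrbifold n p hp).ModeledAt (lensSet n K) x bookModel := by
  obtain ⟨s, hs, rfl⟩ := hx
  have hsK : s.1.1 ∈ K := hs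
  by_cases hz : s.1.1 = 0
  · obtain ⟨M, hM, hΘ⟩ := h.model
    have hw : s.1.2 ≠ 0 := fun hw => by
      have hs1 : hexNorm s.1.1 + hexNorm s.1.2 = 1 := s.2
      rw [hz, hw, hexNorm_zero] at hs1
      norm_num at hs1
    obtain ⟨u, hu, hus⟩ := exists_rotate_mem_sector hw
    obtain ⟨e, he, hes, hinj, hef⟩ := exists_snd_sector_chart hn6 hu
    obtain ⟨Θ, hΘ0, hΘ⟩ := hΘ (hexB (u * s.1.2))
    have key : (lensOrbifold n p hp).ModeledAt (lensSet n K) (lensMk n s) M := by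
      refine modeledAt_lens hp he hinj (by rw [hes]; exact hus) Θ ?_ fun t _ => ?_
      · rw [hef, hz, Complex.zero_re, Complex.zero_im, hΘ0]
      · rw [hef, ← hΘ, lensMk_mem_lensSet h.mul_mem]
    rcases hM with rfl | rfl
    · exact Or.inl key
    · exact Or.inr (Or.inr key)
  · left
    obtain ⟨ζ, hζ, hζz⟩ := h.exists_neg_mul_mem _ hsK hz
    obtain ⟨t, hts, ht⟩ := exists_lensMk_eq hζ s
    rw [← hts]
    obtain ⟨e, he, hes, hinj, hef⟩ := exists_neg_sector_chart hn6
    have hte : t ∈ e.source := by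
      rw [hes]
      change -t.1.1 ∈ sector
      rwa [ht]
    have htK : t.1.1 ∈ K := by
      rw [ht]
      exact h.mul_mem _ hζ _ hsK
    have hef2 : ∀ s, e s 2 = -hexB s.1.1 := fun s => by rw [hef]; rfl
    refine modeledAt_lens hp he hinj hte (PLAut.translate (e t)) ?_ fun r hr => ?_
    · rw [PLAut.translate_apply, sub_self]
    · rw [hes] at hr hte
      rw [lensMk_mem_lensSet h.mul_mem, h.mem_iff _ hr, PLAut.translate_apply]
      change _ ↔ e r 2 - e t 2 = 0
      rw [hef2, hef2, (h.mem_iff _ hte).1 htK, neg_zero, sub_zero, neg_eq_zero]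

theorem lensOrbifold_label {p : ℕ} {hp : 1 ≤ p} {x : LensSpace n}
    (h : (lensOrbifold n p hp).label x ≠ 1) :
    x ∈ lensFibre n ∧ (lensOrbifold n p hp).label x = p := by
  by_cases hx : x ∈ lensFibre n
  · exact ⟨hx, if_pos hx⟩
  · exact absurd (if_neg hx) h

theorem lensOrbifold_label_lensMk {p : ℕ} {hp : 1 ≤ p} {y : V3} {s : hexSphere}
    (h : y 0 = 0 ∧ y 1 = 0 ↔ s.1.2 = 0) :
    (lensOrbifold n p hp).label (lensMk n s) = cyclicLabel p y := by
  by_cases hs : s.1.2 = 0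
  · have hs' := (lensMk_mem_lensFibre n).2 hs
    exact (if_pos hs').trans (if_pos (h.2 hs)).symm
  · have hs' := mt (lensMk_mem_lensFibre n).1 hs
    exact (if_neg hs').trans (if_neg (mt h.1 hs)).symm

/-- The point of the fibre `w = 0` with `z = -1`. -/
def fibrePoint : hexSphere := ⟨(-1, 0), by
  change hexNorm (-1) + hexNorm 0 = 1
  simp [hexNorm, hexA, hexB]⟩

theorem SpineCone.eq_of_mem_fibre {K D : Set ℂ} (h : SpineCone n K D) {x : LensSpace n}
    (hx : x ∈ lensSet n K) (hxf : x ∈ lensFibre n) : x = lensMk n fibrePoint := by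
  obtain ⟨s, hs, rfl⟩ := hx
  have hw : s.1.2 = 0 := (lensMk_mem_lensFibre n).1 hxf
  have hs1 : hexNorm s.1.1 + hexNorm s.1.2 = 1 := s.2
  rw [hw, hexNorm_zero, add_zero] at hs1
  have hz : s.1.1 ≠ 0 := fun hz => by
    rw [hz, hexNorm_zero] at hs1
    exact zero_ne_one hs1
  obtain ⟨ζ, hζ, hζz⟩ := h.exists_neg_mul_mem _ hs hz
  obtain ⟨t, hts, ht⟩ := exists_lensMk_eq hζ s
  rw [← hts]
  rw [← ht] at hζz
  have htw : t.1.2 = 0 := by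
    rw [← lensMk_mem_lensFibre n, hts]
    exact hxf
  have htK : t.1.1 ∈ K := by
    rw [← lensMk_mem_lensSet h.mul_mem, hts]
    exact ⟨s, hs, rfl⟩
  have hB := (h.mem_iff _ hζz).1 htK
  have ht1 : hexNorm t.1.1 + hexNorm t.1.2 = 1 := t.2
  rw [htw, hexNorm_zero, add_zero, hexNorm, hB, abs_zero, add_zero,
    max_eq_left (abs_nonneg (hexA _)), max_self] at ht1
  have hA : 0 < hexA (-t.1.1) := hζz.1
  rw [← hexALinear_apply, map_neg, hexALinear_apply] at hA
  rw [abs_of_neg (by linarith)] at ht1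
  refine congrArg (lensMk n) (Subtype.ext (Prod.ext (eq_of_hex ?_ ?_) htw))
  · change _ = hexA (-1)
    rw [show hexA t.1.1 = -1 by linarith]
    simp [hexA]
  · change _ = hexB (-1)
    rw [hB]
    simp [hexB]

theorem SpineCone.isSpine {K D : Set ℂ} (h : SpineCone n K D) (hn6 : n ≠ 6) {p : ℕ}
    (hp : 1 ≤ p) : (lensOrbifold n p hp).IsSpine (lensSet n K) := by
  have hl := isDiscalLabel_cyclicLabel hp
  have hc : IsCompact (lensSet n K) :=
    (h.isClosed.preimage (continuous_fst.comp continuous_subtype_val)).isCompact.image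
      (isLocalHomeomorph_lensMk n).continuous
  refine ⟨ClosedOrbifold.isSimple_of_modeledAt hc (h.modeledAt hn6 hp), ?_, ?_⟩
  · rintro (x : LensSpace n) ⟨hx, hxl⟩
    obtain ⟨hxf, hxp⟩ := lensOrbifold_label hxl
    have hp2 : 2 ≤ p := by
      have : (lensOrbifold n p hp).label x ≠ 1 := hxl
      omega
    rw [h.eq_of_mem_fibre hx hxf]
    obtain ⟨e, he, hes, hinj, hef⟩ := exists_neg_sector_chart hn6
    obtain ⟨φ, hφ, hφs, -, hφe⟩ := exists_lens_chart_of_injOn n he hinj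
    have hse : fibrePoint ∈ e.source := by
      rw [hes]
      change -(-1) ∈ sector
      simp [sector, hexA, hexB]
    have hsφ : lensMk n fibrePoint ∈ φ.source := by
      rw [hφs]
      exact mem_image_of_mem _ hse
    have h0 : φ (lensMk n fibrePoint) = 0 := by
      rw [hφe _ hse, hef]
      ext i
      fin_cases i
      · exact neg_zero
      · exact neg_zero
      · change -hexB (-1) = 0
        simp [hexB]
    have hev : ∀ᶠ y in 𝓝 (lensMk n fibrePoint), (y ∈ lensSet n K ↔ φ y 2 = 0) ∧
        (lensOrbifold n p hp).label y = cyclicLabel p (φ y) := by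
      filter_upwards [φ.open_source.mem_nhds hsφ] with y hy
      rw [hφs] at hy
      obtain ⟨t, ht, rfl⟩ := hy
      rw [hφe t ht]
      rw [hes] at ht
      have h2 : e t 2 = -hexB t.1.1 := by rw [hef]; rfl
      refine ⟨?_, lensOrbifold_label_lensMk ?_⟩
      · rw [lensMk_mem_lensSet h.mul_mem, h.mem_iff _ ht, h2, neg_eq_zero]
      · rw [hef, Complex.ext_iff]
        exact and_congr neg_eq_zero neg_eq_zero
    exact ⟨φ, plGroupoid.subset_maximalAtlas (M := LensSpace n) hφ, hsφ, h0, p, hp2, hev⟩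
  · intro (x : LensSpace n) hx
    obtain ⟨e, he, hes, het, hef⟩ := h.chart
    have hinj : InjOn (lensMk n) e.source := by
      rw [hes]
      exact injOn_lensMk n h.eq_one_of_mul_mem (fun s => s.1.1) fun _ _ => rfl
    obtain ⟨φ, hφ, hφs, hφt, hφe⟩ := exists_lens_chart_of_injOn n he hinj
    have hcompl : φ.source = (lensSet n K)ᶜ := by
      rw [hφs, hes]
      ext y
      obtain ⟨s, rfl⟩ := lensMk_surjective n y
      rw [mem_compl_iff, lensMk_mem_lensSet h.mul_mem]
      constructor
      · rintro ⟨t, ht, hts⟩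
        rw [← lensMk_mem_lensSet h.mul_mem, ← hts, lensMk_mem_lensSet h.mul_mem]
        exact h.disjoint _ ht
      · intro hs
        obtain ⟨ζ, hζ, hζs⟩ := h.exists_mul_mem _ hs
        obtain ⟨t, hts, ht⟩ := exists_lensMk_eq hζ s
        refine ⟨t, ?_, hts⟩
        change t.1.1 ∈ D
        rwa [ht]
    refine ⟨φ, plGroupoid.subset_maximalAtlas (M := LensSpace n) hφ, ?_, hφt.trans het, _, hl, ?_⟩
    · refine ClosedOrbifold.component_eq_source (X := lensOrbifold n p hp) (hφt.trans het)
        (hcompl ▸ hx) hcompl.subset ?_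
      have hopen : IsOpen ((lensSet n K)ᶜ \ φ.source : Set (LensSpace n)) := by
        rw [hcompl, Set.sdiff_self]
        exact isOpen_empty
      exact hopen
    · intro (y : LensSpace n) hy
      have hy' : y ∈ lensMk n '' e.source := hφs ▸ hy
      obtain ⟨t, ht, rfl⟩ := hy'
      have : (lensOrbifold n p hp).label (lensMk n t) = cyclicLabel p (φ (lensMk n t)) := by
        rw [hφe t ht]
        exact lensOrbifold_label_lensMk (hef t)
      exact this

theorem SpineCone.complexity {K D : Set ℂ} (h : SpineCone n K D) (hn6 : n ≠ 6) {p : ℕ}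
    (hp : 1 ≤ p) : (lensOrbifold n p hp).complexity = ((p - 1 : ℕ) : ℕ∞) ∧
      ∀ P, (lensOrbifold n p hp).IsMinimalSpine P → ¬ (lensOrbifold n p hp).IsSpecial P := by
  refine ClosedOrbifold.complexity_eq_of_connected (X := lensOrbifold n p hp)
    (lensMk n fibrePoint) (fun y hy => (lensOrbifold_label hy).2) (fun hp2 => ?_)
    (h.isSpine hn6 hp) (ClosedOrbifold.vertices_eq_empty_of_modeledAt (h.modeledAt hn6 hp)) ?_
    (if_pos ((lensMk_mem_lensFibre n).2 rfl))
  · have hS : (lensOrbifold n p hp).singularSet = lensFibre n := by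
      refine Set.ext fun (y : LensSpace n) => ⟨fun hy => (lensOrbifold_label hy).1, fun hy => ?_⟩
      have hy' : (lensOrbifold n p hp).label y = p := if_pos hy
      change (lensOrbifold n p hp).label y ≠ 1
      omega
    rw [hS]
    exact ⟨isCompact_lensFibre, isConnected_lensFibre⟩
  · rintro (y : LensSpace n) ⟨hy, hyl⟩
    exact h.eq_of_mem_fibre hy (lensOrbifold_label hyl).1

end LensSpine

theorem mem_sector_neg {z : ℂ} : -z ∈ sector ↔ hexA z < 0 ∧ hexA z + hexB z < 0 := by
  rw [sector, mem_ofPred_eq, ← hexALinear_apply, ← hexBLinear_apply, map_neg, map_neg,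
    hexALinear_apply, hexBLinear_apply]
  constructor <;> rintro ⟨h1, h2⟩ <;> constructor <;> linarith

/-- The union of the three half-lines through `-1`, `e^{iπ/3}` and `e^{-iπ/3}`. -/
def tripod : Set ℂ := {z | hexB z + max (hexA z) 0 = 0 ∨ hexA z = 0 ∧ 0 ≤ hexB z}

theorem spineCone_two : SpineCone 2 {z | hexB z = 0} {z | 0 < hexB z} := by
  have hA : ∀ z, hexA (-1 * z) = -hexA z := fun z => by
    rw [neg_one_mul, ← hexALinear_apply, map_neg, hexALinear_apply]
  have hB : ∀ z, hexB (-1 * z) = -hexB z := fun z => by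
    rw [neg_one_mul, ← hexBLinear_apply, map_neg, hexBLinear_apply]
  have hroot : ∀ ζ : ℂ, ζ ^ 2 = 1 → ζ = 1 ∨ ζ = -1 := fun ζ hζ => sq_eq_one_iff.1 hζ
  refine ⟨isClosed_eq continuous_hexB continuous_const, ?_, fun z hz => ne_of_gt hz, ?_, ?_,
    exists_halfPlane_chart, fun _ _ => Iff.rfl, ?_, planeModel, Or.inl rfl, fun c => ?_⟩
  · intro ζ hζ z (hz : hexB z = 0)
    change hexB (ζ * z) = 0
    rcases hroot ζ hζ with rfl | rfl
    · rwa [one_mul]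
    · rw [hB, hz, neg_zero]
  · intro z (hz : hexB z ≠ 0)
    rcases lt_or_gt_of_ne hz with h | h
    · exact ⟨-1, by norm_num, show 0 < hexB (-1 * z) by rw [hB]; linarith⟩
    · exact ⟨1, by norm_num, show 0 < hexB (1 * z) by rwa [one_mul]⟩
  · intro ζ hζ z (hz : 0 < hexB z) (hζz : 0 < hexB (ζ * z))
    rcases hroot ζ hζ with rfl | rfl
    · rfl
    · rw [hB] at hζz
      linarith
  · intro z (hz : hexB z = 0) hz0
    have ha : hexA z ≠ 0 := fun ha => hz0
      (eq_of_hex (by rw [ha]; simp [hexA]) (by rw [hz]; simp [hexB]))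
    rcases lt_or_gt_of_ne ha with h | h
    · refine ⟨1, by norm_num, ?_⟩
      rw [one_mul, mem_sector_neg]
      constructor <;> linarith
    · refine ⟨-1, by norm_num, ?_⟩
      rw [mem_sector_neg, hA, hB]
      constructor <;> linarith
  · refine ⟨(PLAut.translate ![0, 0, c]).trans (PLAut.perm (Equiv.swap 1 2)), ?_, fun x y t => ?_⟩
    · rw [PLAut.trans_apply, PLAut.translate_apply, sub_self]
      rfl
    · change hexB _ = 0 ↔ PLAut.perm _ (PLAut.translate ![0, 0, c] ![x, y, t]) 2 = 0
      rw [PLAut.perm_apply, Equiv.swap_apply_right, PLAut.translate_apply]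
      change 2 * y / √3 = 0 ↔ y - 0 = 0
      rw [sub_zero, div_eq_zero_iff, mul_eq_zero]
      simp

/-- The action of the cube roots of unity in the coordinates `a`, `b`. -/
theorem hex_mul_of_cube {ζ : ℂ} (hζ : ζ ^ 3 = 1) (z : ℂ) :
    hexA (ζ * z) = hexA z ∧ hexB (ζ * z) = hexB z ∨
      hexA (ζ * z) = -(hexA z + hexB z) ∧ hexB (ζ * z) = hexA z ∨
      hexA (ζ * z) = hexB z ∧ hexB (ζ * z) = -(hexA z + hexB z) := by
  have h6 : ζ ^ 6 = 1 := by rw [show 6 = 3 * 2 from rfl, pow_mul, hζ, one_pow]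
  obtain ⟨k, hk, rfl⟩ := isPrimitiveRoot_ofHex.eq_pow_of_pow_eq_one h6
  rw [← pow_mul, isPrimitiveRoot_ofHex.pow_eq_one_iff_dvd] at hζ
  have hcase : k = 0 ∨ k = 1 + 1 ∨ k = 1 + 1 + 1 + 1 := by omega
  rcases hcase with rfl | rfl | rfl
  · left
    simp
  · right; left
    simp only [pow_succ', pow_zero, mul_one, mul_assoc, hexA_rotate, hexB_rotate]
    exact ⟨trivial, by ring⟩
  · right; right
    simp only [pow_succ', pow_zero, mul_one, mul_assoc, hexA_rotate, hexB_rotate]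
    exact ⟨by ring, by ring⟩

theorem exists_hex_mul_eq (z : ℂ) :
    (∃ ζ : ℂ, ζ ^ 3 = 1 ∧ hexA (ζ * z) = -(hexA z + hexB z) ∧ hexB (ζ * z) = hexA z) ∧
      ∃ ζ : ℂ, ζ ^ 3 = 1 ∧ hexA (ζ * z) = hexB z ∧ hexB (ζ * z) = -(hexA z + hexB z) := by
  refine ⟨⟨ofHex 0 1 ^ 2, ?_, ?_⟩, ofHex 0 1 ^ 4, ?_, ?_⟩
  · rw [← pow_mul, isPrimitiveRoot_ofHex.pow_eq_one]
  · simp only [pow_succ', pow_zero, mul_one, mul_assoc, hexA_rotate, hexB_rotate]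
    exact ⟨trivial, by ring⟩
  · rw [← pow_mul, isPrimitiveRoot_ofHex.pow_eq_one_iff_dvd]
    norm_num
  · simp only [pow_succ', pow_zero, mul_one, mul_assoc, hexA_rotate, hexB_rotate]
    exact ⟨by ring, by ring⟩

/-- The piecewise linear map taking the product of the tripod and a line to the union of a plane and
a half-plane. -/
def tripodModel (c : ℝ) : PLAut :=
  PLAut.ofInverse
    (fun v => ![v 2 - c, v 0 - v 1 * (√3)⁻¹, 2 * (√3)⁻¹ * v 1 + max (v 0 - v 1 * (√3)⁻¹) 0])
    (fun v => ![v 1 + (v 2 - max (v 1) 0) / 2, √3 / 2 * (v 2 - max (v 1) 0), v 0 + c])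
    (by
      refine continuous_pi fun i => ?_
      fin_cases i <;> simp <;> fun_prop)
    (by
      refine continuous_pi fun i => ?_
      fin_cases i <;> simp <;> fun_prop)
    (by
      have hc : ∀ i, FinitelyAffineOn (fun v : V3 => v i) univ := fun i =>
        finitelyAffineOn_coord i univ
      have ha := (hc 0).sub (((hc 1).const_mul (√3)⁻¹).congr
        (g := fun v : V3 => v 1 * (√3)⁻¹) fun v _ => mul_comm _ _)
      exact finitelyAffineOn_vec3 ((hc 2).sub (.const c univ)) ha
        (((hc 1).const_mul (2 * (√3)⁻¹)).add (ha.max (.const 0 univ))))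
    (by
      have hc : ∀ i, FinitelyAffineOn (fun v : V3 => v i) univ := fun i =>
        finitelyAffineOn_coord i univ
      have hb := (hc 2).sub ((hc 1).max (.const 0 univ))
      exact finitelyAffineOn_vec3 ((hc 1).add ((hb.const_mul (1 / 2)).congr
        (g := fun v : V3 => (v 2 - max (v 1) 0) / 2) fun v _ => by ring))
        (hb.const_mul (√3 / 2)) ((hc 0).add (.const c univ)))
    (by
      have : √3 ≠ 0 := by positivity
      intro v
      ext i
      fin_cases i
      · change v 0 - v 1 * (√3)⁻¹ + (2 * (√3)⁻¹ * v 1 + max (v 0 - v 1 * (√3)⁻¹) 0 -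
          max (v 0 - v 1 * (√3)⁻¹) 0) / 2 = v 0
        ring
      · change √3 / 2 * (2 * (√3)⁻¹ * v 1 + max (v 0 - v 1 * (√3)⁻¹) 0 -
          max (v 0 - v 1 * (√3)⁻¹) 0) = v 1
        field_simp
        ring
      · exact sub_add_cancel _ _)
    (by
      have h3 : √3 ≠ 0 := by positivity
      intro v
      have h1 : v 1 + (v 2 - max (v 1) 0) / 2 - √3 / 2 * (v 2 - max (v 1) 0) * (√3)⁻¹ = v 1 := by
        field_simp
        ring
      ext i
      fin_cases i
      · exact add_sub_cancel_right _ _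
      · exact h1
      · change 2 * (√3)⁻¹ * (√3 / 2 * (v 2 - max (v 1) 0)) + max (v 1 + (v 2 - max (v 1) 0) / 2 -
          √3 / 2 * (v 2 - max (v 1) 0) * (√3)⁻¹) 0 = v 2
        rw [h1]
        field_simp
        ring)

theorem spineCone_three : SpineCone 3 tripod sector := by
  refine ⟨?_, ?_, ?_, ?_, fun ζ hζ z => eq_one_of_mul_mem_sector 3 (by norm_num) hζ,
    exists_sector_chart, ?_, ?_, bookModel, Or.inr rfl, fun c => ⟨tripodModel c, ?_, ?_⟩⟩
  · exact (isClosed_eq (continuous_hexB.add (continuous_hexA.max continuous_const))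
      continuous_const).union
      ((isClosed_eq continuous_hexA continuous_const).inter
        (isClosed_le continuous_const continuous_hexB))
  · intro ζ hζ z hz
    have := hex_mul_of_cube hζ z
    simp only [tripod, mem_ofPred_eq] at hz ⊢
    grind
  · rintro z ⟨h1, h2⟩ hz
    simp only [tripod, mem_ofPred_eq] at hz
    grind
  · intro z hz
    obtain ⟨⟨ζ, hζ, hA, hB⟩, ξ, hξ, hA', hB'⟩ := exists_hex_mul_eq z
    simp only [tripod, mem_ofPred_eq] at hz
    by_cases h1 : z ∈ sector
    · exact ⟨1, one_pow _, by rwa [one_mul]⟩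
    by_cases h2 : ζ * z ∈ sector
    · exact ⟨ζ, hζ, h2⟩
    refine ⟨ξ, hξ, ?_⟩
    simp only [sector, mem_ofPred_eq, hA, hB, hA', hB'] at h1 h2 ⊢
    grind
  · intro z hz
    rw [mem_sector_neg] at hz
    simp only [tripod, mem_ofPred_eq]
    grind
  · intro z hz hz0
    obtain ⟨⟨ζ, hζ, hA, hB⟩, ξ, hξ, hA', hB'⟩ := exists_hex_mul_eq z
    have h0 : ¬ (hexA z = 0 ∧ hexB z = 0) := fun h => hz0
      (eq_of_hex (by rw [h.1]; simp [hexA]) (by rw [h.2]; simp [hexB]))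
    simp only [tripod, mem_ofPred_eq] at hz
    by_cases h1 : -z ∈ sector
    · exact ⟨1, one_pow _, by rwa [one_mul]⟩
    by_cases h2 : -(ζ * z) ∈ sector
    · exact ⟨ζ, hζ, h2⟩
    refine ⟨ξ, hξ, ?_⟩
    simp only [mem_sector_neg, hA, hB, hA', hB'] at h1 h2 ⊢
    grind
  · ext i
    fin_cases i
    · exact sub_self c
    · change (0 : ℝ) - 0 * (√3)⁻¹ = 0
      ring
    · change 2 * (√3)⁻¹ * 0 + max (0 - 0 * (√3)⁻¹) 0 = (0 : ℝ)
      simp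
  · intro x y t
    have hA : hexA ⟨x, y⟩ = x - y * (√3)⁻¹ := by simp [hexA, div_eq_mul_inv]
    have hB : hexB ⟨x, y⟩ = 2 * (√3)⁻¹ * y := by simp only [hexB]; ring
    change (hexB ⟨x, y⟩ + max (hexA ⟨x, y⟩) 0 = 0 ∨ hexA ⟨x, y⟩ = 0 ∧ 0 ≤ hexB ⟨x, y⟩) ↔
      (2 * (√3)⁻¹ * y + max (x - y * (√3)⁻¹) 0 = 0 ∨
        x - y * (√3)⁻¹ = 0 ∧ 0 ≤ 2 * (√3)⁻¹ * y + max (x - y * (√3)⁻¹) 0)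
    rw [hA, hB]
    refine or_congr Iff.rfl (and_congr_right fun h => ?_)
    rw [h, max_self, add_zero]

end Orbifold3

end

theorem mainTheorem9 :
    (∀ (p : ℕ) (hp : 1 ≤ p),
      ((sphereCyclic p hp).complexity = ((p - 1 : ℕ) : ℕ∞) ∧
        (projectiveFibre p hp).complexity = ((p - 1 : ℕ) : ℕ∞) ∧
        (lensThreeFibre p hp).complexity = ((p - 1 : ℕ) : ℕ∞)) ∧
      (∀ P, (sphereCyclic p hp).IsMinimalSpine P → ¬ (sphereCyclic p hp).IsSpecial P) ∧
      (∀ P, (projectiveFibre p hp).IsMinimalSpine P → ¬ (projectiveFibre p hp).IsSpecial P) ∧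
      (∀ P, (lensThreeFibre p hp).IsMinimalSpine P → ¬ (lensThreeFibre p hp).IsSpecial P)) ∧
    (∀ (p q r : ℕ) (h : Admissible p q r),
      (sphereVertex p q r h).complexity = (((p - 1) + (q - 1) + (r - 1) : ℕ) : ℕ∞) ∧
      ∀ P, (sphereVertex p q r h).IsMinimalSpine P → ¬ (sphereVertex p q r h).IsSpecial P) := by
  refine ⟨fun p hp => ?_, fun p q r h => sphereVertex_complexity h⟩
  obtain ⟨h1, h1'⟩ := sphereCyclic_complexity hp
  obtain ⟨h2, h2'⟩ := spineCone_two.complexity (by norm_num) hp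
  obtain ⟨h3, h3'⟩ := spineCone_three.complexity (by norm_num) hp
  exact ⟨⟨h1, h2, h3⟩, h1', h2', h3'⟩
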